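/- **Setting.** Let $n\ge 2$ and let $\Omega\subset\mathbb R^n$ be a bounded connected $\mathcal C^{1,1}$ domain with connected complement, $\Gamma=\partial\Omega$, with outward unit normal $\nu$ and surface measure $\sigma$. For $j=1,2$ let $A_j\in\mathcal C^1(\overline\Omega,\mathbb R^n)$, $V_j\in L^\infty(\Omega,\mathbb R)$, and let $H_j=(-{\rm i}\nabla+A_j)^2+V_j$ act on $L^2(\Omega)$ with domain $D(H_j)=\{v\in H^1_0(\Omega):(-{\rm i}\nabla+A_j)^2v\in L^2(\Omega)\}$. Write $x\cdot y=\sum_k x_ky_k$ for $x,y\in\mathbb C^n$. Let $\lambda\in\mathbb C\setminus\mathbb R$, let $\sqrt\lambda$ be either of the two square roots of $\lambda$, let $\eta_1,\eta_2\in\mathbb S^{n-1}$, let $A_{j,\sharp}\in\mathcal C_0^\infty(\mathbb R^n,\mathbb R^n)$, $j=1,2$, and let $b_2\in W^{2,\infty}(\mathbb R^n)$ be complex valued with $\eta_2\cdot\nabla b_2=0$. Put $$\psi_j(x)=-\int_{-\infty}^0\eta_j\cdot A_{j,\sharp}(x+s\eta_j)\,ds,\qquad \Phi_1(x)=e^{{\rm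 i}\sqrt\lambda\,\eta_1\cdot x}e^{{\rm i}\psi_1(x)},\qquad \Phi_2(x)=e^{-{\rm i}\sqrt\lambda\,\eta_2\cdot x}b_2(x)e^{-{\rm i}\psi_2(x)}.$$ For $f\in H^{1/2}(\Gamma)$ let $\Lambda_{j,\lambda}f=(\partial_\nu+{\rm i}A_j\cdot\nu)u|_\Gamma=\big((\nabla+{\rm i}A_j)u\big)\cdot\nu\in H^{-1/2}(\Gamma)$, where $u\in H^1(\Omega)$ solves $(-{\rm i}\nabla+A_j)^2u+V_ju-\lambda u=0$ in $\Omega$, $u=f$ on $\Gamma$. The normal trace of a field $X\in L^2(\Omega;\mathbb C^n)$ with $\operatorname{div}X\in L^2(\Omega)$ is the element $X\cdot\nu$ of $H^{-1/2}(\Gamma)$ given by $\langle X\cdot\nu,w|_\Gamma\rangle=\int_\Omega X\cdot\overline{\nabla w}\,dx+\int_\Omega(\operatorname{div}X)\,\overline w\,dx$ for $w\in H^1(\Omega)$. Set $S_j=\langle\Lambda_{j,\lambda}\Phi_1,\overline{\Phi_2}\rangle$. **Proposition.** For $j=1,2$, $H_j-\lambda:D(H_j)\to L^2(\Omega)$ is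 bijective, the Dirichlet problem defining $\Lambda_{j,\lambda}\Phi_1$ has a unique solution in $H^1(\Omega)$, and $$\begin{aligned}S_1={}&2\sqrt\lambda\int_\Omega\eta_2\cdot(A_1-A_{2,\sharp})\,e^{{\rm i}\sqrt\lambda(\eta_1-\eta_2)\cdot x}\,b_2\,e^{{\rm i}(\psi_1-\psi_2)}dx+\int_\Omega(V_1b_2-q_{12})\,e^{{\rm i}\sqrt\lambda(\eta_1-\eta_2)\cdot x}e^{{\rm i}(\psi_1-\psi_2)}dx\\ &-{\rm i}\int_\Gamma e^{{\rm i}\sqrt\lambda(\eta_1-\eta_2)\cdot x}e^{{\rm i}(\psi_1-\psi_2)}\big(b_2\sqrt\lambda\,\eta_2+b_2\nabla\psi_2+{\rm i}\nabla b_2+b_2A_1\big)\cdot\nu\,d\sigma(x)\\ &-\int_\Omega\Big[(H_1-\lambda)^{-1}\big(2\sqrt\lambda\,\eta_1\cdot(A_1-A_{1,\sharp})+q_{11}\big)\Phi_1\Big]\big(2\sqrt\lambda\,\eta_2\cdot(A_1-A_{2,\sharp})b_2+V_1b_2-q_{12}\big)e^{-{\rm i}\sqrt\lambda\,\eta_2\cdot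 x}e^{-{\rm i}\psi_2}dx,\end{aligned}$$ $$\begin{aligned}S_2={}&\int_\Omega\big[2\sqrt\lambda\,\eta_2\cdot(A_2-A_{2,\sharp})b_2+V_2b_2-q_{22}\big]e^{{\rm i}\sqrt\lambda(\eta_1-\eta_2)\cdot x}e^{{\rm i}(\psi_1-\psi_2)}dx\\ &-{\rm i}\int_\Gamma e^{{\rm i}\sqrt\lambda(\eta_1-\eta_2)\cdot x}e^{{\rm i}(\psi_1-\psi_2)}\big(b_2\sqrt\lambda\,\eta_2+b_2\nabla\psi_2+{\rm i}\nabla b_2+b_2A_2\big)\cdot\nu\,d\sigma(x)\\ &-\int_\Omega\Big[(H_2-\lambda)^{-1}\big(2\sqrt\lambda\,\eta_1\cdot(A_2-A_{1,\sharp})+q_{21}\big)\Phi_1\Big]\big(2\sqrt\lambda\,\eta_2\cdot(A_2-A_{2,\sharp})b_2+V_2b_2-q_{22}\big)e^{-{\rm i}\sqrt\lambda\,\eta_2\cdot x}e^{-{\rm i}\psi_2}dx,\end{aligned}$$ where, for $j=1,2$, $$q_{j1}=-{\rm i}\operatorname{div}A_j+|A_j|^2+V_j+2A_j\cdot\nabla\psi_1-{\rm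 i}\Delta\psi_1+|\nabla\psi_1|^2,$$ $$q_{j2}=\Delta b_2-2{\rm i}\nabla\psi_2\cdot\nabla b_2-2{\rm i}\nabla b_2\cdot A_j+\big(-{\rm i}\Delta\psi_2-|\nabla\psi_2|^2-2\nabla\psi_2\cdot A_j-{\rm i}\operatorname{div}A_j-|A_j|^2\big)b_2.$$ -/

import Mathlib

open MeasureTheory Set Filter Topology TopologicalSpace Matrix
open scoped ContDiff NNReal ENNReal Distributions ComplexConjugate

noncomputable section

namespace MagneticSchrodinger

/-- The Euclidean space `ℝⁿ`. -/
abbrev Euc (n : ℕ) : Type := EuclideanSpace ℝ (Fin n)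

/-! ### Domains, outward normal, surface measure -/

/-- The boundary of `Ω` is of class `C^{1,1}`: near each boundary point, in suitable orthonormal
coordinates, `Ω` is the region below the graph of a `C¹` function with Lipschitz derivative. -/
def HasC11Boundary {n : ℕ} (Ω : Set (Euc n)) : Prop :=
  ∀ x₀ ∈ frontier Ω,
    ∃ (T : Euc n ≃ₗᵢ[ℝ] WithLp 2 (Euc (n - 1) × ℝ)) (γ : Euc (n - 1) → ℝ) (K : ℝ≥0)
      (U : Set (Euc n)),
      ContDiff ℝ 1 γ ∧ LipschitzWith K (fderiv ℝ γ) ∧ IsOpen U ∧ x₀ ∈ U ∧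
        ∀ x ∈ U, x ∈ Ω ↔ (T x).snd < γ (T x).fst

/-- Bounded connected `C^{1,1}` domains with connected complement. -/
structure IsAdmissibleDomain {n : ℕ} (Ω : Opens (Euc n)) : Prop where
  bounded : Bornology.IsBounded (Ω : Set (Euc n))
  connected : IsConnected (Ω : Set (Euc n))
  connected_compl : IsConnected ((Ω : Set (Euc n))ᶜ)
  c11 : HasC11Boundary (Ω : Set (Euc n))

/-- `v` is the outward unit normal vector to `∂Ω` at `x`: to first order at `x`, the set `Ω` is the
half space `{y | ⟨v, y - x⟩ < 0}`. -/
def IsOutwardUnitNormal {n : ℕ} (Ω : Set (Euc n)) (x v : Euc n) : Prop :=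
  ‖v‖ = 1 ∧ ∀ ε > 0, ∀ᶠ y in 𝓝 x,
    (y ∈ Ω → inner ℝ v (y - x) ≤ ε * ‖y - x‖) ∧
    (y ∉ Ω → -(ε * ‖y - x‖) ≤ inner ℝ v (y - x))

open Classical in
/-- The outward unit normal vector field `ν` (zero where there is none). -/
def outwardNormal {n : ℕ} (Ω : Set (Euc n)) (x : Euc n) : Euc n :=
  if h : ∃ v, IsOutwardUnitNormal Ω x v then h.choose else 0

/-- The surface measure `σ` on `∂Ω`: the `(n-1)`-dimensional Hausdorff measure, normalized so as to
agree with Lebesgue measure on `(n-1)`-dimensional subspaces. -/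
def surfaceMeasure {n : ℕ} (Ω : Set (Euc n)) : Measure (Euc n) :=
  (Measure.euclideanHausdorffMeasure (n - 1)).restrict (frontier Ω)

/-! ### Vector calculus; the product `x · y = ∑ xₖ yₖ` on `ℂⁿ` is `x ⬝ᵥ y` -/

/-- A real vector seen in `ℂⁿ`. -/
def toC {n : ℕ} (v : Euc n) : Fin n → ℂ := fun k => ((v k : ℝ) : ℂ)

/-- `η · x` for real vectors, as a complex number. -/
def rdot {n : ℕ} (η x : Euc n) : ℂ := ((inner ℝ η x : ℝ) : ℂ)

/-- The (classical) gradient of a complex-valued function on `ℝⁿ`. -/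
def grad {n : ℕ} (f : Euc n → ℂ) (x : Euc n) : Fin n → ℂ :=
  fun k => fderiv ℝ f x (EuclideanSpace.single k 1)

/-- The divergence of a real vector field. -/
def divergence {n : ℕ} (A : Euc n → Euc n) (x : Euc n) : ℝ :=
  ∑ k, (fderiv ℝ A x (EuclideanSpace.single k 1)) k

/-- `W^{2,∞}(ℝⁿ)`, each class being represented by its `C¹` element: bounded `C¹` functions with
bounded and Lipschitz first derivatives. -/
structure IsW2Infty {n : ℕ} (b : Euc n → ℂ) : Prop where
  contDiff : ContDiff ℝ 1 b
  bounded : ∃ C : ℝ, ∀ x, ‖b x‖ ≤ C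
  bounded_fderiv : ∃ C : ℝ, ∀ x, ‖fderiv ℝ b x‖ ≤ C
  lipschitz_fderiv : ∃ K : ℝ≥0, LipschitzWith K (fderiv ℝ b)

/-! ### Sobolev spaces -/

/-- `L²(Ω)` with complex values. -/
abbrev L2 {n : ℕ} (Ω : Opens (Euc n)) : Type := Lp ℂ 2 (volume.restrict (Ω : Set (Euc n)))

open Classical in
/-- The class in `L²(Ω)` of a square integrable function (zero for other functions). -/
def toL2 {n : ℕ} (Ω : Opens (Euc n)) (f : Euc n → ℂ) : L2 Ω :=
  if h : MemLp f 2 (volume.restrict (Ω : Set (Euc n))) then h.toLp f else 0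

/-- `∂ₖ u = g` in the sense of distributions on `Ω`. -/
def HasWeakPartial {n : ℕ} {Ω : Opens (Euc n)} (k : Fin n) (u g : L2 Ω) : Prop :=
  ∀ φ : 𝓓(Ω, ℂ), ∫ x in (Ω : Set (Euc n)), u x * grad φ x k
    = -∫ x in (Ω : Set (Euc n)), g x * φ x

/-- `u ∈ H¹(Ω)`. -/
def MemH1 {n : ℕ} {Ω : Opens (Euc n)} (u : L2 Ω) : Prop :=
  ∀ k, ∃ g : L2 Ω, HasWeakPartial k u g

open Classical in
/-- The weak partial derivative `∂ₖ u ∈ L²(Ω)` (zero if there is none). -/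
def weakPartial {n : ℕ} {Ω : Opens (Euc n)} (k : Fin n) (u : L2 Ω) : L2 Ω :=
  if h : ∃ g : L2 Ω, HasWeakPartial k u g then h.choose else 0

/-- `u ∈ H¹₀(Ω)`, the closure of `C_c^∞(Ω)` in `H¹(Ω)`. -/
def MemH10 {n : ℕ} {Ω : Opens (Euc n)} (u : L2 Ω) : Prop :=
  MemH1 u ∧ ∀ ε > 0, ∃ φ : 𝓓(Ω, ℂ), ‖u - toL2 Ω φ‖ ≤ ε ∧
    ∀ k, ‖weakPartial k u - toL2 Ω (fun x => grad φ x k)‖ ≤ ε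

/-- `div X = d` in the sense of distributions on `Ω`. -/
def HasWeakDiv {n : ℕ} {Ω : Opens (Euc n)} (X : Fin n → L2 Ω) (d : L2 Ω) : Prop :=
  ∀ φ : 𝓓(Ω, ℂ), ∑ k, ∫ x in (Ω : Set (Euc n)), X k x * grad φ x k
    = -∫ x in (Ω : Set (Euc n)), d x * φ x

open Classical in
/-- The divergence in `L²(Ω)` of a field `X ∈ H_div(Ω)` (zero for other fields). -/
def weakDiv {n : ℕ} {Ω : Opens (Euc n)} (X : Fin n → L2 Ω) : L2 Ω :=
  if h : ∃ d : L2 Ω, HasWeakDiv X d then h.choose else 0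

/-- The pairing `⟨X · ν, w⟩` between the normal trace `X · ν ∈ H^{-1/2}(∂Ω)` of a field
`X ∈ H_div(Ω)` and the boundary value in `H^{1/2}(∂Ω)` of `w ∈ H¹(Ω)`, antilinear in `w`. -/
def normalTracePairing {n : ℕ} {Ω : Opens (Euc n)} (X : Fin n → L2 Ω) (w : L2 Ω) : ℂ :=
  (∑ k, ∫ x in (Ω : Set (Euc n)), X k x * conj (weakPartial k w x))
    + ∫ x in (Ω : Set (Euc n)), weakDiv X x * conj (w x)

/-! ### The magnetic Schrödinger operator, its resolvent and its Dirichlet-to-Neumann map -/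

/-- `(-i∇ + A)² u + V u = f` in the sense of distributions on `Ω`, for `u ∈ H¹(Ω)`. -/
def SolvesMagnetic {n : ℕ} {Ω : Opens (Euc n)} (A : Euc n → Euc n) (V : Euc n → ℝ)
    (u f : L2 Ω) : Prop :=
  MemH1 u ∧ ∀ φ : 𝓓(Ω, ℂ),
    (∑ k, ∫ x in (Ω : Set (Euc n)),
        (-Complex.I * weakPartial k u x + toC (A x) k * u x) *
          (Complex.I * grad φ x k + toC (A x) k * φ x))
      + ∫ x in (Ω : Set (Euc n)), (V x : ℂ) * u x * φ x
    = ∫ x in (Ω : Set (Euc n)), f x * φ x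

/-- The graph of the operator `H = (-i∇ + A)² + V` acting on `L²(Ω)` with domain
`D(H) = {v ∈ H¹₀(Ω) : (-i∇ + A)² v ∈ L²(Ω)}`: the pairs `(v, H v)` with `v ∈ D(H)`. -/
def schrodingerGraph {n : ℕ} (Ω : Opens (Euc n)) (A : Euc n → Euc n) (V : Euc n → ℝ) :
    Set (L2 Ω × L2 Ω) :=
  {p | MemH10 p.1 ∧ SolvesMagnetic A V p.1 p.2}

/-- `H - lam` is a bijection from `D(H)` onto `L²(Ω)`. -/
def ResolventExists {n : ℕ} (Ω : Opens (Euc n)) (A : Euc n → Euc n) (V : Euc n → ℝ)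
    (lam : ℂ) : Prop :=
  ∀ f : L2 Ω, ∃! v : L2 Ω, (v, f + lam • v) ∈ schrodingerGraph Ω A V

open Classical in
/-- The resolvent `(H - lam)⁻¹`: it sends `f` to the `v ∈ D(H)` with `H v - lam v = f`. -/
def schrodingerResolvent {n : ℕ} (Ω : Opens (Euc n)) (A : Euc n → Euc n) (V : Euc n → ℝ)
    (lam : ℂ) (f : L2 Ω) : L2 Ω :=
  if h : ∃ v : L2 Ω, (v, f + lam • v) ∈ schrodingerGraph Ω A V then h.choose else 0

/-- `u ∈ H¹(Ω)` solves `(-i∇ + A)² u + V u - lam u = 0` in `Ω` with `u = F` on `∂Ω`, the boundary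
datum in `H^{1/2}(∂Ω)` being given as the boundary value of `F ∈ H¹(Ω)`. -/
def IsDirichletSolution {n : ℕ} {Ω : Opens (Euc n)} (A : Euc n → Euc n) (V : Euc n → ℝ)
    (lam : ℂ) (F u : L2 Ω) : Prop :=
  SolvesMagnetic A V u (lam • u) ∧ MemH10 (u - F)

open Classical in
/-- The solution of the Dirichlet problem with boundary datum `F`. -/
def dirichletSolution {n : ℕ} {Ω : Opens (Euc n)} (A : Euc n → Euc n) (V : Euc n → ℝ)
    (lam : ℂ) (F : L2 Ω) : L2 Ω :=
  if h : ∃ u : L2 Ω, IsDirichletSolution A V lam F u then h.choose else 0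

/-- The field `(∇ + iA) u`. -/
def covariantGrad {n : ℕ} {Ω : Opens (Euc n)} (A : Euc n → Euc n) (u : L2 Ω) : Fin n → L2 Ω :=
  fun k => toL2 Ω (fun x => weakPartial k u x + Complex.I * toC (A x) k * u x)

/-- The pairing `⟨Λ F, w⟩` of the Dirichlet-to-Neumann map
`Λ F = (∂_ν + i A·ν) u = ((∇ + iA) u) · ν ∈ H^{-1/2}(∂Ω)` with the boundary value of `w ∈ H¹(Ω)`,
where `u` solves the Dirichlet problem with boundary datum `F`. -/
def dnPairing {n : ℕ} {Ω : Opens (Euc n)} (A : Euc n → Euc n) (V : Euc n → ℝ)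
    (lam : ℂ) (F w : L2 Ω) : ℂ :=
  normalTracePairing (covariantGrad A (dirichletSolution A V lam F)) w

/-! ### The ansatz functions; `r` stands for `√lam` -/

/-- The (real) phase `ψ(x) = -∫_{-∞}^0 η · A♯(x + sη) ds`, as a complex-valued function. -/
def phase {n : ℕ} (η : Euc n) (As : Euc n → Euc n) (x : Euc n) : ℂ :=
  ((-∫ s in Iic (0 : ℝ), inner ℝ η (As (x + s • η)) : ℝ) : ℂ)

/-- `Φ₁(x) = e^{i r η₁·x} e^{iψ₁(x)}`. -/
def ansatz₁ {n : ℕ} (r : ℂ) (η₁ : Euc n) (ψ₁ : Euc n → ℂ) (x : Euc n) : ℂ :=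
  Complex.exp (Complex.I * r * rdot η₁ x) * Complex.exp (Complex.I * ψ₁ x)

/-- `e^{-i r η₂·x} e^{-iψ₂(x)}`. -/
def expFactor₂ {n : ℕ} (r : ℂ) (η₂ : Euc n) (ψ₂ : Euc n → ℂ) (x : Euc n) : ℂ :=
  Complex.exp (-Complex.I * r * rdot η₂ x) * Complex.exp (-Complex.I * ψ₂ x)

/-- `Φ₂(x) = e^{-i r η₂·x} b₂(x) e^{-iψ₂(x)}`. -/
def ansatz₂ {n : ℕ} (r : ℂ) (η₂ : Euc n) (b₂ ψ₂ : Euc n → ℂ) (x : Euc n) : ℂ :=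
  Complex.exp (-Complex.I * r * rdot η₂ x) * b₂ x * Complex.exp (-Complex.I * ψ₂ x)

/-- `e^{i r (η₁ - η₂)·x} e^{i(ψ₁(x) - ψ₂(x))}`. -/
def expFactor₁₂ {n : ℕ} (r : ℂ) (η₁ η₂ : Euc n) (ψ₁ ψ₂ : Euc n → ℂ) (x : Euc n) : ℂ :=
  Complex.exp (Complex.I * r * rdot (η₁ - η₂) x) * Complex.exp (Complex.I * (ψ₁ x - ψ₂ x))

/-- `S = ⟨Λ Φ₁, conj Φ₂⟩`. -/
def pairingS {n : ℕ} (Ω : Opens (Euc n)) (A : Euc n → Euc n) (V : Euc n → ℝ)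
    (lam r : ℂ) (η₁ η₂ : Euc n) (b₂ ψ₁ ψ₂ : Euc n → ℂ) : ℂ :=
  dnPairing A V lam (toL2 Ω (ansatz₁ r η₁ ψ₁)) (toL2 Ω (fun x => conj (ansatz₂ r η₂ b₂ ψ₂ x)))

/-- `-i div A + |A|² + V + 2 A·∇ψ₁ - i Δψ₁ + |∇ψ₁|²`. -/
def q₁ {n : ℕ} (A : Euc n → Euc n) (V : Euc n → ℝ) (ψ₁ : Euc n → ℂ) (x : Euc n) : ℂ :=
  -Complex.I * divergence A x + (‖A x‖ : ℂ) ^ 2 + V x + 2 * (toC (A x) ⬝ᵥ grad ψ₁ x)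
    - Complex.I * Laplacian.laplacian ψ₁ x + grad ψ₁ x ⬝ᵥ grad ψ₁ x

/-- `Δb₂ - 2i ∇ψ₂·∇b₂ - 2i ∇b₂·A + (-iΔψ₂ - |∇ψ₂|² - 2∇ψ₂·A - i div A - |A|²) b₂`. -/
def q₂ {n : ℕ} (A : Euc n → Euc n) (b₂ ψ₂ : Euc n → ℂ) (x : Euc n) : ℂ :=
  Laplacian.laplacian b₂ x - 2 * Complex.I * (grad ψ₂ x ⬝ᵥ grad b₂ x)
    - 2 * Complex.I * (grad b₂ x ⬝ᵥ toC (A x))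
    + (-Complex.I * Laplacian.laplacian ψ₂ x - grad ψ₂ x ⬝ᵥ grad ψ₂ x
        - 2 * (grad ψ₂ x ⬝ᵥ toC (A x)) - Complex.I * divergence A x - (‖A x‖ : ℂ) ^ 2) * b₂ x

end MagneticSchrodinger

end

open MagneticSchrodinger

/-!
With the eikonal and transport equations satisfied by the phases `r η·x + ψ` and the amplitude `b`,
the operators `(-i∇ + A)²` and `(i∇ + A)²` multiply the modulated plane waves `Φ₁` and
`e^{-i r η₂·x} e^{-iψ₂}` by explicit functions, up to the eigenvalue `r²`. Hence the solution of the
Dirichlet problem with datum `Φ₁` is `Φ₁ - (H - r²)⁻¹ (2r η₁·(A - As₁) + q₁) Φ₁`. Green's formula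
moves the operator onto `Φ₂`; what is left is the pairing of this solution with the explicit
function that comes with `Φ₂`, and a boundary integral.

The resolvent exists because `Im r² ≠ 0` makes the sesquilinear form of `H - r²` coercive on `H¹₀`.
The fields `A` are Lipschitz up to the boundary and so extend to Lipschitz fields on `ℝⁿ`, which by
Rademacher's theorem can be differentiated almost everywhere. The divergence theorem for Lipschitz
fields is local: in a boundary chart, the integral over the region below a `C¹` graph of the
derivative in a direction transversal to the graph is an integral over the graph.
-/

namespace MagneticSchrodinger

/-! ### Calculus of locally Lipschitz functions -/

section Lipschitz

theorem locallyLipschitz_mul {X 𝔸 : Type*} [PseudoEMetricSpace X] [NormedRing 𝔸]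
    [NormedAlgebra ℝ 𝔸] {f g : X → 𝔸} (hf : LocallyLipschitz f) (hg : LocallyLipschitz g) :
    LocallyLipschitz fun x => f x * g x :=
  (contDiff_mul (𝕜 := ℝ) (n := 1)).locallyLipschitz.comp (hf.prodMk hg)

theorem exists_lipschitzWith_of_hasCompactSupport {X F : Type*} [MetricSpace X] [ProperSpace X]
    [NormedAddCommGroup F] {f : X → F} (hf : LocallyLipschitz f) (hc : HasCompactSupport f) :
    ∃ K, LipschitzWith K f := by
  set T := Metric.cthickening 1 (tsupport f)
  obtain ⟨K, hK⟩ := LocallyLipschitzOn.exists_lipschitzOnWith_of_compact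
    (hc.isCompact.cthickening : IsCompact T) hf.locallyLipschitzOn
  obtain ⟨M, hM⟩ := hf.continuous.bounded_above_of_compact_support hc
  have near {x y : X} (hx : x ∈ tsupport f) (hxy : dist x y < 1) :
      dist (f x) (f y) ≤ K * dist x y :=
    hK.dist_le_mul x (Metric.self_subset_cthickening _ hx) y
      (Metric.mem_cthickening_of_dist_le y x 1 _ hx (by rw [dist_comm]; exact hxy.le))
  refine ⟨K + (2 * M).toNNReal, LipschitzWith.of_dist_le_mul fun x y => ?_⟩
  rw [NNReal.coe_add, add_mul]
  rcases lt_or_ge (dist x y) 1 with hxy | hxy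
  · refine le_add_of_le_of_nonneg ?_ (by positivity)
    by_cases hx : x ∈ tsupport f
    · exact near hx hxy
    by_cases hy : y ∈ tsupport f
    · rw [dist_comm, dist_comm x]
      exact near hy (by rwa [dist_comm])
    · rw [image_eq_zero_of_notMem_tsupport hx, image_eq_zero_of_notMem_tsupport hy, dist_self]
      positivity
  · refine le_add_of_nonneg_of_le (by positivity) ?_
    calc dist (f x) (f y) ≤ ‖f x‖ + ‖f y‖ := dist_le_norm_add_norm _ _
      _ ≤ (2 * M).toNNReal * 1 := by linarith [hM x, hM y, Real.le_coe_toNNReal (2 * M)]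
      _ ≤ (2 * M).toNNReal * dist x y := by gcongr

variable {E : Type*} [NormedAddCommGroup E] [NormedSpace ℝ E] [FiniteDimensional ℝ E]
  {F : Type*} [NormedAddCommGroup F] [NormedSpace ℝ F]

theorem exists_norm_fderiv_le_of_locallyLipschitz {f : E → F} (hf : LocallyLipschitz f)
    {s : Set E} (hs : Bornology.IsBounded s) : ∃ C : ℝ, ∀ x ∈ s, ‖fderiv ℝ f x‖ ≤ C := by
  obtain ⟨R, hR⟩ := hs.subset_ball 0
  have : ProperSpace E := FiniteDimensional.proper ℝ E
  obtain ⟨K, hK⟩ := LocallyLipschitzOn.exists_lipschitzOnWith_of_compact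
    (isCompact_closedBall (0 : E) R) hf.locallyLipschitzOn
  exact ⟨K, fun x hx => norm_fderiv_le_of_lipschitzOn ℝ
    (mem_of_superset (Metric.isOpen_ball.mem_nhds (hR hx)) Metric.ball_subset_closedBall) hK⟩

variable [MeasurableSpace E] [BorelSpace E] (μ : Measure E) [μ.IsAddHaarMeasure]

theorem integrable_fderiv_of_locallyLipschitz [FiniteDimensional ℝ F] {f : E → F}
    (hf : LocallyLipschitz f) (hc : HasCompactSupport f) (v : E) :
    Integrable (fun x => fderiv ℝ f x v) μ := by
  obtain ⟨C, hC⟩ := exists_norm_fderiv_le_of_locallyLipschitz hf hc.isCompact.isBounded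
  have : CompleteSpace F := FiniteDimensional.complete ℝ F
  have : ProperSpace F := FiniteDimensional.proper ℝ F
  borelize F
  have hbound : Integrable ((tsupport f).indicator fun _ => C * ‖v‖) μ :=
    (integrable_indicator_iff (isClosed_tsupport f).measurableSet).2
      (integrableOn_const hc.isCompact.measure_lt_top.ne)
  refine hbound.mono' (measurable_fderiv_apply_const ℝ f v).aestronglyMeasurable
    (ae_of_all _ fun x => ?_)
  by_cases hx : x ∈ tsupport f
  · rw [indicator_of_mem hx]
    exact (fderiv ℝ f x).le_of_opNorm_le (hC x hx) v
  · rw [indicator_of_notMem hx, fderiv_of_notMem_tsupport ℝ hx, _root_.zero_apply, norm_zero]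

theorem ae_differentiableAt_of_locallyLipschitz [FiniteDimensional ℝ F] {f : E → F}
    (hf : LocallyLipschitz f) : ∀ᵐ x ∂μ, DifferentiableAt ℝ f x := by
  have : ProperSpace E := FiniteDimensional.proper ℝ E
  have on_ball (m : ℕ) : ∀ᵐ x ∂μ, x ∈ Metric.ball (0 : E) m → DifferentiableAt ℝ f x := by
    obtain ⟨K, hK⟩ := LocallyLipschitzOn.exists_lipschitzOnWith_of_compact
      (isCompact_closedBall (0 : E) m) hf.locallyLipschitzOn
    filter_upwards [hK.ae_differentiableWithinAt_of_mem (μ := μ)] with x hx hxm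
    exact (hx (Metric.ball_subset_closedBall hxm)).differentiableAt
      (mem_of_superset (Metric.isOpen_ball.mem_nhds hxm) Metric.ball_subset_closedBall)
  filter_upwards [ae_all_iff.2 on_ball] with x hx
  obtain ⟨m, hm⟩ := exists_nat_gt ‖x‖
  exact hx m (mem_ball_zero_iff.2 hm)

theorem integral_fderiv_eq_zero_of_locallyLipschitz_real {f : E → ℝ} (hf : LocallyLipschitz f)
    (hc : HasCompactSupport f) (v : E) : ∫ x, fderiv ℝ f x v ∂μ = 0 := by
  have : ProperSpace E := FiniteDimensional.proper ℝ E
  obtain ⟨K, hK⟩ := exists_lipschitzWith_of_hasCompactSupport hf hc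
  have by_parts := (LipschitzWith.const (1 : ℝ)).integral_lineDeriv_mul_eq (μ := μ) hK hc (-v)
  simp only [lineDeriv, deriv_const, neg_neg, mul_one, zero_mul, integral_zero] at by_parts
  rw [by_parts]
  refine integral_congr_ae ?_
  filter_upwards [ae_differentiableAt_of_locallyLipschitz μ hf] with x hx
  exact hx.lineDeriv_eq_fderiv.symm

theorem integral_fderiv_eq_zero_of_locallyLipschitz [FiniteDimensional ℝ F] {f : E → F}
    (hf : LocallyLipschitz f) (hc : HasCompactSupport f) (v : E) :
    ∫ x, fderiv ℝ f x v ∂μ = 0 := by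
  have : CompleteSpace F := FiniteDimensional.complete ℝ F
  refine SeparatingDual.eq_zero_of_forall_dual_eq_zero (R := ℝ) fun L => ?_
  rw [← L.integral_comp_comm (integrable_fderiv_of_locallyLipschitz μ hf hc v),
    ← integral_fderiv_eq_zero_of_locallyLipschitz_real μ
      (L.lipschitz.locallyLipschitz.comp hf) (hc.comp_left (map_zero L)) v]
  refine integral_congr_ae ?_
  filter_upwards [ae_differentiableAt_of_locallyLipschitz μ hf] with x hx
  rw [(L.hasFDerivAt.comp x hx.hasFDerivAt).fderiv, ContinuousLinearMap.comp_apply]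

variable {𝔸 : Type*} [NormedCommRing 𝔸] [NormedAlgebra ℝ 𝔸] [FiniteDimensional ℝ 𝔸]

theorem integrable_fderiv_mul_of_locallyLipschitz {f g : E → 𝔸} (hf : LocallyLipschitz f)
    (hg : Continuous g) (hc : HasCompactSupport g) (v : E) :
    Integrable (fun x => fderiv ℝ f x v * g x) μ := by
  obtain ⟨C, hC⟩ := exists_norm_fderiv_le_of_locallyLipschitz hf hc.isCompact.isBounded
  have : CompleteSpace 𝔸 := FiniteDimensional.complete ℝ 𝔸
  have : ProperSpace 𝔸 := FiniteDimensional.proper ℝ 𝔸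
  borelize 𝔸
  have hbound : Integrable (fun x => C * ‖v‖ * ‖g x‖) μ :=
    (hg.norm.integrable_of_hasCompactSupport hc.norm).const_mul _
  refine hbound.mono' ((measurable_fderiv_apply_const ℝ f v).mul
    hg.measurable).aestronglyMeasurable (ae_of_all _ fun x => ?_)
  by_cases hx : x ∈ tsupport g
  · refine (norm_mul_le _ _).trans ?_
    gcongr
    exact (fderiv ℝ f x).le_of_opNorm_le (hC x hx) v
  · rw [image_eq_zero_of_notMem_tsupport hx, mul_zero, norm_zero, mul_zero]

theorem integral_fderiv_mul_of_locallyLipschitz {f g : E → 𝔸} (hf : LocallyLipschitz f)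
    (hg : LocallyLipschitz g) (hc : HasCompactSupport g) (v : E) :
    ∫ x, fderiv ℝ f x v * g x ∂μ = -∫ x, f x * fderiv ℝ g x v ∂μ := by
  have leibniz : ∀ᵐ x ∂μ, fderiv ℝ (fun x => f x * g x) x v
      = fderiv ℝ f x v * g x + f x * fderiv ℝ g x v := by
    filter_upwards [ae_differentiableAt_of_locallyLipschitz μ hf,
      ae_differentiableAt_of_locallyLipschitz μ hg] with x hx hy
    rw [fderiv_fun_mul hx hy, _root_.add_apply, _root_.smul_apply,
      _root_.smul_apply, smul_eq_mul, smul_eq_mul]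
    ring
  have int_fg := integrable_fderiv_of_locallyLipschitz μ (locallyLipschitz_mul hf hg) hc.mul_left v
  have int_f := integrable_fderiv_mul_of_locallyLipschitz μ hf hg.continuous hc v
  have int_g : Integrable (fun x => f x * fderiv ℝ g x v) μ :=
    (int_fg.sub int_f).congr (leibniz.mono fun x hx => by
      simp only [Pi.sub_apply, hx, add_sub_cancel_left])
  have total := integral_fderiv_eq_zero_of_locallyLipschitz μ (locallyLipschitz_mul hf hg)
    hc.mul_left v
  rw [integral_congr_ae leibniz, integral_add int_f int_g] at total
  exact eq_neg_of_add_eq_zero_left total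

end Lipschitz

/-! ### Surface measure of a graph -/

section Area

theorem measure_le_of_locally_le {X : Type*} [TopologicalSpace X] [SecondCountableTopology X]
    [MeasurableSpace X] [OpensMeasurableSpace X] {μ ν : Measure X}
    (h : ∀ x, ∃ U : Set X, IsOpen U ∧ x ∈ U ∧ ∀ s ⊆ U, MeasurableSet s → ν s ≤ μ s) : ν ≤ μ := by
  rcases isEmpty_or_nonempty X with _ | _
  · exact Measure.le_iff.2 fun s _ => by simp only [s.eq_empty_of_isEmpty, measure_empty, le_rfl]
  choose U hUo hxU hU using h
  obtain ⟨t, htc, ht⟩ := TopologicalSpace.countable_cover_nhds fun x => (hUo x).mem_nhds (hxU x)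
  have ht0 : t.Nonempty := nonempty_iff_ne_empty.2 fun h0 => by
    simp only [h0, mem_empty_iff_false, iUnion_of_empty, iUnion_empty, empty_ne_univ] at ht
  obtain ⟨f, rfl⟩ := htc.exists_eq_range ht0
  set D := disjointed fun n => U (f n)
  have hDm : ∀ n, MeasurableSet (D n) :=
    MeasurableSet.disjointed fun n => (hUo _).measurableSet
  have hcov : ⋃ n, D n = univ := by rw [iUnion_disjointed, ← ht, biUnion_range]
  refine Measure.le_iff.2 fun s hs => ?_
  have hdisj : Pairwise (Function.onFun Disjoint fun n => s ∩ D n) :=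
    fun i j hij => (disjoint_disjointed _ hij).mono inter_subset_right inter_subset_right
  rw [← inter_univ s, ← hcov, inter_iUnion, measure_iUnion hdisj fun n => hs.inter (hDm n),
    measure_iUnion hdisj fun n => hs.inter (hDm n)]
  exact ENNReal.tsum_le_tsum fun n =>
    hU (f n) _ (inter_subset_right.trans (disjointed_subset _ _)) (hs.inter (hDm n))

theorem euclideanHausdorffMeasure_image_le_of_norm_sub_le {X W W' : Type*}
    [NormedAddCommGroup W] [MeasurableSpace W] [BorelSpace W]
    [NormedAddCommGroup W'] [MeasurableSpace W'] [BorelSpace W'] (d : ℕ)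
    {f : X → W} {g : X → W'} {s : Set X} {K : ℝ≥0}
    (h : ∀ x ∈ s, ∀ y ∈ s, ‖f x - f y‖ ≤ K * ‖g x - g y‖) :
    (Measure.euclideanHausdorffMeasure d : Measure W) (f '' s)
      ≤ (K : ℝ≥0∞) ^ d * (Measure.euclideanHausdorffMeasure d : Measure W') (g '' s) := by
  rcases s.eq_empty_or_nonempty with rfl | ⟨x₀, -⟩
  · simp
  have : Nonempty X := ⟨x₀⟩
  have hinv : ∀ x ∈ s, Function.invFunOn g s (g x) ∈ s ∧ g (Function.invFunOn g s (g x)) = g x :=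
    fun x hx => ⟨Function.invFunOn_mem ⟨x, hx, rfl⟩, Function.invFunOn_eq ⟨x, hx, rfl⟩⟩
  have himg : f '' s = (f ∘ Function.invFunOn g s) '' (g '' s) := by
    rw [image_image]
    refine image_congr fun x hx => ?_
    have := h x hx _ (hinv x hx).1
    rw [(hinv x hx).2, sub_self, norm_zero, mul_zero, norm_le_zero_iff, sub_eq_zero] at this
    exact this
  have hl : LipschitzOnWith K (f ∘ Function.invFunOn g s) (g '' s) := by
    refine LipschitzOnWith.of_dist_le_mul ?_
    rintro _ ⟨x, hx, rfl⟩ _ ⟨y, hy, rfl⟩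
    rw [dist_eq_norm, dist_eq_norm]
    have := h _ (hinv x hx).1 _ (hinv y hy).1
    rwa [(hinv x hx).2, (hinv y hy).2] at this
  rw [himg]
  simp only [Measure.euclideanHausdorffMeasure_def, Measure.smul_apply, ENNReal.smul_def,
    smul_eq_mul]
  have := hl.hausdorffMeasure_image_le (d := d) (by positivity)
  rw [ENNReal.rpow_natCast] at this
  calc _ ≤ _ := mul_le_mul_right this _
    _ = _ := by ring

/-- The linear map `x ↦ (x, a x)`, whose range is the graph of the linear form `a`. -/
noncomputable def graphLinear {E : Type*} [NormedAddCommGroup E] [NormedSpace ℝ E]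
    (a : E →L[ℝ] ℝ) : E →L[ℝ] WithLp 2 (E × ℝ) :=
  (WithLp.prodContinuousLinearEquiv 2 ℝ E ℝ).symm.toContinuousLinearMap ∘L
    ((ContinuousLinearMap.id ℝ E).prod a)

/-- The factor by which `graphLinear a` multiplies surface measure. -/
noncomputable def graphJacobian {E : Type*} [NormedAddCommGroup E] [NormedSpace ℝ E]
    (a : E →L[ℝ] ℝ) : ℝ :=
  √(1 + ‖a‖ ^ 2)

section Linear

variable {E : Type*} [NormedAddCommGroup E]

theorem graphLinear_apply [NormedSpace ℝ E] (a : E →L[ℝ] ℝ) (x : E) :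
    graphLinear a x = WithLp.toLp 2 (x, a x) := rfl

theorem norm_le_norm_graphLinear [NormedSpace ℝ E] (a : E →L[ℝ] ℝ) (x : E) :
    ‖x‖ ≤ ‖graphLinear a x‖ := by
  rw [graphLinear_apply, WithLp.prod_norm_eq_of_L2]
  exact Real.le_sqrt_of_sq_le (le_add_of_nonneg_right (sq_nonneg _))

theorem norm_graphLinear_sub_le [NormedSpace ℝ E] (a b : E →L[ℝ] ℝ) (x : E) :
    ‖graphLinear a x - graphLinear b x‖ ≤ ‖a - b‖ * ‖x‖ := by
  have hsub : ‖graphLinear a x - graphLinear b x‖ = ‖(a - b) x‖ := by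
    rw [graphLinear_apply, graphLinear_apply, ← WithLp.toLp_sub, WithLp.prod_norm_eq_of_L2]
    simp [Real.sqrt_sq_eq_abs]
  exact hsub ▸ (a - b).le_opNorm x

theorem graphJacobian_pos [NormedSpace ℝ E] (a : E →L[ℝ] ℝ) : 0 < graphJacobian a :=
  Real.sqrt_pos.2 (by positivity)

theorem one_le_graphJacobian [NormedSpace ℝ E] (a : E →L[ℝ] ℝ) : 1 ≤ graphJacobian a :=
  Real.one_le_sqrt.2 (le_add_of_nonneg_right (sq_nonneg _))

theorem normDet_graphLinear [InnerProductSpace ℝ E] [FiniteDimensional ℝ E] (a : E →L[ℝ] ℝ) :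
    (graphLinear a : E →ₗ[ℝ] WithLp 2 (E × ℝ)).normDet = graphJacobian a := by
  set v := (InnerProductSpace.toDual ℝ E).symm a with hv
  have hva (x : E) : inner ℝ v x = a x := by simp [hv]
  have hav : a v = ‖a‖ ^ 2 := by
    rw [← hva, real_inner_self_eq_norm_sq, hv, LinearIsometryEquiv.norm_map]
  have hgram : (((graphLinear a).adjoint ∘L graphLinear a : E →L[ℝ] E) : E →ₗ[ℝ] E)
      = LinearMap.transvection (a : E →ₗ[ℝ] ℝ) v := by
    ext1 x
    refine ext_inner_left ℝ fun y => ?_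
    rw [LinearMap.transvection.apply]
    change inner ℝ y ((graphLinear a).adjoint (graphLinear a x)) = inner ℝ y (x + a x • v)
    rw [ContinuousLinearMap.adjoint_inner_right, graphLinear_apply, graphLinear_apply,
      WithLp.prod_inner_apply, inner_add_right, inner_smul_right, real_inner_comm v y, hva]
    simp
  have hsq := ContinuousLinearMap.normDet_sq (graphLinear a)
  rw [ContinuousLinearMap.det, hgram, LinearMap.transvection.det, ContinuousLinearMap.coe_coe,
    hav] at hsq
  rw [graphJacobian, ← hsq]
  exact (Real.sqrt_sq (LinearMap.normDet_nonneg _)).symm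

end Linear

variable {d : ℕ}

theorem euclideanHausdorffMeasure_graphLinear_image (a : Euc d →L[ℝ] ℝ) (s : Set (Euc d)) :
    (Measure.euclideanHausdorffMeasure d : Measure (WithLp 2 (Euc d × ℝ))) (graphLinear a '' s)
      = ENNReal.ofReal (graphJacobian a) * volume s := by
  have h := LinearMap.euclideanHausdorffMeasure_image_eq_normDet_mul_volume
    (graphLinear a : Euc d →ₗ[ℝ] WithLp 2 (Euc d × ℝ)) s
  rwa [normDet_graphLinear, finrank_euclideanSpace_fin] at h

theorem ofReal_graphJacobian_le {a b : Euc d →L[ℝ] ℝ} {K : ℝ≥0}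
    (h : ∀ z, ‖graphLinear a z‖ ≤ K * ‖graphLinear b z‖) :
    ENNReal.ofReal (graphJacobian a) ≤ (K : ℝ≥0∞) ^ d * ENNReal.ofReal (graphJacobian b) := by
  have hball := euclideanHausdorffMeasure_image_le_of_norm_sub_le d (f := graphLinear a)
    (g := graphLinear b) (s := Metric.ball 0 1)
    fun x _ y _ => by simpa only [map_sub] using h (x - y)
  rw [euclideanHausdorffMeasure_graphLinear_image, euclideanHausdorffMeasure_graphLinear_image,
    ← mul_assoc] at hball
  exact (ENNReal.mul_le_mul_iff_left (Metric.measure_ball_pos volume _ one_pos).ne'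
    measure_ball_lt_top.ne).1 hball

/-- The parametrization `y ↦ (y, γ y)` of the graph of `γ`. -/
noncomputable def graphMap (γ : Euc d → ℝ) (y : Euc d) : WithLp 2 (Euc d × ℝ) :=
  WithLp.toLp 2 (y, γ y)

theorem continuous_graphMap {γ : Euc d → ℝ} (hγ : Continuous γ) : Continuous (graphMap γ) :=
  (WithLp.prod_continuous_toLp 2 _ _).comp (continuous_id.prodMk hγ)

theorem graphMap_injective (γ : Euc d → ℝ) : Function.Injective (graphMap γ) :=
  fun _ _ h => congrArg (fun p : WithLp 2 (Euc d × ℝ) => p.fst) h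

theorem measurableEmbedding_graphMap {γ : Euc d → ℝ} (hγ : Continuous γ) :
    MeasurableEmbedding (graphMap γ) :=
  (continuous_graphMap hγ).measurableEmbedding (graphMap_injective γ)

theorem hasStrictFDerivAt_graphMap {γ : Euc d → ℝ} (hγ : ContDiff ℝ 1 γ) (x : Euc d) :
    HasStrictFDerivAt (graphMap γ) (graphLinear (fderiv ℝ γ x)) x := by
  exact (WithLp.prodContinuousLinearEquiv 2 ℝ (Euc d) ℝ).symm.hasStrictFDerivAt.comp x
    ((hasStrictFDerivAt_id x).prodMk (hγ.contDiffAt.hasStrictFDerivAt one_ne_zero))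

theorem norm_le_mul_norm_of_norm_sub_le {W : Type*} [SeminormedAddCommGroup W] {K : ℝ}
    (hK : 1 ≤ K) {u w : W} (h : ‖u - w‖ ≤ (1 - K⁻¹) * ‖w‖) : ‖u‖ ≤ K * ‖w‖ ∧ ‖w‖ ≤ K * ‖u‖ := by
  have hK0 : 0 < K := one_pos.trans_le hK
  have hu : ‖u‖ ≤ ‖w‖ + ‖u - w‖ := norm_le_norm_add_norm_sub' u w
  have hw : ‖w‖ ≤ ‖u‖ + ‖u - w‖ := norm_le_norm_add_norm_sub u w
  have hKinv : 2 - K⁻¹ ≤ K := by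
    have : 0 ≤ (K - 1) ^ 2 / K := by positivity
    have hexp : (K - 1) ^ 2 / K = K - 2 + K⁻¹ := by field_simp; ring
    linarith
  constructor
  · nlinarith [norm_nonneg w]
  · rw [← div_le_iff₀' hK0, div_eq_inv_mul]
    linarith

theorem exists_nhds_graphMap_comparable {γ : Euc d → ℝ} (hγ : ContDiff ℝ 1 γ) (x : Euc d)
    {K : ℝ≥0} (hK : 1 < K) :
    ∃ U : Set (Euc d), IsOpen U ∧ x ∈ U ∧
      (∀ y ∈ U, ∀ z ∈ U,
        ‖graphMap γ y - graphMap γ z‖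
          ≤ K * ‖graphLinear (fderiv ℝ γ x) y - graphLinear (fderiv ℝ γ x) z‖ ∧
        ‖graphLinear (fderiv ℝ γ x) y - graphLinear (fderiv ℝ γ x) z‖
          ≤ K * ‖graphMap γ y - graphMap γ z‖) ∧
      ∀ y ∈ U, ∀ z, ‖graphLinear (fderiv ℝ γ y) z‖ ≤ K * ‖graphLinear (fderiv ℝ γ x) z‖ ∧
        ‖graphLinear (fderiv ℝ γ x) z‖ ≤ K * ‖graphLinear (fderiv ℝ γ y) z‖ := by
  set L := graphLinear (fderiv ℝ γ x)
  set c : ℝ≥0 := 1 - K⁻¹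
  have hc0 : 0 < c := tsub_pos_of_lt (inv_lt_one_of_one_lt₀ hK)
  have hc : (c : ℝ) = 1 - (K : ℝ)⁻¹ := NNReal.coe_sub (inv_le_one_of_one_le₀ hK.le)
  have hcomp {u w : WithLp 2 (Euc d × ℝ)} {y : ℝ} (hy : y ≤ ‖w‖) (h : ‖u - w‖ ≤ c * y) :
      ‖u‖ ≤ K * ‖w‖ ∧ ‖w‖ ≤ K * ‖u‖ :=
    norm_le_mul_norm_of_norm_sub_le (by exact_mod_cast hK.le) (h.trans (by rw [← hc]; gcongr))
  obtain ⟨U, hU, happrox⟩ :=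
    (hasStrictFDerivAt_graphMap hγ x).approximates_deriv_on_nhds (Or.inr hc0)
  obtain ⟨V, hVU, hV, hxV⟩ := mem_nhds_iff.1 hU
  have hopen : IsOpen {y | ‖fderiv ℝ γ y - fderiv ℝ γ x‖ < c} :=
    isOpen_lt ((hγ.continuous_fderiv one_ne_zero).sub continuous_const).norm continuous_const
  refine ⟨V ∩ {y | ‖fderiv ℝ γ y - fderiv ℝ γ x‖ < c}, hV.inter hopen,
    ⟨hxV, by simpa using hc0⟩, fun y hy z hz => ?_, fun y hy z => ?_⟩
  · rw [← map_sub]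
    exact hcomp (norm_le_norm_graphLinear _ _) (happrox y (hVU hy.1) z (hVU hz.1))
  · refine hcomp (norm_le_norm_graphLinear _ _) ((norm_graphLinear_sub_le _ _ _).trans ?_)
    gcongr
    exact hy.2.le

theorem exists_nhds_measure_graphMap_comparable {γ : Euc d → ℝ} (hγ : ContDiff ℝ 1 γ)
    (x : Euc d) {K : ℝ≥0} (hK : 1 < K) :
    ∃ U : Set (Euc d), IsOpen U ∧ x ∈ U ∧ ∀ s ⊆ U, MeasurableSet s →
      (Measure.euclideanHausdorffMeasure d : Measure (WithLp 2 (Euc d × ℝ))) (graphMap γ '' s)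
          ≤ (K : ℝ≥0∞) ^ d * ((K : ℝ≥0∞) ^ d *
            volume.withDensity (fun y => ENNReal.ofReal (graphJacobian (fderiv ℝ γ y))) s) ∧
      volume.withDensity (fun y => ENNReal.ofReal (graphJacobian (fderiv ℝ γ y))) s
          ≤ (K : ℝ≥0∞) ^ d * ((K : ℝ≥0∞) ^ d *
            (Measure.euclideanHausdorffMeasure d : Measure (WithLp 2 (Euc d × ℝ)))
              (graphMap γ '' s)) := by
  obtain ⟨U, hU, hxU, hmap, hlin⟩ := exists_nhds_graphMap_comparable hγ x hK
  refine ⟨U, hU, hxU, fun s hs hsm => ?_⟩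
  have hmap_le := euclideanHausdorffMeasure_image_le_of_norm_sub_le d fun y hy z hz =>
    (hmap y (hs hy) z (hs hz)).1
  have hle_map := euclideanHausdorffMeasure_image_le_of_norm_sub_le d fun y hy z hz =>
    (hmap y (hs hy) z (hs hz)).2
  rw [euclideanHausdorffMeasure_graphLinear_image] at hmap_le hle_map
  rw [withDensity_apply _ hsm]
  constructor
  · refine hmap_le.trans (mul_le_mul_right ?_ _)
    rw [← setLIntegral_const, ← lintegral_const_mul' _ _ (by finiteness)]
    exact setLIntegral_mono' hsm fun y hy => ofReal_graphJacobian_le fun z => (hlin y (hs hy) z).2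
  · refine le_trans ?_ (mul_le_mul_right hle_map _)
    rw [← setLIntegral_const, ← lintegral_const_mul' _ _ (by finiteness)]
    exact setLIntegral_mono' hsm fun y hy => ofReal_graphJacobian_le fun z => (hlin y (hs hy) z).1

theorem le_of_forall_one_lt_le_pow_mul {m : ℕ} {a b : ℝ≥0∞}
    (h : ∀ K : ℝ≥0, 1 < K → a ≤ (K : ℝ≥0∞) ^ m * ((K : ℝ≥0∞) ^ m * b)) : a ≤ b := by
  have hlim : Tendsto (fun K : ℝ≥0 => ((K ^ m * K ^ m : ℝ≥0) : ℝ≥0∞) * b) (𝓝[>] 1) (𝓝 b) := by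
    have hcont : Continuous fun K : ℝ≥0 => ((K ^ m * K ^ m : ℝ≥0) : ℝ≥0∞) :=
      ENNReal.continuous_coe.comp (by fun_prop)
    have hone := (hcont.tendsto 1).mono_left (nhdsWithin_le_nhds (s := Ioi 1))
    simpa using ENNReal.Tendsto.mul_const (b := b) hone (Or.inl (by simp))
  refine ge_of_tendsto hlim (eventually_mem_nhdsWithin.mono fun K hK => ?_)
  simpa only [ENNReal.coe_mul, ENNReal.coe_pow, mul_assoc] using h K hK

theorem comap_graphMap_euclideanHausdorffMeasure {γ : Euc d → ℝ} (hγ : ContDiff ℝ 1 γ) :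
    (Measure.euclideanHausdorffMeasure d : Measure (WithLp 2 (Euc d × ℝ))).comap (graphMap γ)
      = (volume : Measure (Euc d)).withDensity
          (fun y => ENNReal.ofReal (graphJacobian (fderiv ℝ γ y))) := by
  have hcomap := (measurableEmbedding_graphMap hγ.continuous).comap_apply
    (Measure.euclideanHausdorffMeasure d : Measure (WithLp 2 (Euc d × ℝ)))
  have hfactor {μ ν : Measure (Euc d)} (h : ∀ K : ℝ≥0, 1 < K → ∀ x, ∃ U : Set (Euc d),
      IsOpen U ∧ x ∈ U ∧ ∀ s ⊆ U, MeasurableSet s →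
        μ s ≤ (K : ℝ≥0∞) ^ d * ((K : ℝ≥0∞) ^ d * ν s)) : μ ≤ ν :=
    Measure.le_iff.2 fun s _ => le_of_forall_one_lt_le_pow_mul fun K hK =>
      measure_le_of_locally_le (μ := (K : ℝ≥0∞) ^ d • (K : ℝ≥0∞) ^ d • ν) (h K hK) s
  refine le_antisymm (hfactor fun K hK x => ?_) (hfactor fun K hK x => ?_)
  all_goals
    obtain ⟨U, hU, hxU, hcomp⟩ := exists_nhds_measure_graphMap_comparable hγ x hK
    refine ⟨U, hU, hxU, fun s hs hsm => ?_⟩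
    rw [hcomap]
  exacts [(hcomp s hs hsm).1, (hcomp s hs hsm).2]

end Area

/-! ### The divergence theorem below a graph -/

section GraphDivergence

theorem deriv_smoothTransition_of_notMem {s : ℝ} (hs : s ∉ Icc (0 : ℝ) 1) :
    deriv Real.smoothTransition s = 0 := by
  rw [mem_Icc, not_and_or, not_le, not_le] at hs
  rcases hs with hs | hs
  · have : Real.smoothTransition =ᶠ[𝓝 s] fun _ => 0 :=
      (eventually_lt_nhds hs).mono fun x hx => Real.smoothTransition.zero_of_nonpos hx.le
    rw [this.deriv_eq, deriv_const]
  · have : Real.smoothTransition =ᶠ[𝓝 s] fun _ => 1 :=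
      (eventually_gt_nhds hs).mono fun x hx => Real.smoothTransition.one_of_one_le hx.le
    rw [this.deriv_eq, deriv_const]

theorem hasCompactSupport_deriv_smoothTransition :
    HasCompactSupport (deriv Real.smoothTransition) :=
  HasCompactSupport.intro isCompact_Icc fun _ hs => deriv_smoothTransition_of_notMem hs

theorem continuous_deriv_smoothTransition : Continuous (deriv Real.smoothTransition) :=
  (Real.smoothTransition.contDiff (n := 1)).continuous_deriv le_rfl

theorem integrable_deriv_smoothTransition : Integrable (deriv Real.smoothTransition) :=
  continuous_deriv_smoothTransition.integrable_of_hasCompactSupport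
    hasCompactSupport_deriv_smoothTransition

theorem integral_deriv_smoothTransition : ∫ s, deriv Real.smoothTransition s = 1 := by
  have hd : ContDiff ℝ 1 Real.smoothTransition := Real.smoothTransition.contDiff
  have h0 : Tendsto Real.smoothTransition atBot (𝓝 0) :=
    tendsto_const_nhds.congr' ((eventually_le_atBot 0).mono fun x hx =>
      (Real.smoothTransition.zero_of_nonpos hx).symm)
  have h1 : Tendsto Real.smoothTransition atTop (𝓝 1) :=
    tendsto_const_nhds.congr' ((eventually_ge_atTop 1).mono fun x hx =>
      (Real.smoothTransition.one_of_one_le hx).symm)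
  rw [integral_of_hasDerivAt_of_tendsto
    (fun x => (hd.differentiable one_ne_zero x).hasDerivAt) integrable_deriv_smoothTransition
    h0 h1, sub_zero]

variable {d : ℕ}

theorem integral_withLp_prod {F : Type*} [NormedAddCommGroup F] [NormedSpace ℝ F]
    (f : WithLp 2 (Euc d × ℝ) → F) :
    ∫ p, f p = ∫ q : Euc d × ℝ, f (WithLp.toLp 2 q) :=
  ((WithLp.volume_preserving_toLp (Euc d) ℝ).integral_comp
    (MeasurableEquiv.toLp 2 (Euc d × ℝ)).measurableEmbedding f).symm

theorem integral_eq_smul_integral_comp_sub_mul {F : Type*} [NormedAddCommGroup F]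
    [NormedSpace ℝ F] (f : ℝ → F) (a : ℝ) {ε : ℝ} (hε : 0 < ε) :
    ∫ t, f t = ε • ∫ s, f (a - ε * s) := by
  rw [Measure.integral_comp_mul_left (fun x => f (a - x)) ε, integral_sub_left_eq_self f volume a,
    abs_of_pos (inv_pos.2 hε), smul_inv_smul₀ hε.ne']

theorem tendsto_integral_deriv_smoothTransition_mul {f : ℝ → ℂ} (hf : Continuous f) {C : ℝ}
    (hC : ∀ t, ‖f t‖ ≤ C) :
    Tendsto (fun ε : ℝ => ∫ s, ((deriv Real.smoothTransition s : ℝ) : ℂ) * f (ε * s)) (𝓝 0)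
      (𝓝 (f 0)) := by
  have hmass : f 0 = ∫ s, ((deriv Real.smoothTransition s : ℝ) : ℂ) * f 0 := by
    rw [integral_mul_const, integral_complex_ofReal, integral_deriv_smoothTransition,
      Complex.ofReal_one, one_mul]
  have := continuous_deriv_smoothTransition
  rw [hmass]
  refine tendsto_integral_filter_of_dominated_convergence
    (fun s => ‖deriv Real.smoothTransition s‖ * C) (.of_forall fun ε => ?_)
    (.of_forall fun ε => .of_forall fun s => ?_)
    (integrable_deriv_smoothTransition.norm.mul_const C)
    (.of_forall fun s => Tendsto.const_mul _ ?_)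
  · exact Continuous.aestronglyMeasurable (by fun_prop)
  · rw [norm_mul, Complex.norm_real]
    gcongr
    exact hC _
  · simpa only [Function.comp_def, zero_mul] using (hf.comp (continuous_mul_const s)).tendsto 0

theorem integral_layer_eq {γ : Euc d → ℝ} (hγ : Continuous γ) {h : WithLp 2 (Euc d × ℝ) → ℂ}
    (hh : Continuous h) (hc : HasCompactSupport h) {ε : ℝ} (hε : 0 < ε) :
    ∫ p, ((deriv Real.smoothTransition ((γ p.fst - p.snd) / ε) / ε : ℝ) : ℂ) * h p
      = ∫ y, ∫ s, ((deriv Real.smoothTransition s : ℝ) : ℂ) *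
          h (WithLp.toLp 2 (y, γ y - ε * s)) := by
  have hε0 : (ε : ℂ) ≠ 0 := by exact_mod_cast hε.ne'
  have := WithLp.prod_continuous_toLp 2 (Euc d) ℝ
  have := continuous_deriv_smoothTransition
  have hint : Integrable fun q : Euc d × ℝ =>
      ((deriv Real.smoothTransition ((γ q.1 - q.2) / ε) / ε : ℝ) : ℂ) * h (WithLp.toLp 2 q) :=
    Continuous.integrable_of_hasCompactSupport (by fun_prop)
      (hc.comp_homeomorph (WithLp.homeomorphProd 2 (Euc d) ℝ).symm).mul_left
  simp only [integral_withLp_prod, WithLp.toLp_fst, WithLp.toLp_snd]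
  rw [Measure.volume_eq_prod] at hint ⊢
  rw [integral_prod _ hint]
  refine integral_congr_ae (.of_forall fun y => ?_)
  simp only
  rw [integral_eq_smul_integral_comp_sub_mul _ (γ y) hε, Complex.real_smul, ← integral_const_mul]
  refine integral_congr_ae (.of_forall fun s => ?_)
  simp only [sub_sub_cancel, mul_div_cancel_left₀ s hε.ne']
  push_cast
  field_simp

theorem tendsto_integral_layer {γ : Euc d → ℝ} (hγ : Continuous γ)
    {h : WithLp 2 (Euc d × ℝ) → ℂ} (hh : Continuous h) (hc : HasCompactSupport h) :
    Tendsto (fun ε : ℝ =>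
        ∫ p, ((deriv Real.smoothTransition ((γ p.fst - p.snd) / ε) / ε : ℝ) : ℂ) * h p)
      (𝓝[>] 0) (𝓝 (∫ y, h (graphMap γ y))) := by
  obtain ⟨C, hC⟩ := hh.bounded_above_of_compact_support hc
  have := WithLp.prod_continuous_toLp 2 (Euc d) ℝ
  have := continuous_deriv_smoothTransition
  have hK : IsCompact (WithLp.fst '' tsupport h) := hc.isCompact.image (by fun_prop)
  refine Tendsto.congr' (eventually_mem_nhdsWithin.mono fun ε hε =>
    (integral_layer_eq hγ hh hc hε).symm) ?_
  refine tendsto_integral_filter_of_dominated_convergence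
    ((WithLp.fst '' tsupport h).indicator fun _ => ∫ s, ‖deriv Real.smoothTransition s‖ * C)
    (.of_forall fun ε => StronglyMeasurable.aestronglyMeasurable ?_)
    (.of_forall fun ε => .of_forall fun y => ?_)
    ((integrable_indicator_iff hK.measurableSet).2 (integrableOn_const hK.measure_lt_top.ne))
    (.of_forall fun y => ?_)
  · have hcont : Continuous fun q : Euc d × ℝ => ((deriv Real.smoothTransition q.2 : ℝ) : ℂ) *
      h (WithLp.toLp 2 (q.1, γ q.1 - ε * q.2)) := by fun_prop
    exact hcont.stronglyMeasurable.integral_prod_right'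
  · by_cases hy : y ∈ WithLp.fst '' tsupport h
    · rw [indicator_of_mem hy]
      refine norm_integral_le_of_norm_le (integrable_deriv_smoothTransition.norm.mul_const C)
        (.of_forall fun s => ?_)
      rw [norm_mul, Complex.norm_real]
      gcongr
      exact hC _
    · have hzero (s : ℝ) : h (WithLp.toLp 2 (y, γ y - ε * s)) = 0 :=
        image_eq_zero_of_notMem_tsupport fun hm => hy ⟨_, hm, rfl⟩
      simp only [indicator_of_notMem hy, hzero, mul_zero, integral_zero, norm_zero, le_rfl]
  · have hline : Continuous fun t : ℝ => h (WithLp.toLp 2 (y, γ y - t)) := by fun_prop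
    have hlim := tendsto_integral_deriv_smoothTransition_mul hline fun t => hC _
    rw [sub_zero] at hlim
    exact hlim.mono_left nhdsWithin_le_nhds

/-- A smooth cutoff of width `ε` to the region below the graph of `γ`: it vanishes above the graph
and tends to `1` below it as `ε → 0`. -/
noncomputable def graphCutoff (γ : Euc d → ℝ) (ε : ℝ) (p : WithLp 2 (Euc d × ℝ)) : ℂ :=
  Real.smoothTransition ((γ p.fst - p.snd) / ε)

theorem contDiff_graphCutoff {γ : Euc d → ℝ} (hγ : ContDiff ℝ 1 γ) (ε : ℝ) :
    ContDiff ℝ 1 (graphCutoff γ ε) := by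
  have hfst : ContDiff ℝ 1 fun p : WithLp 2 (Euc d × ℝ) => γ p.fst :=
    hγ.comp (WithLp.fstL 2 ℝ (Euc d) ℝ).contDiff
  exact Complex.ofRealCLM.contDiff.comp ((Real.smoothTransition.contDiff (n := 1)).comp
    ((hfst.sub (WithLp.sndL 2 ℝ (Euc d) ℝ).contDiff).div_const ε))

theorem fderiv_smoothTransition_div_apply {E : Type*} [NormedAddCommGroup E] [NormedSpace ℝ E]
    {ρ : E → ℝ} {L : E →L[ℝ] ℝ} {p : E} (hρ : HasFDerivAt ρ L p) (ε : ℝ) (e : E) :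
    fderiv ℝ (fun p => (Real.smoothTransition (ρ p / ε) : ℂ)) p e
      = ((deriv Real.smoothTransition (ρ p / ε) / ε : ℝ) : ℂ) * (L e : ℝ) := by
  have htransition : HasDerivAt Real.smoothTransition
      (deriv Real.smoothTransition (ρ p / ε)) (ρ p / ε) :=
    ((Real.smoothTransition.contDiff (n := 1)).differentiable one_ne_zero _).hasDerivAt
  have hscaled : HasFDerivAt (fun p => ρ p / ε) (ε⁻¹ • L) p := by
    simpa only [div_eq_mul_inv] using hρ.mul_const ε⁻¹
  have hcomp := Complex.ofRealCLM.hasFDerivAt.comp p (htransition.hasFDerivAt.comp p hscaled)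
  change fderiv ℝ (Complex.ofRealCLM ∘ Real.smoothTransition ∘ fun p => ρ p / ε) p e = _
  rw [hcomp.fderiv]
  simp only [div_eq_mul_inv, ContinuousLinearMap.comp_apply, _root_.smul_apply,
    ContinuousLinearMap.toSpanSingleton_apply, smul_eq_mul, Complex.ofRealCLM_apply,
    Complex.ofReal_mul, Complex.ofReal_inv]
  ring

theorem fderiv_graphCutoff_apply {γ : Euc d → ℝ} {p : WithLp 2 (Euc d × ℝ)}
    (hγ : DifferentiableAt ℝ γ p.fst) (ε : ℝ) (e : WithLp 2 (Euc d × ℝ)) :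
    fderiv ℝ (graphCutoff γ ε) p e =
      -(((deriv Real.smoothTransition ((γ p.fst - p.snd) / ε) / ε : ℝ) : ℂ) *
        ((e.snd - fderiv ℝ γ p.fst e.fst : ℝ) : ℂ)) := by
  have hheight : HasFDerivAt (fun p : WithLp 2 (Euc d × ℝ) => γ p.fst - p.snd)
      ((fderiv ℝ γ p.fst).comp (WithLp.fstL 2 ℝ (Euc d) ℝ) - WithLp.sndL 2 ℝ (Euc d) ℝ) p :=
    (hγ.hasFDerivAt.comp p (WithLp.fstL 2 ℝ (Euc d) ℝ).hasFDerivAt).sub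
      (WithLp.sndL 2 ℝ (Euc d) ℝ).hasFDerivAt
  rw [← mul_neg, ← Complex.ofReal_neg, neg_sub]
  exact fderiv_smoothTransition_div_apply hheight ε e

theorem tendsto_integral_graphCutoff_mul {γ : Euc d → ℝ} (hγ : Continuous γ)
    {h : WithLp 2 (Euc d × ℝ) → ℂ} (hh : Integrable h) :
    Tendsto (fun ε : ℝ => ∫ p, graphCutoff γ ε p * h p) (𝓝[>] 0)
      (𝓝 (∫ p in {p : WithLp 2 (Euc d × ℝ) | p.snd < γ p.fst}, h p)) := by
  have hm : MeasurableSet {p : WithLp 2 (Euc d × ℝ) | p.snd < γ p.fst} :=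
    (isOpen_lt (by fun_prop) (by fun_prop)).measurableSet
  rw [← integral_indicator hm]
  refine tendsto_integral_filter_of_dominated_convergence (fun p => ‖h p‖)
    (.of_forall fun ε => AEStronglyMeasurable.mul (Continuous.aestronglyMeasurable ?_) hh.1)
    (.of_forall fun ε => .of_forall fun p => ?_) hh.norm (.of_forall fun p => ?_)
  · have := Real.smoothTransition.continuous
    unfold graphCutoff
    fun_prop
  · rw [norm_mul, graphCutoff, Complex.norm_real,
      Real.norm_of_nonneg (Real.smoothTransition.nonneg _)]
    exact mul_le_of_le_one_left (norm_nonneg _) (Real.smoothTransition.le_one _)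
  · refine tendsto_const_nhds.congr' ?_
    by_cases hp : p.snd < γ p.fst
    · have hsmall : ∀ᶠ ε : ℝ in 𝓝[>] 0, 0 < ε ∧ ε < γ p.fst - p.snd :=
        eventually_mem_nhdsWithin.and (nhdsWithin_le_nhds (eventually_lt_nhds (sub_pos.2 hp)))
      filter_upwards [hsmall] with ε hε
      rw [indicator_of_mem (by exact hp), graphCutoff,
        Real.smoothTransition.one_of_one_le ((one_le_div hε.1).2 hε.2.le), Complex.ofReal_one,
        one_mul]
    · filter_upwards [eventually_mem_nhdsWithin] with ε (hε : 0 < ε)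
      rw [indicator_of_notMem (by exact hp), graphCutoff, Real.smoothTransition.zero_of_nonpos
        (div_nonpos_of_nonpos_of_nonneg (by linarith) hε.le), Complex.ofReal_zero, zero_mul]

theorem integral_fderiv_below_graph {γ : Euc d → ℝ} (hγ : ContDiff ℝ 1 γ)
    {g : WithLp 2 (Euc d × ℝ) → ℂ} (hg : LocallyLipschitz g) (hc : HasCompactSupport g)
    (e : WithLp 2 (Euc d × ℝ)) :
    ∫ p in {p : WithLp 2 (Euc d × ℝ) | p.snd < γ p.fst}, fderiv ℝ g p e
      = ∫ y, g (graphMap γ y) * ((e.snd - fderiv ℝ γ y e.fst : ℝ) : ℂ) := by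
  have hconormal : Continuous fun p : WithLp 2 (Euc d × ℝ) =>
      ((e.snd - fderiv ℝ γ p.fst e.fst : ℝ) : ℂ) := by
    have := hγ.continuous_fderiv one_ne_zero
    fun_prop
  have hinterior := tendsto_integral_graphCutoff_mul hγ.continuous
    (integrable_fderiv_of_locallyLipschitz volume hg hc e)
  have hlayer := tendsto_integral_layer hγ.continuous (hg.continuous.mul hconormal) hc.mul_right
  refine tendsto_nhds_unique hinterior (hlayer.congr fun ε => ?_)
  rw [← neg_eq_iff_eq_neg.2 (integral_fderiv_mul_of_locallyLipschitz volume
    (contDiff_graphCutoff hγ ε).locallyLipschitz hg hc e), ← integral_neg]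
  refine integral_congr_ae (.of_forall fun p => ?_)
  simp only [fderiv_graphCutoff_apply (hγ.differentiable one_ne_zero _), Pi.mul_apply]
  ring

end GraphDivergence

/-! ### Outward normal -/

section Normal

variable {n : ℕ}

theorem IsOutwardUnitNormal.inner_nonpos {Ω : Set (Euc n)} {x v w : Euc n}
    (hv : IsOutwardUnitNormal Ω x v) (hw : IsOutwardUnitNormal Ω x w) {d : Euc n}
    (hd : inner ℝ v d < 0) : inner ℝ w d ≤ 0 := by
  have hd₀ : 0 < ‖d‖ := norm_pos_iff.2 (by rintro rfl; simp at hd)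
  have hlim : Tendsto (fun t : ℝ => x + t • d) (𝓝[>] 0) (𝓝 x) := by
    have hcont : Continuous fun t : ℝ => x + t • d := by fun_prop
    have hlim₀ := hcont.tendsto 0
    simp only [zero_smul, add_zero] at hlim₀
    exact hlim₀.mono_left nhdsWithin_le_nhds
  by_contra! hwd
  have hv_near := hlim.eventually
    (hv.2 (-inner ℝ v d / (2 * ‖d‖)) (div_pos (neg_pos.2 hd) (by positivity)))
  have hw_near := hlim.eventually (hw.2 (inner ℝ w d / (2 * ‖d‖)) (by positivity))
  obtain ⟨t, htv, htw, ht : 0 < t⟩ :=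
    (hv_near.and (hw_near.and eventually_mem_nhdsWithin)).exists
  have hradius (a : ℝ) : a / (2 * ‖d‖) * (t * ‖d‖) = t * a / 2 := by field_simp
  simp only [add_sub_cancel_left, inner_smul_right, norm_smul, Real.norm_of_nonneg ht.le, hradius]
    at htv htw
  have htvd : t * inner ℝ v d < 0 := mul_neg_of_pos_of_neg ht hd
  have htwd : 0 < t * inner ℝ w d := mul_pos ht hwd
  by_cases hmem : x + t • d ∈ Ω
  · linarith [htw.1 hmem]
  · linarith [htv.2 hmem]

theorem IsOutwardUnitNormal.unique {Ω : Set (Euc n)} {x v w : Euc n}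
    (hv : IsOutwardUnitNormal Ω x v) (hw : IsOutwardUnitNormal Ω x w) : v = w := by
  have hvv : inner ℝ v v = (1 : ℝ) := by rw [real_inner_self_eq_norm_sq, hv.1]; norm_num
  have hww : inner ℝ w w = (1 : ℝ) := by rw [real_inner_self_eq_norm_sq, hw.1]; norm_num
  have : 0 ≤ (inner ℝ w v : ℝ) := by
    have := hv.inner_nonpos hw (d := -v) (by rw [inner_neg_right, hvv]; norm_num)
    rw [inner_neg_right] at this
    linarith
  have hsq : ∀ δ > 0, 1 - (inner ℝ w v : ℝ) ^ 2 ≤ δ * inner ℝ w v := by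
    intro δ hδ
    have := hv.inner_nonpos hw (d := w - ((inner ℝ w v : ℝ) + δ) • v) (by
      rw [inner_sub_right, inner_smul_right, hvv, real_inner_comm v w]; linarith)
    rw [inner_sub_right, inner_smul_right, hww] at this
    nlinarith
  have hone_le : 1 ≤ (inner ℝ w v : ℝ) := by
    by_contra! hlt
    have := hsq (1 - inner ℝ w v) (by linarith)
    nlinarith
  refine ((inner_eq_one_iff_of_norm_eq_one hw.1 hv.1).1 (le_antisymm ?_ hone_le)).symm
  simpa only [hv.1, hw.1, mul_one] using real_inner_le_norm w v

theorem IsOutwardUnitNormal.outwardNormal_eq {Ω : Set (Euc n)} {x v : Euc n}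
    (hv : IsOutwardUnitNormal Ω x v) : outwardNormal Ω x = v := by
  have hex : ∃ v, IsOutwardUnitNormal Ω x v := ⟨v, hv⟩
  rw [outwardNormal, dif_pos hex]
  exact hex.choose_spec.unique hv

/-- The upward unit normal `(-∇γ(y), 1) / √(1 + |∇γ(y)|²)` to the graph of `γ`. -/
noncomputable def graphNormal {d : ℕ} (γ : Euc d → ℝ) (y : Euc d) : WithLp 2 (Euc d × ℝ) :=
  (graphJacobian (fderiv ℝ γ y))⁻¹ •
    WithLp.toLp 2 (-(InnerProductSpace.toDual ℝ (Euc d)).symm (fderiv ℝ γ y), (1 : ℝ))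

theorem inner_graphNormal {d : ℕ} (γ : Euc d → ℝ) (y : Euc d) (e : WithLp 2 (Euc d × ℝ)) :
    inner ℝ (graphNormal γ y) e
      = (graphJacobian (fderiv ℝ γ y))⁻¹ * (e.snd - fderiv ℝ γ y e.fst) := by
  rw [graphNormal, real_inner_smul_left, WithLp.prod_inner_apply]
  change _ * (inner ℝ (-_) e.fst + e.snd * (1 : ℝ)) = _
  rw [inner_neg_left, InnerProductSpace.toDual_symm_apply]
  ring

theorem norm_graphNormal {d : ℕ} (γ : Euc d → ℝ) (y : Euc d) : ‖graphNormal γ y‖ = 1 := by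
  have hpos := graphJacobian_pos (fderiv ℝ γ y)
  rw [graphNormal, norm_smul, norm_inv, Real.norm_of_nonneg hpos.le, WithLp.prod_norm_eq_of_L2]
  change _ * √(‖-(InnerProductSpace.toDual ℝ (Euc d)).symm (fderiv ℝ γ y)‖ ^ 2 + ‖(1 : ℝ)‖ ^ 2) = 1
  rw [norm_neg, LinearIsometryEquiv.norm_map, norm_one, one_pow, add_comm (_ ^ 2)]
  exact inv_mul_cancel₀ hpos.ne'

end Normal

/-! ### Domains with `C¹` boundary -/

section Chart

variable {n d : ℕ}

/-- In the open set `U` and in the orthonormal coordinates `T`, the set `Ω` is the region below the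
graph of the `C¹` function `γ`. -/
structure IsGraphChart (Ω : Set (Euc n)) (T : Euc n ≃ₗᵢ[ℝ] WithLp 2 (Euc d × ℝ)) (γ : Euc d → ℝ)
    (U : Set (Euc n)) : Prop where
  contDiff : ContDiff ℝ 1 γ
  isOpen : IsOpen U
  mem_iff : ∀ x ∈ U, x ∈ Ω ↔ (T x).snd < γ (T x).fst

/-- The boundary of `Ω` is of class `C¹`: around each boundary point, `Ω` is the region below the
graph of a `C¹` function. -/
def HasC1Boundary (Ω : Set (Euc n)) : Prop :=
  ∀ x ∈ frontier Ω, ∃ (T : Euc n ≃ₗᵢ[ℝ] WithLp 2 (Euc (n - 1) × ℝ)) (γ : Euc (n - 1) → ℝ)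
    (U : Set (Euc n)), IsGraphChart Ω T γ U ∧ x ∈ U

theorem HasC11Boundary.hasC1Boundary {Ω : Set (Euc n)} (hΩ : HasC11Boundary Ω) :
    HasC1Boundary Ω := fun x hx =>
  let ⟨T, γ, _, U, hγ, _, hU, hxU, hmem⟩ := hΩ x hx
  ⟨T, γ, U, ⟨hγ, hU, hmem⟩, hxU⟩

variable {Ω U : Set (Euc n)} {T : Euc n ≃ₗᵢ[ℝ] WithLp 2 (Euc d × ℝ)} {γ : Euc d → ℝ}

theorem frontier_below_graph (hγ : Continuous γ) :
    frontier {p : WithLp 2 (Euc d × ℝ) | p.snd < γ p.fst} = {p | p.snd = γ p.fst} := by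
  have hopen : IsOpen {p : WithLp 2 (Euc d × ℝ) | p.snd < γ p.fst} :=
    isOpen_lt (by fun_prop) (by fun_prop)
  refine Subset.antisymm (frontier_lt_subset_eq (by fun_prop) (by fun_prop)) fun p hp => ?_
  rw [hopen.frontier_eq]
  refine ⟨?_, fun hlt => hlt.ne hp⟩
  have hcont : Continuous fun t : ℝ => WithLp.toLp 2 (p.fst, p.snd - t) :=
    (WithLp.prod_continuous_toLp 2 (Euc d) ℝ).comp (by fun_prop)
  have hlim := hcont.tendsto 0
  rw [sub_zero] at hlim
  refine mem_closure_of_tendsto (hlim.mono_left (nhdsWithin_le_nhds (s := Ioi 0))) ?_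
  filter_upwards [self_mem_nhdsWithin] with t (ht : 0 < t)
  exact (sub_lt_self _ ht).trans_eq hp

theorem IsGraphChart.mem_frontier_iff (hU : IsGraphChart Ω T γ U) {x : Euc n} (hx : x ∈ U) :
    x ∈ frontier Ω ↔ (T x).snd = γ (T x).fst := by
  have hlocal : Ω ∩ U = T ⁻¹' {p | p.snd < γ p.fst} ∩ U :=
    ext fun z => and_congr_left (hU.mem_iff z)
  have hfrontier : frontier Ω ∩ U = T ⁻¹' {p | p.snd = γ p.fst} ∩ U := by
    rw [← frontier_below_graph hU.contDiff.continuous, ← frontier_inter_open_inter hU.isOpen,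
      hlocal, frontier_inter_open_inter hU.isOpen]
    exact congrArg (· ∩ U) (T.toHomeomorph.preimage_frontier _).symm
  simpa only [mem_inter_iff, hx, and_true, mem_preimage, mem_ofPred_eq] using
    Set.ext_iff.1 hfrontier x

theorem IsGraphChart.mem_closure_iff (hU : IsGraphChart Ω T γ U) {x : Euc n} (hx : x ∈ U) :
    x ∈ closure Ω ↔ (T x).snd ≤ γ (T x).fst := by
  rw [closure_eq_self_union_frontier, mem_union, hU.mem_frontier_iff hx, hU.mem_iff x hx,
    le_iff_lt_or_eq]

theorem IsGraphChart.isOutwardUnitNormal (hU : IsGraphChart Ω T γ U) {x : Euc n} (hxU : x ∈ U)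
    (hx : (T x).snd = γ (T x).fst) :
    IsOutwardUnitNormal Ω x (T.symm (graphNormal γ (T x).fst)) := by
  refine ⟨by rw [LinearIsometryEquiv.norm_map, norm_graphNormal], fun ε hε => ?_⟩
  set y := (T x).fst
  have hcont : Continuous fun z => (T z).fst := by fun_prop
  have hlin : ∀ᶠ y' in 𝓝 y, ‖γ y' - γ y - fderiv ℝ γ y (y' - y)‖ ≤ ε * ‖y' - y‖ :=
    (hU.contDiff.differentiable one_ne_zero y).hasFDerivAt.isLittleO.def hε
  filter_upwards [(hcont.tendsto x).eventually hlin, hU.isOpen.mem_nhds hxU] with z hz hzU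
  have hinner : inner ℝ (T.symm (graphNormal γ y)) (z - x) =
      (graphJacobian (fderiv ℝ γ y))⁻¹ * ((T z).snd - γ y - fderiv ℝ γ y ((T z).fst - y)) := by
    rw [← LinearIsometryEquiv.inner_map_map T, LinearIsometryEquiv.apply_symm_apply,
      inner_graphNormal, map_sub, ← hx]
    rfl
  have hdist : ‖(T z).fst - y‖ ≤ ‖z - x‖ := by
    rw [← LinearIsometryEquiv.norm_map T (z - x), map_sub]
    exact WithLp.norm_fst_le _ (T z - T x)
  have herror : |γ (T z).fst - γ y - fderiv ℝ γ y ((T z).fst - y)| ≤ ε * ‖z - x‖ :=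
    hz.trans (by gcongr)
  have hJ_nonneg : 0 ≤ (graphJacobian (fderiv ℝ γ y))⁻¹ := inv_nonneg.2 (graphJacobian_pos _).le
  have hJ_mul_le : (graphJacobian (fderiv ℝ γ y))⁻¹ * (ε * ‖z - x‖) ≤ ε * ‖z - x‖ :=
    mul_le_of_le_one_left (by positivity) (inv_le_one_of_one_le₀ (one_le_graphJacobian _))
  rw [abs_le] at herror
  rw [hinner, hU.mem_iff z hzU, not_lt]
  refine ⟨fun hbelow => le_trans ?_ hJ_mul_le, fun habove => ?_⟩
  · gcongr
    linarith
  · rw [neg_le, ← mul_neg]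
    refine le_trans ?_ hJ_mul_le
    gcongr
    linarith

end Chart

/-! ### The divergence theorem -/

section SurfaceIntegral

variable {n : ℕ}

theorem indicator_eq_indicator_of_support_subset {α M : Type*} [Zero M] {s t u : Set α}
    {f : α → M} (hf : f.support ⊆ u) (hst : ∀ x ∈ u, x ∈ s ↔ x ∈ t) :
    s.indicator f = t.indicator f := by
  classical
  funext x
  by_cases hx : f x = 0
  · simp only [indicator_apply, hx, ite_self]
  · simp only [indicator_apply, hst x (hf hx)]

theorem integral_euclideanHausdorffMeasure_graph {d : ℕ} {γ : Euc d → ℝ} (hγ : ContDiff ℝ 1 γ)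
    (F : WithLp 2 (Euc d × ℝ) → ℂ) :
    (Integrable (fun y => graphJacobian (fderiv ℝ γ y) • F (graphMap γ y)) →
      IntegrableOn F (range (graphMap γ)) (Measure.euclideanHausdorffMeasure d)) ∧
    ∫ p in range (graphMap γ), F p ∂(Measure.euclideanHausdorffMeasure d)
      = ∫ y, graphJacobian (fderiv ℝ γ y) • F (graphMap γ y) := by
  have hemb := measurableEmbedding_graphMap hγ.continuous
  have hmeas : Measurable fun y => ENNReal.ofReal (graphJacobian (fderiv ℝ γ y)) := by
    have := hγ.continuous_fderiv one_ne_zero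
    unfold graphJacobian
    exact (ENNReal.continuous_ofReal.comp (by fun_prop)).measurable
  have hfin : ∀ᵐ y ∂(volume : Measure (Euc d)),
      ENNReal.ofReal (graphJacobian (fderiv ℝ γ y)) < (⊤ : ℝ≥0∞) :=
    .of_forall fun _ => ENNReal.ofReal_lt_top
  have htoReal (y : Euc d) : (ENNReal.ofReal (graphJacobian (fderiv ℝ γ y))).toReal =
      graphJacobian (fderiv ℝ γ y) := ENNReal.toReal_ofReal (graphJacobian_pos _).le
  constructor
  · intro hint
    rw [IntegrableOn, ← hemb.map_comap, hemb.integrable_map_iff,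
      comap_graphMap_euclideanHausdorffMeasure hγ,
      integrable_withDensity_iff_integrable_smul' hmeas hfin]
    simp only [htoReal]
    exact hint
  · rw [← hemb.map_comap, hemb.integral_map, comap_graphMap_euclideanHausdorffMeasure hγ,
      integral_withDensity_eq_integral_toReal_smul hmeas hfin]
    simp only [htoReal]

theorem IsGraphChart.integral_surfaceMeasure {Ω U : Set (Euc n)}
    {T : Euc n ≃ₗᵢ[ℝ] WithLp 2 (Euc (n - 1) × ℝ)} {γ : Euc (n - 1) → ℝ}
    (hU : IsGraphChart Ω T γ U) {F : Euc n → ℂ} (hF : F.support ⊆ U) :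
    (Integrable (fun y => graphJacobian (fderiv ℝ γ y) • F (T.symm (graphMap γ y))) →
      Integrable F (surfaceMeasure Ω)) ∧
    ∫ x, F x ∂(surfaceMeasure Ω) =
      ∫ y, graphJacobian (fderiv ℝ γ y) • F (T.symm (graphMap γ y)) := by
  have hmem (x : Euc n) (hx : x ∈ U) : x ∈ frontier Ω ↔ x ∈ T ⁻¹' range (graphMap γ) := by
    rw [hU.mem_frontier_iff hx]
    refine ⟨fun h => ⟨(T x).fst, by rw [graphMap, ← h]; rfl⟩, ?_⟩
    rintro ⟨y, hy⟩
    rw [← hy]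
    rfl
  have hind := indicator_eq_indicator_of_support_subset hF hmem
  have hrange : MeasurableSet (T ⁻¹' range (graphMap γ)) :=
    T.continuous.measurable
      (measurableEmbedding_graphMap hU.contDiff.continuous).measurableSet_range
  have hT : MeasurePreserving T (Measure.euclideanHausdorffMeasure (n - 1))
      (Measure.euclideanHausdorffMeasure (n - 1)) :=
    T.toIsometryEquiv.measurePreserving_euclideanHausdorffMeasure (n - 1)
  have hTemb : MeasurableEmbedding T := T.toHomeomorph.measurableEmbedding
  obtain ⟨hint, heq⟩ :=
    integral_euclideanHausdorffMeasure_graph hU.contDiff (fun p => F (T.symm p))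
  constructor
  · intro h
    rw [surfaceMeasure, ← IntegrableOn, ← integrable_indicator_iff isClosed_frontier.measurableSet,
      hind, integrable_indicator_iff hrange]
    refine ((hT.integrableOn_comp_preimage hTemb).2 (hint h)).congr_fun (fun x _ => ?_) hrange
    simp only [Function.comp_apply, LinearIsometryEquiv.symm_apply_apply]
  · rw [surfaceMeasure, ← integral_indicator isClosed_frontier.measurableSet, hind,
      integral_indicator hrange, ← heq, ← hT.setIntegral_preimage_emb hTemb]
    simp only [LinearIsometryEquiv.symm_apply_apply]

end SurfaceIntegral

section Divergence

variable {n : ℕ}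

/-- The divergence theorem on `Ω` for the field `f e`, the flux being integrable. -/
def DivergenceFormula (Ω : Set (Euc n)) (e : Euc n) (f : Euc n → ℂ) : Prop :=
  Integrable (fun x => f x * ((inner ℝ (outwardNormal Ω x) e : ℝ) : ℂ)) (surfaceMeasure Ω) ∧
    ∫ x in Ω, fderiv ℝ f x e
      = ∫ x, f x * ((inner ℝ (outwardNormal Ω x) e : ℝ) : ℂ) ∂(surfaceMeasure Ω)

/-- The divergence theorem holds on `Ω` for the fields `f e` with support in `W`. -/
def DivergenceFormulaIn (Ω : Set (Euc n)) (e : Euc n) (W : Set (Euc n)) : Prop :=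
  ∀ f : Euc n → ℂ, LocallyLipschitz f → HasCompactSupport f → tsupport f ⊆ W →
    DivergenceFormula Ω e f

variable {Ω : Set (Euc n)} {e : Euc n}

theorem exists_contDiff_eventuallyEq_one_of_isCompact {K W : Set (Euc n)} (hK : IsCompact K)
    (hW : IsOpen W) (hKW : K ⊆ W) :
    ∃ χ : Euc n → ℂ, ContDiff ℝ ∞ χ ∧ HasCompactSupport χ ∧ tsupport χ ⊆ W ∧
      ∀ x ∈ K, χ =ᶠ[𝓝 x] 1 := by
  obtain ⟨L, hL, hKL, hLW⟩ := exists_compact_between hK hW hKW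
  obtain ⟨f, hf_zero, hf_one, -⟩ := exists_contMDiffMap_zero_one_nhds_of_isClosed
    (modelWithCornersSelf ℝ (Euc n)) (n := (⊤ : ℕ∞)) isOpen_interior.isClosed_compl hK.isClosed
    (disjoint_compl_left.mono_right hKL)
  have hsupp : tsupport (fun x => (f x : ℂ)) ⊆ L := by
    refine closure_minimal (fun x hx => ?_) hL.isClosed
    by_contra hxL
    refine hx ?_
    simp only [hf_zero.self_of_nhdsSet x fun h => hxL (interior_subset h), Complex.ofReal_zero]
  refine ⟨fun x => f x, Complex.ofRealCLM.contDiff.comp f.contMDiff.contDiff,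
    HasCompactSupport.of_support_subset_isCompact hL ((subset_tsupport _).trans hsupp),
    hsupp.trans hLW, fun x hx => ?_⟩
  filter_upwards [eventually_nhdsSet_iff_forall.1 hf_one x hx] with y hy
  rw [hy, Complex.ofReal_one, Pi.one_apply]

theorem divergenceFormulaIn_self (hΩ : IsOpen Ω) (e : Euc n) : DivergenceFormulaIn Ω e Ω := by
  intro f hf hc hs
  have hflux : (fun x => f x * ((inner ℝ (outwardNormal Ω x) e : ℝ) : ℂ))
      =ᵐ[surfaceMeasure Ω] fun _ => 0 := by
    refine (ae_restrict_iff' isClosed_frontier.measurableSet).2 (.of_forall fun x hx => ?_)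
    have hxf : x ∉ tsupport f := fun h => (hΩ.frontier_eq ▸ hx).2 (hs h)
    simp only [image_eq_zero_of_notMem_tsupport hxf, zero_mul]
  refine ⟨(integrable_zero _ _ _).congr hflux.symm, ?_⟩
  rw [integral_congr_ae hflux, integral_zero,
    setIntegral_eq_integral_of_forall_compl_eq_zero fun x hx => ?_,
    integral_fderiv_eq_zero_of_locallyLipschitz volume hf hc e]
  rw [fderiv_of_notMem_tsupport ℝ fun h => hx (hs h)]
  rfl

theorem IsGraphChart.jacobian_smul_flux {d : ℕ} {U : Set (Euc n)}
    {T : Euc n ≃ₗᵢ[ℝ] WithLp 2 (Euc d × ℝ)} {γ : Euc d → ℝ} (hU : IsGraphChart Ω T γ U)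
    {f : Euc n → ℂ} (hf : f.support ⊆ U) (e : Euc n) (y : Euc d) :
    graphJacobian (fderiv ℝ γ y) • (f (T.symm (graphMap γ y)) *
        ((inner ℝ (outwardNormal Ω (T.symm (graphMap γ y))) e : ℝ) : ℂ))
      = f (T.symm (graphMap γ y)) * (((T e).snd - fderiv ℝ γ y (T e).fst : ℝ) : ℂ) := by
  by_cases hy : f (T.symm (graphMap γ y)) = 0
  · simp only [hy, zero_mul, smul_zero]
  have hnormal := hU.isOutwardUnitNormal (hf hy)
    (by rw [LinearIsometryEquiv.apply_symm_apply]; rfl)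
  have hJ : (graphJacobian (fderiv ℝ γ y) : ℂ) ≠ 0 :=
    Complex.ofReal_ne_zero.2 (graphJacobian_pos _).ne'
  rw [hnormal.outwardNormal_eq, LinearIsometryEquiv.apply_symm_apply,
    ← LinearIsometryEquiv.inner_map_map T, LinearIsometryEquiv.apply_symm_apply,
    inner_graphNormal, Complex.real_smul]
  simp only [graphMap, WithLp.toLp_fst]
  push_cast
  field_simp

theorem IsGraphChart.integral_fderiv_eq {d : ℕ} {U : Set (Euc n)}
    {T : Euc n ≃ₗᵢ[ℝ] WithLp 2 (Euc d × ℝ)} {γ : Euc d → ℝ} (hU : IsGraphChart Ω T γ U)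
    (hΩ : MeasurableSet Ω) {f : Euc n → ℂ} (hf : tsupport f ⊆ U) (e : Euc n) :
    ∫ x in Ω, fderiv ℝ f x e =
      ∫ p in {p : WithLp 2 (Euc d × ℝ) | p.snd < γ p.fst},
        fderiv ℝ (fun p => f (T.symm p)) p (T e) := by
  have hbelow : MeasurableSet {p : WithLp 2 (Euc d × ℝ) | p.snd < γ p.fst} := by
    have := hU.contDiff.continuous
    exact (isOpen_lt (by fun_prop) (by fun_prop)).measurableSet
  have hderiv (x : Euc n) : fderiv ℝ (fun p => f (T.symm p)) (T x) (T e) = fderiv ℝ f x e := by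
    have hcomp := T.symm.toContinuousLinearEquiv.comp_right_fderiv (f := f) (x := T x)
    change fderiv ℝ (fun p => f (T.symm p)) (T x) = _ at hcomp
    rw [hcomp]
    simp
  have hsupp : (fun x => fderiv ℝ f x e).support ⊆ U := fun x hx => hf <| by
    by_contra hxf
    exact hx (by simp only [fderiv_of_notMem_tsupport ℝ hxf, _root_.zero_apply])
  rw [← T.measurePreserving.setIntegral_preimage_emb T.toHomeomorph.measurableEmbedding]
  simp only [hderiv]
  rw [← integral_indicator hΩ, ← integral_indicator (T.continuous.measurable hbelow)]
  exact congrArg _ (indicator_eq_indicator_of_support_subset hsupp hU.mem_iff)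

theorem IsGraphChart.divergenceFormulaIn {U : Set (Euc n)}
    {T : Euc n ≃ₗᵢ[ℝ] WithLp 2 (Euc (n - 1) × ℝ)} {γ : Euc (n - 1) → ℝ}
    (hU : IsGraphChart Ω T γ U) (hΩ : MeasurableSet Ω) (e : Euc n) :
    DivergenceFormulaIn Ω e U := by
  intro f hf hc hs
  have hg : LocallyLipschitz fun p => f (T.symm p) := hf.comp T.symm.lipschitz.locallyLipschitz
  have hgc : HasCompactSupport fun p => f (T.symm p) := hc.comp_homeomorph T.symm.toHomeomorph
  have hsupp : f.support ⊆ U := (subset_tsupport f).trans hs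
  obtain ⟨hint, heq⟩ := hU.integral_surfaceMeasure
    (F := fun x => f x * ((inner ℝ (outwardNormal Ω x) e : ℝ) : ℂ))
    ((Function.support_mul_subset_left _ _).trans hsupp)
  simp only [hU.jacobian_smul_flux hsupp e] at hint heq
  refine ⟨hint (Continuous.integrable_of_hasCompactSupport ?_ (HasCompactSupport.mul_right ?_)), ?_⟩
  · have := hU.contDiff.continuous_fderiv one_ne_zero
    exact (hg.continuous.comp (continuous_graphMap hU.contDiff.continuous)).mul (by fun_prop)
  · refine HasCompactSupport.intro (hgc.isCompact.image (f := WithLp.fst) (by fun_prop))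
      fun y hy => ?_
    exact image_eq_zero_of_notMem_tsupport (f := fun p => f (T.symm p))
      fun h => hy ⟨graphMap γ y, h, rfl⟩
  · rw [heq, hU.integral_fderiv_eq hΩ hs e, integral_fderiv_below_graph hU.contDiff hg hgc (T e)]

theorem DivergenceFormula.add {f g : Euc n → ℂ}
    (hf : LocallyLipschitz f) (hfc : HasCompactSupport f)
    (hg : LocallyLipschitz g) (hgc : HasCompactSupport g)
    (hfdiv : DivergenceFormula Ω e f) (hgdiv : DivergenceFormula Ω e g) :
    DivergenceFormula Ω e (fun x => f x + g x) := by
  refine ⟨by simp only [add_mul]; exact hfdiv.1.add hgdiv.1, ?_⟩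
  simp only [add_mul]
  rw [integral_add hfdiv.1 hgdiv.1, ← hfdiv.2, ← hgdiv.2,
    ← integral_add (integrable_fderiv_of_locallyLipschitz volume hf hfc e).integrableOn
      (integrable_fderiv_of_locallyLipschitz volume hg hgc e).integrableOn]
  refine integral_congr_ae (ae_restrict_of_ae ?_)
  filter_upwards [ae_differentiableAt_of_locallyLipschitz volume hf,
    ae_differentiableAt_of_locallyLipschitz volume hg] with x hx hy
  rw [fderiv_fun_add hx hy]
  rfl

theorem DivergenceFormulaIn.union {W₁ W₂ : Set (Euc n)} (h₁ : DivergenceFormulaIn Ω e W₁)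
    (h₂ : DivergenceFormulaIn Ω e W₂) (ho₁ : IsOpen W₁) (ho₂ : IsOpen W₂) :
    DivergenceFormulaIn Ω e (W₁ ∪ W₂) := by
  intro f hf hc hs
  obtain ⟨χ, hχ, -, hχs, hχ_one⟩ := exists_contDiff_eventuallyEq_one_of_isCompact
    (hc.isCompact.diff ho₂) ho₁ (fun x hx => (hs hx.1).resolve_right hx.2)
  have hχ' : ContDiff ℝ 1 χ := hχ.of_le (by simp)
  have hf₁ := locallyLipschitz_mul hχ'.locallyLipschitz hf
  have hf₂ := locallyLipschitz_mul
    (contDiff_const.sub hχ' : ContDiff ℝ 1 fun x => 1 - χ x).locallyLipschitz hf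
  have hs₁ : tsupport (fun x => χ x * f x) ⊆ W₁ := tsupport_mul_subset_left.trans hχs
  have hs₂ : tsupport (fun x => (1 - χ x) * f x) ⊆ W₂ := by
    intro x hx
    by_contra hxW
    refine (notMem_tsupport_iff_eventuallyEq.2 ?_) hx
    filter_upwards [hχ_one x ⟨tsupport_mul_subset_right hx, hxW⟩] with y hy
    rw [hy, Pi.one_apply, sub_self, zero_mul, Pi.zero_apply]
  have hsum := DivergenceFormula.add hf₁ hc.mul_left hf₂ hc.mul_left
    (h₁ _ hf₁ hc.mul_left hs₁) (h₂ _ hf₂ hc.mul_left hs₂)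
  refine (funext fun x => ?_ : f = _) ▸ hsum
  ring

theorem exists_divergenceFormulaIn (hΩo : IsOpen Ω) (hΩb : Bornology.IsBounded Ω)
    (hΩ : HasC1Boundary Ω) (e : Euc n) :
    ∃ W, IsOpen W ∧ closure Ω ⊆ W ∧ DivergenceFormulaIn Ω e W := by
  refine hΩb.isCompact_closure.induction_on
    (p := fun s => ∃ W, IsOpen W ∧ s ⊆ W ∧ DivergenceFormulaIn Ω e W) ?_ ?_ ?_ fun x hx => ?_
  · exact ⟨Ω, hΩo, empty_subset Ω, divergenceFormulaIn_self hΩo e⟩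
  · rintro s t hst ⟨W, hW, htW, hdiv⟩
    exact ⟨W, hW, hst.trans htW, hdiv⟩
  · rintro s t ⟨W₁, ho₁, hs₁, h₁⟩ ⟨W₂, ho₂, hs₂, h₂⟩
    exact ⟨W₁ ∪ W₂, ho₁.union ho₂, union_subset_union hs₁ hs₂, h₁.union h₂ ho₁ ho₂⟩
  · by_cases hxΩ : x ∈ Ω
    · exact ⟨Ω, nhdsWithin_le_nhds (hΩo.mem_nhds hxΩ), Ω, hΩo, subset_rfl,
        divergenceFormulaIn_self hΩo e⟩
    · obtain ⟨T, γ, U, hU, hxU⟩ := hΩ x (by rw [hΩo.frontier_eq]; exact ⟨hx, hxΩ⟩)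
      exact ⟨U, nhdsWithin_le_nhds (hU.isOpen.mem_nhds hxU), U, hU.isOpen, subset_rfl,
        hU.divergenceFormulaIn hΩo.measurableSet e⟩

theorem divergenceFormula (hΩo : IsOpen Ω) (hΩb : Bornology.IsBounded Ω) (hΩ : HasC1Boundary Ω)
    (e : Euc n) {f : Euc n → ℂ} (hf : LocallyLipschitz f) : DivergenceFormula Ω e f := by
  obtain ⟨W, hW, hΩW, hdiv⟩ := exists_divergenceFormulaIn hΩo hΩb hΩ e
  obtain ⟨χ, hχ, hχc, hχs, hχ_one⟩ :=
    exists_contDiff_eventuallyEq_one_of_isCompact hΩb.isCompact_closure hW hΩW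
  have hχf : ∀ x ∈ closure Ω, (fun x => χ x * f x) =ᶠ[𝓝 x] f := fun x hx => by
    filter_upwards [hχ_one x hx] with y hy
    rw [hy, Pi.one_apply, one_mul]
  obtain ⟨hint, heq⟩ := hdiv _ (locallyLipschitz_mul (hχ.of_le (by simp)).locallyLipschitz hf)
    hχc.mul_right (tsupport_mul_subset_left.trans hχs)
  have hflux : (fun x => χ x * f x * ((inner ℝ (outwardNormal Ω x) e : ℝ) : ℂ))
      =ᵐ[surfaceMeasure Ω] fun x => f x * ((inner ℝ (outwardNormal Ω x) e : ℝ) : ℂ) := by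
    refine (ae_restrict_iff' isClosed_frontier.measurableSet).2 (.of_forall fun x hx => ?_)
    exact congrArg (· * _) (hχf x (frontier_subset_closure hx)).self_of_nhds
  refine ⟨hint.congr hflux, ?_⟩
  rw [← integral_congr_ae hflux, ← heq]
  refine setIntegral_congr_fun hΩo.measurableSet fun x hx => ?_
  simp only [(hχf x (subset_closure hx)).fderiv_eq]

end Divergence

/-! ### Lipschitz continuity of `C¹` fields up to the boundary -/

section LipschitzOnClosure

variable {n : ℕ} {F : Type*} [NormedAddCommGroup F] [NormedSpace ℝ F]

-- In the convex set `C` the mean value inequality applies, even at boundary points.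
theorem exists_lipschitzOnWith_of_contDiffWithinAt_of_flattening {E E' : Type*}
    [NormedAddCommGroup E] [NormedSpace ℝ E] [NormedAddCommGroup E'] [NormedSpace ℝ E']
    {f : E → F} {s U : Set E} {x : E} (hf : ContDiffWithinAt ℝ 1 f s x)
    {τ : E → E'} {σ : E' → E} (hτ : ContDiff ℝ 1 τ) (hσ : ContDiff ℝ 1 σ)
    (hστ : Function.LeftInverse σ τ) (hτσ : Function.RightInverse σ τ) (hU : U ∈ 𝓝 x)
    {C : Set E'} (hC : Convex ℝ C) (hs : ∀ z ∈ U, z ∈ s ↔ τ z ∈ C) :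
    ∃ K, ∃ t ∈ 𝓝[s] x, LipschitzOnWith K f t := by
  have hmaps : MapsTo σ (C ∩ σ ⁻¹' U) s := fun q hq => by
    rw [hs _ hq.2, hτσ q]
    exact hq.1
  have hU' : σ ⁻¹' U ∈ 𝓝 (τ x) := hσ.continuous.continuousAt.preimage_mem_nhds (by rwa [hστ x])
  have hflat : ContDiffWithinAt ℝ 1 (f ∘ σ) C (τ x) := by
    refine (contDiffWithinAt_inter hU').1
      (ContDiffWithinAt.comp (τ x) ?_ hσ.contDiffAt.contDiffWithinAt hmaps)
    rwa [hστ x]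
  obtain ⟨K, t, ht, hK⟩ := hflat.exists_lipschitzOnWith hC
  obtain ⟨L, u, hu, hL⟩ := (hτ.contDiffAt (x := x)).exists_lipschitzOnWith
  have hlim : Tendsto τ (𝓝[s] x) (𝓝[C] (τ x)) := by
    refine tendsto_nhdsWithin_iff.2
      ⟨hτ.continuous.continuousAt.tendsto.mono_left nhdsWithin_le_nhds, ?_⟩
    filter_upwards [self_mem_nhdsWithin, nhdsWithin_le_nhds hU] with z hz hzU
    exact (hs z hzU).1 hz
  refine ⟨K * L, u ∩ τ ⁻¹' t, inter_mem (nhdsWithin_le_nhds hu) (hlim ht), ?_⟩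
  have hcomp := hK.comp (hL.mono (inter_subset_left (t := τ ⁻¹' t))) fun z hz => hz.2
  rwa [Function.comp_assoc, hστ.comp_eq_id, Function.comp_id] at hcomp

theorem IsGraphChart.exists_flattening {d : ℕ} {Ω U : Set (Euc n)}
    {T : Euc n ≃ₗᵢ[ℝ] WithLp 2 (Euc d × ℝ)} {γ : Euc d → ℝ} (hU : IsGraphChart Ω T γ U) :
    ∃ (τ : Euc n → Euc d × ℝ) (σ : Euc d × ℝ → Euc n), ContDiff ℝ 1 τ ∧ ContDiff ℝ 1 σ ∧
      Function.LeftInverse σ τ ∧ Function.RightInverse σ τ ∧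
      ∀ z ∈ U, z ∈ closure Ω ↔ τ z ∈ {q : Euc d × ℝ | q.2 ≤ 0} := by
  have hfst : ContDiff ℝ 1 fun z : Euc n => (T z).fst :=
    (WithLp.fstL 2 ℝ (Euc d) ℝ).contDiff.comp T.toContinuousLinearEquiv.contDiff
  have hsnd : ContDiff ℝ 1 fun z : Euc n => (T z).snd :=
    (WithLp.sndL 2 ℝ (Euc d) ℝ).contDiff.comp T.toContinuousLinearEquiv.contDiff
  refine ⟨fun z => ((T z).fst, (T z).snd - γ (T z).fst),
    fun q => T.symm (WithLp.toLp 2 (q.1, γ q.1 + q.2)), hfst.prodMk (hsnd.sub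
      (hU.contDiff.comp hfst)), T.symm.toContinuousLinearEquiv.contDiff.comp
      ((WithLp.prodContinuousLinearEquiv 2 ℝ (Euc d) ℝ).symm.contDiff.comp
        (contDiff_fst.prodMk ((hU.contDiff.comp contDiff_fst).add contDiff_snd))),
    fun z => ?_, fun q => ?_, fun z hz => ?_⟩
  · simp only [add_sub_cancel]
    exact T.symm_apply_apply z
  · simp only [LinearIsometryEquiv.apply_symm_apply, WithLp.toLp_fst, WithLp.toLp_snd,
      add_sub_cancel_left]
  · rw [hU.mem_closure_iff hz, mem_ofPred_eq, sub_nonpos]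

theorem locallyLipschitzOn_closure_of_contDiffOn {Ω : Set (Euc n)} (hΩo : IsOpen Ω)
    (hΩ : HasC1Boundary Ω) {f : Euc n → F} (hf : ContDiffOn ℝ 1 f (closure Ω)) :
    LocallyLipschitzOn (closure Ω) f := by
  intro x hx
  by_cases hxΩ : x ∈ Ω
  · have hfx : ContDiffAt ℝ 1 f x :=
      hf.contDiffAt (mem_of_superset (hΩo.mem_nhds hxΩ) subset_closure)
    obtain ⟨K, t, ht, hK⟩ := hfx.exists_lipschitzOnWith
    exact ⟨K, t, mem_nhdsWithin_of_mem_nhds ht, hK⟩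
  · obtain ⟨T, γ, U, hU, hxU⟩ := hΩ x (by rw [hΩo.frontier_eq]; exact ⟨hx, hxΩ⟩)
    obtain ⟨τ, σ, hτ, hσ, hστ, hτσ, hclosure⟩ := hU.exists_flattening
    exact exists_lipschitzOnWith_of_contDiffWithinAt_of_flattening (hf x hx) hτ hσ hστ hτσ
      (hU.isOpen.mem_nhds hxU)
      (convex_halfSpace_le (LinearMap.snd ℝ (Euc (n - 1)) ℝ).isLinear 0) hclosure

theorem exists_lipschitzOnWith_closure_of_contDiffOn {Ω : Set (Euc n)} (hΩo : IsOpen Ω)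
    (hΩb : Bornology.IsBounded Ω) (hΩ : HasC1Boundary Ω) {f : Euc n → F}
    (hf : ContDiffOn ℝ 1 f (closure Ω)) : ∃ K : ℝ≥0, LipschitzOnWith K f (closure Ω) :=
  LocallyLipschitzOn.exists_lipschitzOnWith_of_compact hΩb.isCompact_closure
    (locallyLipschitzOn_closure_of_contDiffOn hΩo hΩ hf)

end LipschitzOnClosure

/-! ### Sobolev spaces -/

section Sobolev

variable {n : ℕ} {Ω : Opens (Euc n)}

theorem coeFn_toL2 {f : Euc n → ℂ} (hf : MemLp f 2 (volume.restrict (Ω : Set (Euc n)))) :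
    toL2 Ω f =ᵐ[volume.restrict (Ω : Set (Euc n))] f := by
  rw [toL2, dif_pos hf]
  exact hf.coeFn_toLp

theorem toL2_eq_of_ae_eq {f : Euc n → ℂ} {u : L2 Ω}
    (h : u =ᵐ[volume.restrict (Ω : Set (Euc n))] f) : toL2 Ω f = u := by
  have hf : MemLp f 2 (volume.restrict (Ω : Set (Euc n))) := (memLp_congr_ae h).1 (Lp.memLp u)
  exact Lp.ext ((coeFn_toL2 hf).trans h.symm)

theorem toL2_congr_ae {f g : Euc n → ℂ} (h : f =ᵐ[volume.restrict (Ω : Set (Euc n))] g) :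
    toL2 Ω f = toL2 Ω g := by
  by_cases hf : MemLp f 2 (volume.restrict (Ω : Set (Euc n)))
  · exact (toL2_eq_of_ae_eq ((coeFn_toL2 hf).trans h)).symm
  · have hg : ¬ MemLp g 2 (volume.restrict (Ω : Set (Euc n))) := fun hg =>
      hf ((memLp_congr_ae h).2 hg)
    rw [toL2, toL2, dif_neg hf, dif_neg hg]

theorem toL2_add {f g : Euc n → ℂ} (hf : MemLp f 2 (volume.restrict (Ω : Set (Euc n))))
    (hg : MemLp g 2 (volume.restrict (Ω : Set (Euc n)))) :
    toL2 Ω (f + g) = toL2 Ω f + toL2 Ω g :=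
  toL2_eq_of_ae_eq ((Lp.coeFn_add _ _).trans ((coeFn_toL2 hf).add (coeFn_toL2 hg)))

theorem toL2_const_smul {f : Euc n → ℂ} (hf : MemLp f 2 (volume.restrict (Ω : Set (Euc n))))
    (c : ℂ) : toL2 Ω (c • f) = c • toL2 Ω f :=
  toL2_eq_of_ae_eq ((Lp.coeFn_smul _ _).trans ((coeFn_toL2 hf).const_smul c))

theorem integrable_L2_mul (u : L2 Ω) {f : Euc n → ℂ}
    (hf : MemLp f 2 (volume.restrict (Ω : Set (Euc n)))) :
    Integrable (fun x => u x * f x) (volume.restrict (Ω : Set (Euc n))) :=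
  (Lp.memLp u).integrable_mul hf

theorem inner_L2_eq (u v : L2 Ω) : inner ℂ u v = ∫ x in (Ω : Set (Euc n)), v x * conj (u x) := by
  rw [L2.inner_def]
  rfl

theorem memLp_of_bound_of_isBounded (hΩ : Bornology.IsBounded (Ω : Set (Euc n))) {f : Euc n → ℂ}
    {p : ℝ≥0∞} (hf : AEStronglyMeasurable f (volume.restrict (Ω : Set (Euc n)))) (C : ℝ)
    (hC : ∀ x ∈ (Ω : Set (Euc n)), ‖f x‖ ≤ C) :
    MemLp f p (volume.restrict (Ω : Set (Euc n))) := by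
  have : IsFiniteMeasure (volume.restrict (Ω : Set (Euc n))) :=
    ⟨by simpa using hΩ.measure_lt_top⟩
  exact MemLp.of_bound hf C ((ae_restrict_iff' Ω.isOpen.measurableSet).2 (ae_of_all _ hC))

theorem memLp_of_continuous (hΩ : Bornology.IsBounded (Ω : Set (Euc n))) {f : Euc n → ℂ}
    {p : ℝ≥0∞} (hf : Continuous f) : MemLp f p (volume.restrict (Ω : Set (Euc n))) := by
  obtain ⟨C, hC⟩ := hΩ.isCompact_closure.exists_bound_of_continuousOn hf.continuousOn
  exact memLp_of_bound_of_isBounded hΩ hf.aestronglyMeasurable C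
    fun x hx => hC x (subset_closure hx)

theorem norm_grad_le (f : Euc n → ℂ) (x : Euc n) (k : Fin n) : ‖grad f x k‖ ≤ ‖fderiv ℝ f x‖ := by
  simpa [grad] using (fderiv ℝ f x).le_opNorm (EuclideanSpace.single k 1)

theorem measurable_grad (f : Euc n → ℂ) (k : Fin n) : Measurable fun x => grad f x k :=
  measurable_fderiv_apply_const ℝ f _

theorem memLp_grad (hΩ : Bornology.IsBounded (Ω : Set (Euc n))) {f : Euc n → ℂ}
    {p : ℝ≥0∞} (hf : LocallyLipschitz f) (k : Fin n) :
    MemLp (fun x => grad f x k) p (volume.restrict (Ω : Set (Euc n))) := by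
  obtain ⟨C, hC⟩ := exists_norm_fderiv_le_of_locallyLipschitz hf hΩ
  exact memLp_of_bound_of_isBounded hΩ (measurable_grad f k).aestronglyMeasurable C
    fun x hx => (norm_grad_le f x k).trans (hC x hx)

theorem grad_conj (f : Euc n → ℂ) (x : Euc n) (k : Fin n) :
    grad (fun x => conj (f x)) x k = conj (grad f x k) := by
  have hconj : fderiv ℝ (fun x => conj (f x)) x = _ := Complex.conjCLE.comp_fderiv
  rw [grad, hconj]
  rfl

theorem testFunction_differentiable (φ : 𝓓(Ω, ℂ)) : Differentiable ℝ φ :=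
  φ.contDiff.differentiable (by simp)

theorem testFunction_locallyLipschitz (φ : 𝓓(Ω, ℂ)) : LocallyLipschitz φ :=
  (φ.contDiff.of_le (by simp)).locallyLipschitz

theorem testFunction_memLp (φ : 𝓓(Ω, ℂ)) {p : ℝ≥0∞} :
    MemLp φ p (volume.restrict (Ω : Set (Euc n))) :=
  (φ.continuous.memLp_of_hasCompactSupport φ.hasCompactSupport).restrict _

theorem testFunction_continuous_grad (φ : 𝓓(Ω, ℂ)) (k : Fin n) :
    Continuous fun x => grad φ x k :=
  (φ.contDiff.continuous_fderiv (by simp)).clm_apply continuous_const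

theorem testFunction_memLp_grad (φ : 𝓓(Ω, ℂ)) (k : Fin n) {p : ℝ≥0∞} :
    MemLp (fun x => grad φ x k) p (volume.restrict (Ω : Set (Euc n))) := by
  refine ((testFunction_continuous_grad φ k).memLp_of_hasCompactSupport ?_).restrict _
  exact (φ.hasCompactSupport.fderiv ℝ).comp_left (g := fun L : Euc n →L[ℝ] ℂ =>
    L (EuclideanSpace.single k 1)) rfl

/-- The complex conjugate of a test function. -/
noncomputable def conjTest (φ : 𝓓(Ω, ℂ)) : 𝓓(Ω, ℂ) where
  toFun x := conj (φ x)
  contDiff' := Complex.conjCLE.contDiff.comp φ.contDiff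
  hasCompactSupport' := φ.hasCompactSupport.comp_left (map_zero (starRingEnd ℂ))
  tsupport_subset' := by
    refine Subset.trans ?_ φ.tsupport_subset
    exact closure_mono fun x hx => by
      simpa using hx

theorem conjTest_apply (φ : 𝓓(Ω, ℂ)) (x : Euc n) : conjTest φ x = conj (φ x) := rfl

theorem grad_conjTest (φ : 𝓓(Ω, ℂ)) (x : Euc n) (k : Fin n) :
    grad (conjTest φ) x k = conj (grad φ x k) := grad_conj φ x k

theorem conjTest_conjTest (φ : 𝓓(Ω, ℂ)) : conjTest (conjTest φ) = φ := by
  ext x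
  simp [conjTest_apply]

/-- The complex-valued test function given by a real one. -/
noncomputable def ofRealTest {g : Euc n → ℝ} (hg : ContDiff ℝ ∞ g) (hgc : HasCompactSupport g)
    (hgs : tsupport g ⊆ (Ω : Set (Euc n))) : 𝓓(Ω, ℂ) where
  toFun x := (g x : ℂ)
  contDiff' := Complex.ofRealCLM.contDiff.comp hg
  hasCompactSupport' := hgc.comp_left Complex.ofReal_zero
  tsupport_subset' := (closure_mono fun x hx => by simpa using hx).trans hgs

theorem L2_ext_of_testFunction {u v : L2 Ω}
    (h : ∀ φ : 𝓓(Ω, ℂ), ∫ x in (Ω : Set (Euc n)), u x * φ x = ∫ x in (Ω : Set (Euc n)), v x * φ x) :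
    u = v := by
  refine sub_eq_zero.1 (Lp.eq_zero_iff_ae_eq_zero.2 ?_)
  refine (ae_restrict_iff' Ω.isOpen.measurableSet).2 ?_
  refine Ω.isOpen.ae_eq_zero_of_integral_contDiff_smul_eq_zero
    (locallyIntegrableOn_of_locallyIntegrable_restrict
      ((Lp.memLp (u - v)).locallyIntegrable one_le_two)) fun g hg hgc hgs => ?_
  let φ : 𝓓(Ω, ℂ) := ofRealTest hg hgc hgs
  calc ∫ x, g x • (u - v) x = ∫ x in (Ω : Set (Euc n)), g x • (u - v) x :=
        (setIntegral_eq_integral_of_forall_compl_eq_zero fun x hx => by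
          rw [image_eq_zero_of_notMem_tsupport fun h => hx (hgs h), zero_smul]).symm
    _ = ∫ x in (Ω : Set (Euc n)), (u x * φ x - v x * φ x) := by
        refine integral_congr_ae ?_
        filter_upwards [Lp.coeFn_sub u v] with x hx
        rw [hx, Pi.sub_apply, Complex.real_smul, mul_comm, sub_mul]
        rfl
    _ = 0 := by
        rw [integral_sub (integrable_L2_mul u (testFunction_memLp φ))
          (integrable_L2_mul v (testFunction_memLp φ)), h φ, sub_self]

theorem HasWeakPartial.unique {k : Fin n} {u g g' : L2 Ω} (h : HasWeakPartial k u g)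
    (h' : HasWeakPartial k u g') : g = g' :=
  L2_ext_of_testFunction fun φ => neg_injective ((h φ).symm.trans (h' φ))

theorem HasWeakPartial.weakPartial_eq {k : Fin n} {u g : L2 Ω} (h : HasWeakPartial k u g) :
    weakPartial k u = g := by
  have h' : ∃ g : L2 Ω, HasWeakPartial k u g := ⟨g, h⟩
  rw [weakPartial, dif_pos h']
  exact h'.choose_spec.unique h

theorem MemH1.hasWeakPartial {u : L2 Ω} (h : MemH1 u) (k : Fin n) :
    HasWeakPartial k u (weakPartial k u) := by
  rw [weakPartial, dif_pos (h k)]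
  exact (h k).choose_spec

theorem HasWeakDiv.weakDiv_eq {X : Fin n → L2 Ω} {d : L2 Ω} (h : HasWeakDiv X d) :
    weakDiv X = d := by
  have h' : ∃ d : L2 Ω, HasWeakDiv X d := ⟨d, h⟩
  rw [weakDiv, dif_pos h']
  exact L2_ext_of_testFunction fun φ => neg_injective ((h'.choose_spec φ).symm.trans (h φ))

theorem setIntegral_fderiv_mul_testFunction {f : Euc n → ℂ} (hf : LocallyLipschitz f)
    (φ : 𝓓(Ω, ℂ)) (k : Fin n) :
    ∫ x in (Ω : Set (Euc n)), f x * grad φ x k = -∫ x in (Ω : Set (Euc n)), grad f x k * φ x := by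
  have h := integral_fderiv_mul_of_locallyLipschitz volume hf (testFunction_locallyLipschitz φ)
    φ.hasCompactSupport (EuclideanSpace.single k 1)
  rw [setIntegral_eq_integral_of_forall_compl_eq_zero,
    setIntegral_eq_integral_of_forall_compl_eq_zero]
  · exact (neg_eq_iff_eq_neg.2 h).symm
  · intro x hx
    rw [image_eq_zero_of_notMem_tsupport fun h => hx (φ.tsupport_subset h), mul_zero]
  · intro x hx
    rw [grad, fderiv_of_notMem_tsupport ℝ fun h => hx (φ.tsupport_subset h)]
    simp

theorem hasWeakPartial_toL2_of_memLp {f : Euc n → ℂ} (hf : LocallyLipschitz f) {k : Fin n}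
    (hfL : MemLp f 2 (volume.restrict (Ω : Set (Euc n))))
    (hgL : MemLp (fun x => grad f x k) 2 (volume.restrict (Ω : Set (Euc n)))) :
    HasWeakPartial k (toL2 Ω f) (toL2 Ω fun x => grad f x k) := by
  intro φ
  calc ∫ x in (Ω : Set (Euc n)), toL2 Ω f x * grad φ x k
      = ∫ x in (Ω : Set (Euc n)), f x * grad φ x k :=
        integral_congr_ae ((coeFn_toL2 hfL).mul (ae_eq_refl _))
    _ = -∫ x in (Ω : Set (Euc n)), grad f x k * φ x := setIntegral_fderiv_mul_testFunction hf φ k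
    _ = -∫ x in (Ω : Set (Euc n)), toL2 Ω (fun x => grad f x k) x * φ x :=
        congrArg Neg.neg (integral_congr_ae ((coeFn_toL2 hgL).symm.mul (ae_eq_refl _)))

theorem hasWeakPartial_toL2 (hΩ : Bornology.IsBounded (Ω : Set (Euc n))) {f : Euc n → ℂ}
    (hf : LocallyLipschitz f) (k : Fin n) :
    HasWeakPartial k (toL2 Ω f) (toL2 Ω fun x => grad f x k) :=
  hasWeakPartial_toL2_of_memLp hf (memLp_of_continuous hΩ hf.continuous) (memLp_grad hΩ hf k)

end Sobolev

/-! ### The space `H¹₀(Ω)` as a Hilbert space of pairs `(u, ∇u)` -/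

section H10

variable {n : ℕ} {Ω : Opens (Euc n)}

/-- Pairs `(u, g)` of a function and a field in `L²(Ω)`: the function is the component `none`. -/
abbrev Jet (Ω : Opens (Euc n)) : Type := PiLp 2 fun _ : Option (Fin n) => L2 Ω

/-- The pair `(u, ∇u)`. -/
noncomputable def jet (u : L2 Ω) : Jet Ω :=
  WithLp.toLp 2 fun o => o.elim u fun k => weakPartial k u

/-- The components of a pair `(u, g)` as operators. -/
noncomputable abbrev jetProj (o : Option (Fin n)) : Jet Ω →L[ℂ] L2 Ω :=
  PiLp.proj 2 (fun _ => L2 Ω) o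

theorem norm_jet_le {q : Jet Ω} {ε : ℝ} (hε : 0 ≤ ε) (h : ∀ o, ‖q o‖ ≤ ε) :
    ‖q‖ ≤ √(n + 1) * ε := by
  rw [PiLp.norm_eq_of_L2]
  refine Real.sqrt_le_iff.2 ⟨by positivity, ?_⟩
  calc ∑ o, ‖q o‖ ^ 2 ≤ ∑ _o : Option (Fin n), ε ^ 2 :=
        Finset.sum_le_sum fun o _ => pow_le_pow_left₀ (norm_nonneg _) (h o) 2
    _ = (√(n + 1) * ε) ^ 2 := by
        rw [Finset.sum_const, Finset.card_univ, Fintype.card_option, Fintype.card_fin,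
          nsmul_eq_mul, mul_pow, Real.sq_sqrt (by positivity), Nat.cast_succ]

theorem hasWeakPartial_testFunction (φ : 𝓓(Ω, ℂ)) (k : Fin n) :
    HasWeakPartial k (toL2 Ω φ) (toL2 Ω fun x => grad φ x k) :=
  hasWeakPartial_toL2_of_memLp (testFunction_locallyLipschitz φ) (testFunction_memLp φ)
    (testFunction_memLp_grad φ k)

theorem grad_add_testFunction (φ ψ : 𝓓(Ω, ℂ)) (k : Fin n) :
    (fun x => grad (φ + ψ : 𝓓(Ω, ℂ)) x k) = (fun x => grad φ x k) + fun x => grad ψ x k := by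
  ext x
  have hadd : fderiv ℝ (⇑(φ + ψ)) x = fderiv ℝ φ x + fderiv ℝ ψ x :=
    fderiv_add (testFunction_differentiable φ x) (testFunction_differentiable ψ x)
  simp only [grad, hadd, Pi.add_apply]
  rfl

theorem grad_smul_testFunction (c : ℂ) (φ : 𝓓(Ω, ℂ)) (k : Fin n) :
    (fun x => grad (c • φ : 𝓓(Ω, ℂ)) x k) = c • fun x => grad φ x k := by
  ext x
  have hsmul : fderiv ℝ (⇑(c • φ)) x = c • fderiv ℝ φ x :=
    fderiv_const_smul (testFunction_differentiable φ x) c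
  simp only [grad, hsmul, Pi.smul_apply]
  rfl

/-- The pair `(φ, ∇φ)` of a test function `φ`. -/
noncomputable def testJet : 𝓓(Ω, ℂ) →ₗ[ℂ] Jet Ω where
  toFun φ := WithLp.toLp 2 fun o => o.elim (toL2 Ω φ) fun k => toL2 Ω fun x => grad φ x k
  map_add' φ ψ := by
    ext1 o
    cases o with
    | none => exact toL2_add (testFunction_memLp φ) (testFunction_memLp ψ)
    | some k =>
      change toL2 Ω _ = toL2 Ω _ + toL2 Ω _
      rw [grad_add_testFunction, toL2_add (testFunction_memLp_grad φ k)
        (testFunction_memLp_grad ψ k)]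
  map_smul' c φ := by
    ext1 o
    cases o with
    | none => exact toL2_const_smul (testFunction_memLp φ) c
    | some k =>
      change toL2 Ω _ = c • toL2 Ω _
      rw [grad_smul_testFunction, toL2_const_smul (testFunction_memLp_grad φ k)]

theorem testJet_none (φ : 𝓓(Ω, ℂ)) : testJet φ none = toL2 Ω φ := rfl

theorem testJet_some (φ : 𝓓(Ω, ℂ)) (k : Fin n) :
    testJet φ (some k) = toL2 Ω fun x => grad φ x k := rfl

variable (Ω) in
/-- The space `H¹₀(Ω)`, realized as the closure of the set of pairs `(φ, ∇φ)`. -/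
noncomputable def H10 : Submodule ℂ (Jet Ω) :=
  (LinearMap.range (testJet (Ω := Ω))).topologicalClosure

theorem isClosed_H10 : IsClosed (H10 Ω : Set (Jet Ω)) :=
  Submodule.isClosed_topologicalClosure _

theorem testJet_mem_H10 (φ : 𝓓(Ω, ℂ)) : testJet φ ∈ H10 Ω :=
  Submodule.le_topologicalClosure _ ⟨φ, rfl⟩

theorem H10_induction {p : Jet Ω → Prop} (hp : IsClosed {q | p q}) (h : ∀ φ, p (testJet φ))
    {q : Jet Ω} (hq : q ∈ H10 Ω) : p q := by
  have hle : closure (LinearMap.range (testJet (Ω := Ω)) : Set (Jet Ω)) ⊆ {q | p q} :=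
    closure_minimal (by rintro _ ⟨φ, rfl⟩; exact h φ) hp
  exact hle hq

theorem mem_H10_iff {q : Jet Ω} :
    q ∈ H10 Ω ↔ ∀ ε > 0, ∃ φ : 𝓓(Ω, ℂ), ∀ o, ‖(q - testJet φ) o‖ ≤ ε := by
  rw [H10, ← SetLike.mem_coe, Submodule.topologicalClosure_coe, Metric.mem_closure_iff]
  constructor
  · intro hq ε hε
    obtain ⟨_, ⟨φ, rfl⟩, h⟩ := hq ε hε
    exact ⟨φ, fun o => (PiLp.norm_apply_le _ o).trans (dist_eq_norm q _ ▸ h.le)⟩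
  · intro h ε hε
    have hn : (0 : ℝ) < √(n + 1) := by positivity
    obtain ⟨φ, hφ⟩ := h (ε / 2 / √(n + 1)) (by positivity)
    refine ⟨testJet φ, ⟨φ, rfl⟩, ?_⟩
    calc dist q (testJet φ) ≤ √(n + 1) * (ε / 2 / √(n + 1)) :=
          (dist_eq_norm q _).trans_le (norm_jet_le (by positivity) hφ)
      _ = ε / 2 := mul_div_cancel₀ _ hn.ne'
      _ < ε := half_lt_self hε

theorem integral_L2_mul_eq_inner (u : L2 Ω) {f : Euc n → ℂ}
    (hf : MemLp f 2 (volume.restrict (Ω : Set (Euc n)))) :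
    ∫ x in (Ω : Set (Euc n)), u x * f x = inner ℂ (toL2 Ω fun x => conj (f x)) u := by
  rw [inner_L2_eq]
  have hf' : MemLp (fun x => conj (f x)) 2 (volume.restrict (Ω : Set (Euc n))) :=
    hf.star
  refine integral_congr_ae ?_
  filter_upwards [coeFn_toL2 hf'] with x hx
  rw [hx, Complex.conj_conj]

theorem hasWeakPartial_of_mem_H10 {q : Jet Ω} (hq : q ∈ H10 Ω) (k : Fin n) :
    HasWeakPartial k (q none) (q (some k)) := by
  intro φ
  refine H10_induction (p := fun q => ∫ x in (Ω : Set (Euc n)), q none x * grad φ x k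
    = -∫ x in (Ω : Set (Euc n)), q (some k) x * φ x) ?_ (fun ψ => ?_) hq
  · simp only [integral_L2_mul_eq_inner _ (testFunction_memLp φ),
      integral_L2_mul_eq_inner _ (testFunction_memLp_grad φ k)]
    exact isClosed_eq (by fun_prop) (by fun_prop)
  · exact hasWeakPartial_testFunction ψ k φ

theorem jet_eq_of_mem_H10 {q : Jet Ω} (hq : q ∈ H10 Ω) : jet (q none) = q := by
  ext1 o
  cases o with
  | none => rfl
  | some k => exact (hasWeakPartial_of_mem_H10 hq k).weakPartial_eq

theorem memH1_of_mem_H10 {q : Jet Ω} (hq : q ∈ H10 Ω) : MemH1 (q none) := fun k =>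
  ⟨_, hasWeakPartial_of_mem_H10 hq k⟩

theorem memH10_iff {u : L2 Ω} : MemH10 u ↔ jet u ∈ H10 Ω := by
  constructor
  · rintro ⟨-, h⟩
    refine mem_H10_iff.2 fun ε hε => ?_
    obtain ⟨φ, hval, hgrad⟩ := h ε hε
    exact ⟨φ, fun o => o.rec hval hgrad⟩
  · intro hu
    refine ⟨memH1_of_mem_H10 hu, fun ε hε => ?_⟩
    obtain ⟨φ, hφ⟩ := mem_H10_iff.1 hu ε hε
    exact ⟨φ, hφ none, fun k => hφ (some k)⟩

/-! ### The magnetic form -/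

/-- Multiplication by a bounded function on `L²(Ω)`. -/
noncomputable def mulL {m : Euc n → ℂ}
    (hm : MemLp m (⊤ : ℝ≥0∞) (volume.restrict (Ω : Set (Euc n)))) : L2 Ω →L[ℂ] L2 Ω :=
  (ContinuousLinearMap.mul ℂ ℂ).holderL (volume.restrict (Ω : Set (Euc n))) ⊤ 2 2 (hm.toLp m)

theorem coeFn_mulL {m : Euc n → ℂ}
    (hm : MemLp m (⊤ : ℝ≥0∞) (volume.restrict (Ω : Set (Euc n)))) (u : L2 Ω) :
    mulL hm u =ᵐ[volume.restrict (Ω : Set (Euc n))] fun x => m x * u x := by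
  have hcoe : mulL hm u =ᵐ[volume.restrict (Ω : Set (Euc n))] fun x => hm.toLp m x * u x :=
    ContinuousLinearMap.coeFn_holder (r := 2) (ContinuousLinearMap.mul ℂ ℂ) (hm.toLp m) u
  exact hcoe.trans (hm.coeFn_toLp.mul (ae_eq_refl _))

/-- The coefficients `A`, `V` of the magnetic Schrödinger operator are in `L^∞(Ω)`. -/
structure BoundedCoefficients (Ω : Opens (Euc n)) (A : Euc n → Euc n) (V : Euc n → ℝ) : Prop where
  field : ∀ k, MemLp (fun x => toC (A x) k) (⊤ : ℝ≥0∞) (volume.restrict (Ω : Set (Euc n)))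
  potential : MemLp (fun x => (V x : ℂ)) (⊤ : ℝ≥0∞) (volume.restrict (Ω : Set (Euc n)))

variable {A : Euc n → Euc n} {V : Euc n → ℝ}

/-- The `k`-th component of `(-i∇ + A) u`. -/
noncomputable def momentum (h : BoundedCoefficients Ω A V) (k : Fin n) : Jet Ω →L[ℂ] L2 Ω :=
  (-Complex.I) • jetProj (some k) + (mulL (h.field k)).comp (jetProj none)

theorem momentum_apply (h : BoundedCoefficients Ω A V) (k : Fin n) (q : Jet Ω) :
    momentum h k q = (-Complex.I) • q (some k) + mulL (h.field k) (q none) := rfl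

theorem coeFn_momentum (h : BoundedCoefficients Ω A V) (k : Fin n) (q : Jet Ω) :
    momentum h k q =ᵐ[volume.restrict (Ω : Set (Euc n))]
      fun x => -Complex.I * q (some k) x + toC (A x) k * q none x := by
  rw [momentum_apply]
  filter_upwards [Lp.coeFn_add ((-Complex.I) • q (some k)) (mulL (h.field k) (q none)),
    Lp.coeFn_smul (-Complex.I) (q (some k)), coeFn_mulL (h.field k) (q none)] with x hadd hsmul hmul
  rw [hadd, Pi.add_apply, hsmul, hmul]
  rfl

/-- The bounded operator on pairs representing the form `⟨(-i∇ + A) u, (-i∇ + A) v⟩ + ⟨V u, v⟩`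
of `H = (-i∇ + A)² + V`. -/
noncomputable def formOp (h : BoundedCoefficients Ω A V) : Jet Ω →L[ℂ] Jet Ω :=
  (∑ k, (momentum h k).adjoint.comp (momentum h k))
    + (jetProj none).adjoint.comp ((mulL h.potential).comp (jetProj none))

theorem inner_formOp (h : BoundedCoefficients Ω A V) (q p : Jet Ω) :
    inner ℂ q (formOp h p) = (∑ k, inner ℂ (momentum h k q) (momentum h k p))
      + inner ℂ (q none) (mulL h.potential (p none)) := by
  simp only [formOp, _root_.add_apply, _root_.sum_apply,
    ContinuousLinearMap.comp_apply, inner_add_right, inner_sum,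
    ContinuousLinearMap.adjoint_inner_right, PiLp.proj_apply]

theorem inner_testJet_formOp (h : BoundedCoefficients Ω A V) (φ : 𝓓(Ω, ℂ)) (p : Jet Ω) :
    inner ℂ (testJet (conjTest φ)) (formOp h p)
      = (∑ k, ∫ x in (Ω : Set (Euc n)), (-Complex.I * p (some k) x + toC (A x) k * p none x) *
          (Complex.I * grad φ x k + toC (A x) k * φ x))
      + ∫ x in (Ω : Set (Euc n)), (V x : ℂ) * p none x * φ x := by
  rw [inner_formOp]
  congr 1
  · refine Finset.sum_congr rfl fun k _ => ?_
    rw [inner_L2_eq]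
    refine integral_congr_ae ?_
    filter_upwards [coeFn_momentum h k p, coeFn_momentum h k (testJet (conjTest φ)),
      coeFn_toL2 (testFunction_memLp (conjTest φ)),
      coeFn_toL2 (testFunction_memLp_grad (conjTest φ) k)] with x hp hφ hval hgrad
    rw [hp, hφ, testJet_none, testJet_some, hval, hgrad, grad_conjTest, conjTest_apply]
    simp [toC]
  · rw [inner_L2_eq]
    refine integral_congr_ae ?_
    filter_upwards [coeFn_mulL h.potential (p none),
      coeFn_toL2 (testFunction_memLp (conjTest φ))] with x hmul hval
    rw [hmul, testJet_none, hval, conjTest_apply, Complex.conj_conj]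

theorem inner_testFunction (φ : 𝓓(Ω, ℂ)) (f : L2 Ω) :
    inner ℂ (testJet (conjTest φ) none) f = ∫ x in (Ω : Set (Euc n)), f x * φ x := by
  rw [integral_L2_mul_eq_inner f (testFunction_memLp φ)]
  rfl

theorem solvesMagnetic_iff (h : BoundedCoefficients Ω A V) {u f : L2 Ω} :
    SolvesMagnetic A V u f ↔ MemH1 u ∧ ∀ q ∈ H10 Ω,
      inner ℂ q (formOp h (jet u)) = inner ℂ (q none) f := by
  refine and_congr_right fun _ => ?_
  constructor
  · intro hs q hq
    refine H10_induction (p := fun q => inner ℂ q (formOp h (jet u)) = inner ℂ (q none) f)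
      (isClosed_eq (by fun_prop) (by fun_prop)) (fun φ => ?_) hq
    rw [← conjTest_conjTest φ, inner_testJet_formOp, inner_testFunction]
    exact hs (conjTest φ)
  · intro hs φ
    have htest := hs _ (testJet_mem_H10 (conjTest φ))
    rwa [inner_testJet_formOp, inner_testFunction] at htest

end H10

/-! ### The resolvent -/

section Resolvent

variable {n : ℕ} {Ω : Opens (Euc n)} {A : Euc n → Euc n} {V : Euc n → ℝ}

theorem im_inner_mulL_real (h : BoundedCoefficients Ω A V) (u : L2 Ω) :
    (inner ℂ u (mulL h.potential u)).im = 0 := by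
  rw [inner_L2_eq]
  have hreal : ∫ x in (Ω : Set (Euc n)), mulL h.potential u x * conj (u x)
      = ∫ x in (Ω : Set (Euc n)), ((V x * Complex.normSq (u x) : ℝ) : ℂ) := by
    refine integral_congr_ae ?_
    filter_upwards [coeFn_mulL h.potential u] with x hx
    rw [hx, mul_assoc, Complex.mul_conj, Complex.ofReal_mul]
  rw [hreal, integral_complex_ofReal, Complex.ofReal_im]

/-- The bounded operator on pairs representing the form of `H - lam`. -/
noncomputable def shiftedFormOp (h : BoundedCoefficients Ω A V) (lam : ℂ) : Jet Ω →L[ℂ] Jet Ω :=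
  formOp h - lam • (jetProj none).adjoint.comp (jetProj none)

theorem inner_shiftedFormOp (h : BoundedCoefficients Ω A V) (lam : ℂ) (q p : Jet Ω) :
    inner ℂ q (shiftedFormOp h lam p)
      = inner ℂ q (formOp h p) - lam * inner ℂ (q none) (p none) := by
  simp only [shiftedFormOp, _root_.sub_apply, _root_.smul_apply, ContinuousLinearMap.comp_apply,
    inner_sub_right, inner_smul_right, ContinuousLinearMap.adjoint_inner_right, PiLp.proj_apply]

theorem inner_self_shiftedFormOp (h : BoundedCoefficients Ω A V) (lam : ℂ) (p : Jet Ω) :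
    inner ℂ p (shiftedFormOp h lam p) = ((∑ k, ‖momentum h k p‖ ^ 2 : ℝ) : ℂ)
      + inner ℂ (p none) (mulL h.potential (p none)) - lam * ((‖p none‖ ^ 2 : ℝ) : ℂ) := by
  have hself : ∀ u : L2 Ω, inner ℂ u u = ((‖u‖ ^ 2 : ℝ) : ℂ) := fun u =>
    (inner_self_eq_norm_sq_to_K u).trans (Complex.ofReal_pow _ _).symm
  simp only [inner_shiftedFormOp, inner_formOp, hself, Complex.ofReal_sum]

theorem abs_im_mul_norm_sq_le (h : BoundedCoefficients Ω A V) (lam : ℂ) (p : Jet Ω) :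
    |lam.im| * ‖p none‖ ^ 2 ≤ ‖inner ℂ p (shiftedFormOp h lam p)‖ := by
  have him : (inner ℂ p (shiftedFormOp h lam p)).im = -(lam.im * ‖p none‖ ^ 2) := by
    rw [inner_self_shiftedFormOp, Complex.sub_im, Complex.add_im, im_inner_mulL_real h,
      Complex.im_mul_ofReal, Complex.ofReal_im, zero_add, zero_sub]
  calc |lam.im| * ‖p none‖ ^ 2 = |(inner ℂ p (shiftedFormOp h lam p)).im| := by
        rw [him, abs_neg, abs_mul, abs_of_nonneg (sq_nonneg ‖p none‖)]
    _ ≤ ‖inner ℂ p (shiftedFormOp h lam p)‖ := Complex.abs_im_le_norm _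

theorem norm_inner_mulL_le {m : Euc n → ℂ}
    (hm : MemLp m (⊤ : ℝ≥0∞) (volume.restrict (Ω : Set (Euc n)))) (u : L2 Ω) :
    ‖inner ℂ u (mulL hm u)‖ ≤ ‖mulL hm‖ * ‖u‖ ^ 2 :=
  calc ‖inner ℂ u (mulL hm u)‖ ≤ ‖u‖ * (‖mulL hm‖ * ‖u‖) :=
        (norm_inner_le_norm _ _).trans (by gcongr; exact (mulL hm).le_opNorm u)
    _ = ‖mulL hm‖ * ‖u‖ ^ 2 := by ring

theorem sum_norm_momentum_sq_le (h : BoundedCoefficients Ω A V) (lam : ℂ) (p : Jet Ω) :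
    ∑ k, ‖momentum h k p‖ ^ 2
      ≤ ‖inner ℂ p (shiftedFormOp h lam p)‖ + (‖mulL h.potential‖ + ‖lam‖) * ‖p none‖ ^ 2 := by
  set s : ℝ := ∑ k, ‖momentum h k p‖ ^ 2
  set z := inner ℂ p (shiftedFormOp h lam p) with hz
  set v := inner ℂ (p none) (mulL h.potential (p none))
  have hsz : (s : ℂ) = z - v + lam * ((‖p none‖ ^ 2 : ℝ) : ℂ) := by
    rw [hz, inner_self_shiftedFormOp]
    ring
  calc s = ‖(s : ℂ)‖ := by
        rw [Complex.norm_real, Real.norm_of_nonneg (Finset.sum_nonneg fun k _ => sq_nonneg _)]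
    _ ≤ ‖z‖ + ‖v‖ + ‖lam * ((‖p none‖ ^ 2 : ℝ) : ℂ)‖ := by
        rw [hsz]
        exact (norm_add_le _ _).trans (by gcongr; exact norm_sub_le _ _)
    _ ≤ ‖z‖ + ‖mulL h.potential‖ * ‖p none‖ ^ 2 + ‖lam‖ * ‖p none‖ ^ 2 := by
        rw [norm_mul, Complex.norm_real, Real.norm_of_nonneg (sq_nonneg _)]
        gcongr
        exact norm_inner_mulL_le _ _
    _ = ‖z‖ + (‖mulL h.potential‖ + ‖lam‖) * ‖p none‖ ^ 2 := by ring

theorem norm_sq_component_le (h : BoundedCoefficients Ω A V) (k : Fin n) (p : Jet Ω) :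
    ‖p (some k)‖ ^ 2
      ≤ 2 * ‖momentum h k p‖ ^ 2 + 2 * (‖mulL (h.field k)‖ ^ 2 * ‖p none‖ ^ 2) := by
  have hk : (-Complex.I) • p (some k) = momentum h k p - mulL (h.field k) (p none) := by
    rw [momentum_apply, add_sub_cancel_right]
  have hle : ‖p (some k)‖ ≤ ‖momentum h k p‖ + ‖mulL (h.field k)‖ * ‖p none‖ :=
    calc ‖p (some k)‖ = ‖(-Complex.I) • p (some k)‖ := by simp [norm_smul]
      _ ≤ ‖momentum h k p‖ + ‖mulL (h.field k)‖ * ‖p none‖ := by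
        rw [hk]
        exact (norm_sub_le _ _).trans (by gcongr; exact ContinuousLinearMap.le_opNorm _ _)
  calc ‖p (some k)‖ ^ 2 ≤ (‖momentum h k p‖ + ‖mulL (h.field k)‖ * ‖p none‖) ^ 2 := by gcongr
    _ ≤ 2 * (‖momentum h k p‖ ^ 2 + (‖mulL (h.field k)‖ * ‖p none‖) ^ 2) := add_sq_le
    _ = _ := by ring

theorem norm_sq_le_sum_norm_momentum_sq (h : BoundedCoefficients Ω A V) (p : Jet Ω) :
    ‖p‖ ^ 2 ≤ 2 * ∑ k, ‖momentum h k p‖ ^ 2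
      + (1 + 2 * ∑ k, ‖mulL (h.field k)‖ ^ 2) * ‖p none‖ ^ 2 :=
  calc ‖p‖ ^ 2 = ‖p none‖ ^ 2 + ∑ k, ‖p (some k)‖ ^ 2 := by
        rw [PiLp.norm_sq_eq_of_L2, Fintype.sum_option]
    _ ≤ ‖p none‖ ^ 2
        + ∑ k, (2 * ‖momentum h k p‖ ^ 2 + 2 * (‖mulL (h.field k)‖ ^ 2 * ‖p none‖ ^ 2)) := by
        gcongr with k
        exact norm_sq_component_le h k p
    _ = _ := by
        rw [Finset.sum_add_distrib, ← Finset.mul_sum, ← Finset.mul_sum, ← Finset.sum_mul]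
        ring

/-- Since `V` is real, the imaginary part of the form bounds `‖u‖²`, its modulus then bounds
`‖(-i∇ + A) u‖²`, and both together bound the full norm. -/
theorem exists_norm_sq_mul_le_norm_inner_shiftedFormOp (h : BoundedCoefficients Ω A V) {lam : ℂ}
    (hlam : lam.im ≠ 0) : ∃ c : ℝ≥0, 0 < c ∧
      ∀ p : Jet Ω, ‖p‖ ^ 2 * c ≤ ‖inner ℂ p (shiftedFormOp h lam p)‖ := by
  have him : 0 < |lam.im| := abs_pos.2 hlam
  set B : ℝ := 2 * (‖mulL h.potential‖ + ‖lam‖) + (1 + 2 * ∑ k, ‖mulL (h.field k)‖ ^ 2) with hB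
  have : 0 ≤ B := by positivity
  have hD : 0 < 2 + B / |lam.im| := by positivity
  refine ⟨Real.toNNReal (2 + B / |lam.im|)⁻¹, Real.toNNReal_pos.2 (inv_pos.2 hD), fun p => ?_⟩
  set z := inner ℂ p (shiftedFormOp h lam p)
  rw [Real.coe_toNNReal _ (inv_nonneg.2 hD.le), ← div_eq_mul_inv, div_le_iff₀ hD]
  calc ‖p‖ ^ 2 ≤ 2 * (‖z‖ + (‖mulL h.potential‖ + ‖lam‖) * ‖p none‖ ^ 2)
        + (1 + 2 * ∑ k, ‖mulL (h.field k)‖ ^ 2) * ‖p none‖ ^ 2 :=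
        (norm_sq_le_sum_norm_momentum_sq h p).trans
          (by gcongr; exact sum_norm_momentum_sq_le h lam p)
    _ = 2 * ‖z‖ + B * ‖p none‖ ^ 2 := by rw [hB]; ring
    _ ≤ 2 * ‖z‖ + B * (‖z‖ / |lam.im|) := by
        gcongr
        exact (le_div_iff₀' him).2 (abs_im_mul_norm_sq_le h lam p)
    _ = ‖z‖ * (2 + B / |lam.im|) := by ring

/-- The compression to `H¹₀(Ω)` of the operator representing the form of `H - lam`. -/
noncomputable def dirichletFormOp (h : BoundedCoefficients Ω A V) (lam : ℂ)
    [CompleteSpace (H10 Ω)] : H10 Ω →L[ℂ] H10 Ω :=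
  (H10 Ω).subtypeL.adjoint.comp ((shiftedFormOp h lam).comp (H10 Ω).subtypeL)

theorem inner_dirichletFormOp (h : BoundedCoefficients Ω A V) (lam : ℂ) [CompleteSpace (H10 Ω)]
    (q p : H10 Ω) :
    inner ℂ q (dirichletFormOp h lam p) = inner ℂ (q : Jet Ω) (shiftedFormOp h lam p) :=
  ContinuousLinearMap.adjoint_inner_right (H10 Ω).subtypeL _ _

theorem bijective_dirichletFormOp (h : BoundedCoefficients Ω A V) {lam : ℂ} (hlam : lam.im ≠ 0)
    [CompleteSpace (H10 Ω)] : Function.Bijective (dirichletFormOp h lam) := by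
  obtain ⟨c, hc, hcoercive⟩ := exists_norm_sq_mul_le_norm_inner_shiftedFormOp h hlam
  rw [← ContinuousLinearMap.isUnit_iff_bijective]
  refine ContinuousLinearMap.isUnit_of_forall_le_norm_inner_map _ hc fun p => ?_
  rw [norm_inner_symm, inner_dirichletFormOp]
  exact hcoercive p

theorem mem_schrodingerGraph_iff (h : BoundedCoefficients Ω A V) {lam : ℂ} {p : Jet Ω}
    (hp : p ∈ H10 Ω) (f : L2 Ω) :
    (p none, f + lam • p none) ∈ schrodingerGraph Ω A V ↔
      ∀ q ∈ H10 Ω, inner ℂ q (shiftedFormOp h lam p) = inner ℂ (q none) f := by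
  simp only [schrodingerGraph, Set.mem_ofPred_eq, memH10_iff, jet_eq_of_mem_H10 hp,
    solvesMagnetic_iff h, hp, true_and, memH1_of_mem_H10 hp, inner_shiftedFormOp,
    inner_add_right, inner_smul_right, sub_eq_iff_eq_add]

theorem resolventExists (h : BoundedCoefficients Ω A V) {lam : ℂ} (hlam : lam.im ≠ 0) :
    ResolventExists Ω A V lam := by
  have : CompleteSpace (H10 Ω) := isClosed_H10.completeSpace_coe
  intro f
  -- The Riesz representative in `H¹₀(Ω)` of the functional `q ↦ ⟨q, f⟩`.
  set y : H10 Ω := (H10 Ω).subtypeL.adjoint ((jetProj none).adjoint f)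
  have inner_y : ∀ q : H10 Ω, inner ℂ q y = inner ℂ ((q : Jet Ω) none) f := fun q =>
    (ContinuousLinearMap.adjoint_inner_right _ _ _).trans
      (ContinuousLinearMap.adjoint_inner_right _ _ _)
  have hiff : ∀ p : H10 Ω, ((p : Jet Ω) none, f + lam • (p : Jet Ω) none) ∈ schrodingerGraph Ω A V
      ↔ dirichletFormOp h lam p = y := fun p => by
    rw [mem_schrodingerGraph_iff h p.2, ext_iff_inner_left ℂ]
    simp only [inner_dirichletFormOp, inner_y, Subtype.forall]
  obtain ⟨p, hp⟩ := (bijective_dirichletFormOp h hlam).2 y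
  refine ⟨(p : Jet Ω) none, (hiff p).2 hp, fun v hv => ?_⟩
  have hjet : jet v ∈ H10 Ω := memH10_iff.1 hv.1
  have heq : (⟨jet v, hjet⟩ : H10 Ω) = p :=
    (bijective_dirichletFormOp h hlam).1 (((hiff ⟨jet v, hjet⟩).1 hv).trans hp.symm)
  exact congrArg (fun q : H10 Ω => (q : Jet Ω) none) heq

theorem schrodingerResolvent_mem_graph {lam : ℂ} (h : ResolventExists Ω A V lam) (f : L2 Ω) :
    (schrodingerResolvent Ω A V lam f, f + lam • schrodingerResolvent Ω A V lam f)
      ∈ schrodingerGraph Ω A V := by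
  have h' := (h f).exists
  rw [schrodingerResolvent, dif_pos h']
  exact h'.choose_spec

theorem HasWeakPartial.sub {k : Fin n} {u v g g' : L2 Ω} (hu : HasWeakPartial k u g)
    (hv : HasWeakPartial k v g') : HasWeakPartial k (u - v) (g - g') := by
  intro φ
  have hu' := hu φ
  have hv' := hv φ
  rw [integral_L2_mul_eq_inner _ (testFunction_memLp_grad φ k),
    integral_L2_mul_eq_inner _ (testFunction_memLp φ)] at hu' hv' ⊢
  rw [inner_sub_right, inner_sub_right, hu', hv']
  ring

theorem MemH1.sub {u v : L2 Ω} (hu : MemH1 u) (hv : MemH1 v) : MemH1 (u - v) := fun k =>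
  ⟨_, (hu.hasWeakPartial k).sub (hv.hasWeakPartial k)⟩

theorem jet_sub {u v : L2 Ω} (hu : MemH1 u) (hv : MemH1 v) : jet (u - v) = jet u - jet v := by
  ext1 o
  cases o with
  | none => rfl
  | some k => exact ((hu.hasWeakPartial k).sub (hv.hasWeakPartial k)).weakPartial_eq

theorem SolvesMagnetic.sub (h : BoundedCoefficients Ω A V) {u v f g : L2 Ω}
    (hu : SolvesMagnetic A V u f) (hv : SolvesMagnetic A V v g) :
    SolvesMagnetic A V (u - v) (f - g) := by
  rw [solvesMagnetic_iff h] at hu hv ⊢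
  refine ⟨hu.1.sub hv.1, fun q hq => ?_⟩
  rw [jet_sub hu.1 hv.1, map_sub, inner_sub_right, inner_sub_right, hu.2 q hq, hv.2 q hq]

theorem MemH10.sub {u v : L2 Ω} (hu : MemH10 u) (hv : MemH10 v) : MemH10 (u - v) := by
  have hjet := (H10 Ω).sub_mem (memH10_iff.1 hu) (memH10_iff.1 hv)
  rw [← jet_sub hu.1 hv.1] at hjet
  exact memH10_iff.2 hjet

theorem MemH10.neg {u : L2 Ω} (hu : MemH10 u) : MemH10 (-u) := by
  simpa using (hu.sub hu).sub hu

theorem isDirichletSolution_iff (h : BoundedCoefficients Ω A V) {lam : ℂ} (hlam : lam.im ≠ 0)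
    {F f u : L2 Ω} (hF : SolvesMagnetic A V F (f + lam • F)) :
    IsDirichletSolution A V lam F u ↔ u = F - schrodingerResolvent Ω A V lam f := by
  have hres := resolventExists h hlam
  obtain ⟨hwH10, hwsol⟩ := schrodingerResolvent_mem_graph hres f
  set w := schrodingerResolvent Ω A V lam f
  constructor
  · rintro ⟨husol, huF⟩
    have hgraph : (F - u, f + lam • (F - u)) ∈ schrodingerGraph Ω A V := by
      refine ⟨neg_sub u F ▸ huF.neg, ?_⟩
      rw [smul_sub, ← add_sub_assoc]
      exact hF.sub h husol
    rw [← (hres f).unique hgraph ⟨hwH10, hwsol⟩, sub_sub_cancel]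
  · rintro rfl
    refine ⟨?_, ?_⟩
    · have hsub := hF.sub h hwsol
      rwa [add_sub_add_left_eq_sub, ← smul_sub] at hsub
    · rw [sub_sub_cancel_left]
      exact hwH10.neg

theorem existsUnique_isDirichletSolution (h : BoundedCoefficients Ω A V) {lam : ℂ}
    (hlam : lam.im ≠ 0) {F f : L2 Ω} (hF : SolvesMagnetic A V F (f + lam • F)) :
    ∃! u, IsDirichletSolution A V lam F u :=
  ⟨_, (isDirichletSolution_iff h hlam hF).2 rfl, fun _ => (isDirichletSolution_iff h hlam hF).1⟩

theorem dirichletSolution_eq (h : BoundedCoefficients Ω A V) {lam : ℂ} (hlam : lam.im ≠ 0)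
    {F f : L2 Ω} (hF : SolvesMagnetic A V F (f + lam • F)) :
    dirichletSolution A V lam F = F - schrodingerResolvent Ω A V lam f := by
  have hex := (existsUnique_isDirichletSolution h hlam hF).exists
  rw [dirichletSolution, dif_pos hex]
  exact (isDirichletSolution_iff h hlam hF).1 hex.choose_spec

end Resolvent

/-! ### Integrals along half lines -/

section LineIntegral

variable {E F : Type*} [NormedAddCommGroup E] [NormedSpace ℝ E] [NormedAddCommGroup F] {η : E}
  {h : E → F}

theorem isClosedEmbedding_line (hη : ‖η‖ = 1) (x : E) :
    IsClosedEmbedding fun s : ℝ => x + s • η := by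
  refine Isometry.isClosedEmbedding (Isometry.of_dist_eq fun s t => ?_)
  rw [dist_add_left, dist_eq_norm, ← sub_smul, norm_smul, hη, mul_one, dist_eq_norm]

theorem integrable_line (hη : ‖η‖ = 1) (hh : Continuous h) (hc : HasCompactSupport h) (x : E) :
    Integrable fun s : ℝ => h (x + s • η) :=
  (hh.comp (by fun_prop)).integrable_of_hasCompactSupport
    (hc.comp_isClosedEmbedding (isClosedEmbedding_line hη x))

theorem exists_norm_line_le_indicator (hη : ‖η‖ = 1) (hh : Continuous h)
    (hc : HasCompactSupport h) (x₀ : E) :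
    ∃ C M : ℝ, ∀ x ∈ Metric.ball x₀ 1, ∀ s : ℝ,
      ‖h (x + s • η)‖ ≤ (Icc (-M) M).indicator (fun _ => C) s := by
  obtain ⟨C, hC⟩ := hh.bounded_above_of_compact_support hc
  obtain ⟨R, hR⟩ := hc.isCompact.isBounded.subset_closedBall (0 : E)
  refine ⟨C, R + (‖x₀‖ + 1), fun x hx s => ?_⟩
  by_cases hs : s ∈ Icc (-(R + (‖x₀‖ + 1))) (R + (‖x₀‖ + 1))
  · rw [indicator_of_mem hs]
    exact hC _
  · suffices hmem : x + s • η ∉ tsupport h by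
      rw [indicator_of_notMem hs, image_eq_zero_of_notMem_tsupport hmem, norm_zero]
    intro hmem
    have hx₀ : ‖x‖ ≤ ‖x₀‖ + 1 := by
      linarith [norm_le_norm_add_norm_sub' x x₀, mem_ball_iff_norm.1 hx]
    refine hs (abs_le.1 ?_)
    calc |s| = ‖(x + s • η) - x‖ := by
          rw [add_sub_cancel_left, norm_smul, hη, mul_one, Real.norm_eq_abs]
      _ ≤ R + (‖x₀‖ + 1) :=
          (norm_sub_le _ _).trans (add_le_add (mem_closedBall_zero_iff.1 (hR hmem)) hx₀)

variable [NormedSpace ℝ F]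

theorem hasFDerivAt_lineIntegral (hη : ‖η‖ = 1) (hh : ContDiff ℝ 1 h) (hc : HasCompactSupport h)
    (x₀ : E) :
    HasFDerivAt (fun x => ∫ s in Iic (0 : ℝ), h (x + s • η))
      (∫ s in Iic (0 : ℝ), fderiv ℝ h (x₀ + s • η)) x₀ := by
  have hcont : Continuous (fderiv ℝ h) := hh.continuous_fderiv one_ne_zero
  obtain ⟨C, M, hCM⟩ := exists_norm_line_le_indicator hη hcont (hc.fderiv ℝ) x₀
  refine hasFDerivAt_integral_of_dominated_of_fderiv_le
    (bound := (Icc (-M) M).indicator fun _ => C)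
    (F := fun x s => h (x + s • η)) (F' := fun x s => fderiv ℝ h (x + s • η))
    (Metric.ball_mem_nhds x₀ one_pos) ?_ ?_ ?_ ?_ ?_ ?_
  · exact Eventually.of_forall fun x => (integrable_line hη hh.continuous hc x).1.restrict
  · exact (integrable_line hη hh.continuous hc x₀).restrict
  · exact (integrable_line hη hcont (hc.fderiv ℝ) x₀).1.restrict
  · exact Eventually.of_forall fun s x hx => hCM x hx s
  · exact ((integrable_indicator_iff measurableSet_Icc).2
      (integrableOn_const (by simp))).restrict
  · exact Eventually.of_forall fun s x _ =>
      ((hh.differentiable one_ne_zero _).hasFDerivAt).comp x ((hasFDerivAt_id x).add_const (s • η))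

theorem lineIntegral_fderiv_apply [CompleteSpace F] (hη : ‖η‖ = 1) (hh : ContDiff ℝ 1 h)
    (hc : HasCompactSupport h) (x : E) :
    (∫ s in Iic (0 : ℝ), fderiv ℝ h (x + s • η)) η = h x := by
  have hint : IntegrableOn (fun s : ℝ => fderiv ℝ h (x + s • η)) (Iic 0) :=
    (integrable_line hη (hh.continuous_fderiv one_ne_zero) (hc.fderiv ℝ) x).restrict
  have hderiv : ∀ s ∈ Iic (0 : ℝ), HasDerivAt (fun s : ℝ => h (x + s • η))
      (fderiv ℝ h (x + s • η) η) s := fun s _ => by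
    have hline : HasDerivAt (fun s : ℝ => x + s • η) η s := by
      simpa using ((hasDerivAt_id s).smul_const η).const_add x
    exact (hh.differentiable one_ne_zero _).hasFDerivAt.comp_hasDerivAt s hline
  have hlim : Tendsto (fun s : ℝ => h (x + s • η)) atBot (𝓝 0) :=
    (hc.comp_isClosedEmbedding (isClosedEmbedding_line hη x)).is_zero_at_infty.mono_left
      atBot_le_cocompact
  rw [ContinuousLinearMap.integral_apply hint,
    integral_Iic_of_hasDerivAt_of_tendsto' hderiv (hint.apply_continuousLinearMap η) hlim]
  simp

end LineIntegral

universe u in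
theorem contDiff_lineIntegral {E F : Type u} [NormedAddCommGroup E] [NormedSpace ℝ E]
    [NormedAddCommGroup F] [NormedSpace ℝ F] {η : E} (hη : ‖η‖ = 1) (m : ℕ) {h : E → F}
    (hh : ContDiff ℝ m h) (hc : HasCompactSupport h) :
    ContDiff ℝ m fun x => ∫ s in Iic (0 : ℝ), h (x + s • η) := by
  induction m generalizing F with
  | zero =>
    refine contDiff_zero.2 (continuous_iff_continuousAt.2 fun x₀ => ?_)
    obtain ⟨C, M, hCM⟩ := exists_norm_line_le_indicator hη hh.continuous hc x₀
    refine continuousAt_of_dominated (bound := (Icc (-M) M).indicator fun _ => C)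
      (Eventually.of_forall fun x => (integrable_line hη hh.continuous hc x).1.restrict) ?_
      ((integrable_indicator_iff measurableSet_Icc).2 (integrableOn_const (by simp))).restrict
      (Eventually.of_forall fun s => (hh.continuous.comp (by fun_prop)).continuousAt)
    filter_upwards [Metric.ball_mem_nhds x₀ one_pos] with x hx
    exact Eventually.of_forall fun s => hCM x hx s
  | succ m ih =>
    have hderiv := hasFDerivAt_lineIntegral hη (hh.of_le (by norm_cast; lia)) hc
    rw [Nat.cast_succ, contDiff_succ_iff_fderiv]
    refine ⟨fun x => (hderiv x).differentiableAt, by simp, ?_⟩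
    rw [funext fun x => (hderiv x).fderiv]
    exact ih (hh.fderiv_right (by norm_cast)) (hc.fderiv ℝ)

section Phase

variable {n : ℕ} {η : Euc n} {As : Euc n → Euc n}

theorem hasCompactSupport_inner_right (η : Euc n) (hc : HasCompactSupport As) :
    HasCompactSupport fun x => (inner ℝ η (As x) : ℝ) :=
  hc.comp_left (g := fun y => (inner ℝ η y : ℝ)) (inner_zero_right _)

theorem contDiff_phase (hη : ‖η‖ = 1) {m : ℕ} (hAs : ContDiff ℝ m As)
    (hc : HasCompactSupport As) : ContDiff ℝ m (phase η As) :=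
  Complex.ofRealCLM.contDiff.comp
    (contDiff_lineIntegral hη m (contDiff_const.inner ℝ hAs)
      (hasCompactSupport_inner_right η hc)).neg

theorem fderiv_phase (hη : ‖η‖ = 1) (hAs : ContDiff ℝ 1 As) (hc : HasCompactSupport As)
    (x : Euc n) : fderiv ℝ (phase η As) x η = -rdot η (As x) := by
  have hinner : ContDiff ℝ 1 fun x => (inner ℝ η (As x) : ℝ) := contDiff_const.inner ℝ hAs
  have hsupp := hasCompactSupport_inner_right η hc
  have hphase : HasFDerivAt (phase η As) _ x :=
    Complex.ofRealCLM.hasFDerivAt.comp x (hasFDerivAt_lineIntegral hη hinner hsupp x).neg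
  rw [hphase.fderiv, ContinuousLinearMap.comp_apply, _root_.neg_apply,
    lineIntegral_fderiv_apply hη hinner hsupp, Complex.ofRealCLM_apply, Complex.ofReal_neg]
  rfl

end Phase

/-! ### Calculus of complex gradients -/

section Gradient

variable {n : ℕ} {x : Euc n}

theorem toC_dotProduct_toC (v w : Euc n) : toC v ⬝ᵥ toC w = rdot v w := by
  simp [toC, rdot, dotProduct, PiLp.inner_apply, mul_comm]

theorem rdot_self (v : Euc n) : rdot v v = (‖v‖ : ℂ) ^ 2 := by
  simp [rdot]

theorem toC_dotProduct_grad (v : Euc n) (f : Euc n → ℂ) (x : Euc n) :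
    toC v ⬝ᵥ grad f x = fderiv ℝ f x v := by
  conv_rhs => rw [← (EuclideanSpace.basisFun (Fin n) ℝ).sum_repr v]
  simp [dotProduct, toC, grad, EuclideanSpace.basisFun_repr]

theorem laplacian_eq_sum (f : Euc n → ℂ) (x : Euc n) :
    Laplacian.laplacian f x = ∑ k : Fin n,
      fderiv ℝ (fderiv ℝ f) x (EuclideanSpace.single k 1) (EuclideanSpace.single k 1) := by
  rw [InnerProductSpace.laplacian_eq_iteratedFDeriv_orthonormalBasis f
    (EuclideanSpace.basisFun (Fin n) ℝ)]
  simp [iteratedFDeriv_two_apply]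

theorem grad_mul {f g : Euc n → ℂ} (hf : DifferentiableAt ℝ f x) (hg : DifferentiableAt ℝ g x)
    (k : Fin n) :
    grad (fun y => f y * g y) x k = grad f x k * g x + f x * grad g x k := by
  simp only [grad]
  rw [fderiv_fun_mul hf hg]
  simp [mul_comm, add_comm]

theorem grad_add {f g : Euc n → ℂ} (hf : DifferentiableAt ℝ f x) (hg : DifferentiableAt ℝ g x)
    (k : Fin n) : grad (fun y => f y + g y) x k = grad f x k + grad g x k := by
  simp only [grad]
  rw [fderiv_fun_add hf hg]
  simp

theorem grad_const_mul {f : Euc n → ℂ} (hf : DifferentiableAt ℝ f x) (c : ℂ) (k : Fin n) :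
    grad (fun y => c * f y) x k = c * grad f x k := by
  simp only [grad]
  rw [fderiv_const_mul hf]
  simp

theorem grad_const (c : ℂ) (x : Euc n) (k : Fin n) : grad (fun _ => c) x k = 0 := by
  simp [grad]

theorem grad_cexp {f : Euc n → ℂ} (hf : DifferentiableAt ℝ f x) (k : Fin n) :
    grad (fun y => Complex.exp (f y)) x k = Complex.exp (f x) * grad f x k := by
  simp only [grad]
  rw [hf.hasFDerivAt.cexp.fderiv]
  simp

theorem contDiff_rdot (η : Euc n) : ContDiff ℝ ω (rdot η) :=
  Complex.ofRealCLM.contDiff.comp (contDiff_const.inner ℝ contDiff_id)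

theorem grad_rdot (η x : Euc n) (k : Fin n) : grad (rdot η) x k = toC η k := by
  have h : HasFDerivAt (rdot η) (Complex.ofRealCLM.comp (innerSL ℝ η)) x :=
    (Complex.ofRealCLM.comp (innerSL ℝ η)).hasFDerivAt
  simp [grad, h.fderiv, toC, EuclideanSpace.inner_single_right]

/-- The `k`-th coordinate, as a complex number. -/
noncomputable def coordC (k : Fin n) : Euc n →L[ℝ] ℂ :=
  Complex.ofRealCLM.comp (innerSL ℝ (EuclideanSpace.single k 1))

theorem coordC_apply (k : Fin n) (v : Euc n) : coordC k v = toC v k := by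
  simp [coordC, toC, EuclideanSpace.inner_single_left]

theorem hasFDerivAt_toC {A : Euc n → Euc n} (hA : DifferentiableAt ℝ A x) (k : Fin n) :
    HasFDerivAt (fun y => toC (A y) k) ((coordC k).comp (fderiv ℝ A x)) x := by
  simpa only [Function.comp_def, coordC_apply] using
    (coordC k).hasFDerivAt.comp x hA.hasFDerivAt

theorem grad_toC {A : Euc n → Euc n} (hA : DifferentiableAt ℝ A x) (k j : Fin n) :
    grad (fun y => toC (A y) k) x j = ((fderiv ℝ A x (EuclideanSpace.single j 1) k : ℝ) : ℂ) := by
  rw [grad, (hasFDerivAt_toC hA k).fderiv, ContinuousLinearMap.comp_apply, coordC_apply]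
  rfl

theorem hasFDerivAt_grad {f : Euc n → ℂ} (hf : DifferentiableAt ℝ (fderiv ℝ f) x) (k : Fin n) :
    HasFDerivAt (fun y => grad f y k)
      ((fderiv ℝ (fderiv ℝ f) x).flip (EuclideanSpace.single k 1)) x := by
  simpa [grad] using
    hf.hasFDerivAt.clm_apply (hasFDerivAt_const (EuclideanSpace.single k (1 : ℝ)) x)

theorem grad_grad {f : Euc n → ℂ} (hf : DifferentiableAt ℝ (fderiv ℝ f) x) (k : Fin n) :
    grad (fun y => grad f y k) x k
      = fderiv ℝ (fderiv ℝ f) x (EuclideanSpace.single k 1) (EuclideanSpace.single k 1) := by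
  rw [grad, (hasFDerivAt_grad hf k).fderiv]
  rfl

end Gradient

/-! ### The momentum of modulated plane waves -/

section Wave

variable {n : ℕ} {ι r : ℂ} {η : Euc n} {ψ b : Euc n → ℂ} {A : Euc n → Euc n} {x : Euc n}

/-- The modulated plane wave `e^{-ι (r η·x + ψ)}`. The parameter `ι` is meant to be a square root
of `-1`: `ι = -i` gives `Φ₁`, and `ι = i` gives the exponential factor of `Φ₂`. -/
noncomputable def wave (ι r : ℂ) (η : Euc n) (ψ : Euc n → ℂ) (x : Euc n) : ℂ :=
  Complex.exp (-ι * (r * rdot η x + ψ x))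

/-- The field `(ι∇ + A) Φ`, the momentum of `Φ` when `ι = -i`, and its transpose when `ι = i`. -/
noncomputable def momentumField (ι : ℂ) (A : Euc n → Euc n) (Φ : Euc n → ℂ) (x : Euc n) :
    Fin n → ℂ :=
  ι • grad Φ x + Φ x • toC (A x)

/-- The function `(ι∇ + A)² Φ`. -/
noncomputable def momentumSq (ι : ℂ) (A : Euc n → Euc n) (Φ : Euc n → ℂ) (x : Euc n) : ℂ :=
  ∑ k, (ι * grad (fun y => momentumField ι A Φ y k) x k + toC (A x) k * momentumField ι A Φ x k)

/-- The vector `r η + ∇ψ + A` by which `ι∇ + A` acts on the modulated plane wave `wave ι r η ψ`. -/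
noncomputable def waveVector (r : ℂ) (η : Euc n) (ψ : Euc n → ℂ) (A : Euc n → Euc n) (x : Euc n) :
    Fin n → ℂ :=
  r • toC η + grad ψ x + toC (A x)

theorem differentiableAt_exponent (hψ : DifferentiableAt ℝ ψ x) :
    DifferentiableAt ℝ (fun y => r * rdot η y + ψ y) x :=
  (((contDiff_rdot η).differentiable (by simp) x).const_mul r).add hψ

theorem differentiableAt_wave (hψ : DifferentiableAt ℝ ψ x) :
    DifferentiableAt ℝ (wave ι r η ψ) x :=
  ((differentiableAt_exponent hψ).const_mul (-ι)).cexp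

theorem contDiff_wave {m : WithTop ℕ∞} (hψ : ContDiff ℝ m ψ) : ContDiff ℝ m (wave ι r η ψ) :=
  (contDiff_const.mul ((contDiff_const.mul ((contDiff_rdot η).of_le le_top)).add hψ)).cexp

theorem grad_wave (hψ : DifferentiableAt ℝ ψ x) (k : Fin n) :
    grad (wave ι r η ψ) x k = -ι * (r * toC η k + grad ψ x k) * wave ι r η ψ x := by
  have hrdot : DifferentiableAt ℝ (rdot η) x := (contDiff_rdot η).differentiable (by simp) x
  have hexp := differentiableAt_exponent (r := r) (η := η) hψ
  unfold wave
  rw [grad_cexp (hexp.const_mul (-ι)), grad_const_mul hexp, grad_add (hrdot.const_mul r) hψ,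
    grad_const_mul hrdot, grad_rdot]
  ring

theorem momentumField_mul_wave (hι : ι * ι = -1) (hψ : DifferentiableAt ℝ ψ x)
    (hb : DifferentiableAt ℝ b x) (k : Fin n) :
    momentumField ι A (fun y => b y * wave ι r η ψ y) x k
      = (ι * grad b x k + b x * waveVector r η ψ A x k) * wave ι r η ψ x := by
  simp only [momentumField, waveVector, Pi.add_apply, Pi.smul_apply, smul_eq_mul]
  rw [grad_mul hb (differentiableAt_wave hψ), grad_wave hψ]
  linear_combination (-b x * (r * toC η k + grad ψ x k) * wave ι r η ψ x) * hι

theorem differentiableAt_waveVector (hψ : DifferentiableAt ℝ (fderiv ℝ ψ) x)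
    (hA : DifferentiableAt ℝ A x) (k : Fin n) :
    DifferentiableAt ℝ (fun y => waveVector r η ψ A y k) x :=
  ((differentiableAt_const _).add (hasFDerivAt_grad hψ k).differentiableAt).add
    (hasFDerivAt_toC hA k).differentiableAt

theorem grad_waveVector (hψ : DifferentiableAt ℝ (fderiv ℝ ψ) x) (hA : DifferentiableAt ℝ A x)
    (k : Fin n) :
    grad (fun y => waveVector r η ψ A y k) x k
      = fderiv ℝ (fderiv ℝ ψ) x (EuclideanSpace.single k 1) (EuclideanSpace.single k 1)
        + ((fderiv ℝ A x (EuclideanSpace.single k 1) k : ℝ) : ℂ) := by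
  have hgrad := (hasFDerivAt_grad hψ k).differentiableAt
  simp only [waveVector, Pi.add_apply, Pi.smul_apply, smul_eq_mul]
  have hsum : DifferentiableAt ℝ (fun y => r * toC η k + grad ψ y k) x :=
    (differentiableAt_const _).add hgrad
  rw [grad_add hsum (hasFDerivAt_toC hA k).differentiableAt,
    grad_add (differentiableAt_const _) hgrad, grad_const, zero_add, grad_grad hψ, grad_toC hA]

theorem momentum_momentumField_mul_wave_component (hι : ι * ι = -1) (hψ : ContDiff ℝ 2 ψ)
    (hb : Differentiable ℝ b) (hbx : DifferentiableAt ℝ (fderiv ℝ b) x)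
    (hA : DifferentiableAt ℝ A x) (k : Fin n) :
    ι * grad (fun y => momentumField ι A (fun y => b y * wave ι r η ψ y) y k) x k
        + toC (A x) k * momentumField ι A (fun y => b y * wave ι r η ψ y) x k
      = (-fderiv ℝ (fderiv ℝ b) x (EuclideanSpace.single k 1) (EuclideanSpace.single k 1)
        + ι * (fderiv ℝ (fderiv ℝ ψ) x (EuclideanSpace.single k 1) (EuclideanSpace.single k 1)
          + ((fderiv ℝ A x (EuclideanSpace.single k 1) k : ℝ) : ℂ)) * b x
        + 2 * ι * (waveVector r η ψ A x k * grad b x k)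
        + waveVector r η ψ A x k * waveVector r η ψ A x k * b x) * wave ι r η ψ x := by
  have hψ1 : Differentiable ℝ ψ := hψ.differentiable two_ne_zero
  have hψ2 : DifferentiableAt ℝ (fderiv ℝ ψ) x :=
    (hψ.fderiv_right (m := 1) (by norm_num)).differentiable one_ne_zero x
  have hvec := differentiableAt_waveVector (r := r) (η := η) hψ2 hA k
  have hgrad := (hasFDerivAt_grad hbx k).differentiableAt
  have hA_eq : toC (A x) k = waveVector r η ψ A x k - (r * toC η k + grad ψ x k) := by
    simp [waveVector]
  have hιgrad : DifferentiableAt ℝ (fun y => ι * grad b y k) x := hgrad.const_mul ι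
  have hprod : DifferentiableAt ℝ (fun y => b y * waveVector r η ψ A y k) x := (hb x).mul hvec
  have hsum : DifferentiableAt ℝ (fun y => ι * grad b y k + b y * waveVector r η ψ A y k) x :=
    hιgrad.add hprod
  simp only [momentumField_mul_wave hι (hψ1 _) (hb _)]
  rw [grad_mul hsum (differentiableAt_wave (hψ1 x)),
    grad_add hιgrad hprod, grad_const_mul hgrad, grad_mul (hb x) hvec,
    grad_grad hbx, grad_waveVector hψ2 hA, grad_wave (hψ1 x), hA_eq]
  linear_combination (fderiv ℝ (fderiv ℝ b) x (EuclideanSpace.single k 1)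
    (EuclideanSpace.single k 1) - (ι * grad b x k + b x * waveVector r η ψ A x k)
      * (r * toC η k + grad ψ x k)) * wave ι r η ψ x * hι

theorem momentumSq_mul_wave (hι : ι * ι = -1) (hψ : ContDiff ℝ 2 ψ)
    (hb : Differentiable ℝ b) (hbx : DifferentiableAt ℝ (fderiv ℝ b) x)
    (hA : DifferentiableAt ℝ A x) :
    momentumSq ι A (fun y => b y * wave ι r η ψ y) x
      = (-Laplacian.laplacian b x + ι * (Laplacian.laplacian ψ x + divergence A x) * b x
          + 2 * ι * (waveVector r η ψ A x ⬝ᵥ grad b x)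
          + (waveVector r η ψ A x ⬝ᵥ waveVector r η ψ A x) * b x) * wave ι r η ψ x := by
  simp only [momentumSq, momentum_momentumField_mul_wave_component hι hψ hb hbx hA]
  rw [← Finset.sum_mul, laplacian_eq_sum, laplacian_eq_sum]
  simp only [Finset.sum_add_distrib, Finset.sum_neg_distrib, ← Finset.mul_sum, ← Finset.sum_mul,
    divergence, dotProduct, Complex.ofReal_sum]

end Wave

/-! ### Functions of class `C^{1,1}` -/

section LocallyC11

variable {n : ℕ} {ι : ℂ} {f g : Euc n → ℂ} {A : Euc n → Euc n}

/-- Functions of class `C^{1,1}_loc`. Both amplitudes and ansatz functions are of this class. -/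
structure IsLocallyC11 (f : Euc n → ℂ) : Prop where
  contDiff : ContDiff ℝ 1 f
  locallyLipschitz_fderiv : LocallyLipschitz (fderiv ℝ f)

theorem isLocallyC11_of_contDiff (hf : ContDiff ℝ 2 f) : IsLocallyC11 f :=
  ⟨hf.of_le one_le_two, (hf.fderiv_right (m := 1) (by norm_num)).locallyLipschitz⟩

namespace IsLocallyC11

theorem differentiable (hf : IsLocallyC11 f) : Differentiable ℝ f :=
  hf.contDiff.differentiable one_ne_zero

theorem locallyLipschitz (hf : IsLocallyC11 f) : LocallyLipschitz f :=
  hf.contDiff.locallyLipschitz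

theorem locallyLipschitz_grad (hf : IsLocallyC11 f) (k : Fin n) :
    LocallyLipschitz fun y => grad f y k :=
  (ContinuousLinearMap.apply ℝ ℂ (EuclideanSpace.single k (1 : ℝ))).lipschitz.locallyLipschitz.comp
    hf.locallyLipschitz_fderiv

theorem mul (hf : IsLocallyC11 f) (hg : IsLocallyC11 g) : IsLocallyC11 fun y => f y * g y := by
  have smul_fderiv {u v : Euc n → ℂ} (hu : IsLocallyC11 u) (hv : IsLocallyC11 v) :
      LocallyLipschitz fun y => u y • fderiv ℝ v y :=
    LocallyLipschitz.comp (g := fun y => (u y, fderiv ℝ v y))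
      (contDiff_fst.smul contDiff_snd : ContDiff ℝ 1 fun p : ℂ × (Euc n →L[ℝ] ℂ) =>
        p.1 • p.2).locallyLipschitz (hu.locallyLipschitz.prodMk hv.locallyLipschitz_fderiv)
  have leibniz : fderiv ℝ (fun y => f y * g y) = fun y => f y • fderiv ℝ g y + g y • fderiv ℝ f y :=
    funext fun y => fderiv_fun_mul (hf.differentiable y) (hg.differentiable y)
  refine ⟨hf.contDiff.mul hg.contDiff, ?_⟩
  rw [leibniz]
  exact (smul_fderiv hf hg).add (smul_fderiv hg hf)

end IsLocallyC11

theorem locallyLipschitz_toC (hA : LocallyLipschitz A) (k : Fin n) :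
    LocallyLipschitz fun y => toC (A y) k := by
  simpa only [Function.comp_def, coordC_apply] using (coordC k).lipschitz.locallyLipschitz.comp hA

theorem locallyLipschitz_momentumField (hf : IsLocallyC11 f) (hA : LocallyLipschitz A)
    (k : Fin n) : LocallyLipschitz fun y => momentumField ι A f y k :=
  (locallyLipschitz_mul (LocallyLipschitz.const ι) (hf.locallyLipschitz_grad k)).add
    (locallyLipschitz_mul hf.locallyLipschitz (locallyLipschitz_toC hA k))

end LocallyC11

/-! ### Weak solutions and Green's formula -/

section WeakSolutions

variable {n : ℕ} {Ω : Opens (Euc n)} {A : Euc n → Euc n} {V : Euc n → ℝ} {f Φ : Euc n → ℂ}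

theorem integrable_mul_of_memLp_two {μ : Measure (Euc n)} {f g : Euc n → ℂ} (hf : MemLp f 2 μ)
    (hg : MemLp g 2 μ) : Integrable (fun x => f x * g x) μ :=
  hf.integrable_mul hg

theorem boundedCoefficients (hΩ : Bornology.IsBounded (Ω : Set (Euc n))) (hA : LocallyLipschitz A)
    (hV : MemLp V (⊤ : ℝ≥0∞) (volume.restrict (Ω : Set (Euc n)))) : BoundedCoefficients Ω A V where
  field k := memLp_of_continuous hΩ (locallyLipschitz_toC hA k).continuous
  potential := hV.ofReal

theorem BoundedCoefficients.potential_sub (h : BoundedCoefficients Ω A V) (c : ℂ) :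
    MemLp (fun x => (V x : ℂ) - c) (⊤ : ℝ≥0∞) (volume.restrict (Ω : Set (Euc n))) :=
  h.potential.sub (memLp_top_const c)

theorem weakPartial_toL2 (hΩ : Bornology.IsBounded (Ω : Set (Euc n))) (hf : LocallyLipschitz f)
    (k : Fin n) :
    weakPartial k (toL2 Ω f) =ᵐ[volume.restrict (Ω : Set (Euc n))] fun x => grad f x k := by
  rw [(hasWeakPartial_toL2 hΩ hf k).weakPartial_eq]
  exact coeFn_toL2 (memLp_grad hΩ hf k)

theorem memH1_toL2 (hΩ : Bornology.IsBounded (Ω : Set (Euc n))) (hf : LocallyLipschitz f) :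
    MemH1 (toL2 Ω f) := fun k => ⟨_, hasWeakPartial_toL2 hΩ hf k⟩

theorem weakPartial_sub {u v : L2 Ω} (hu : MemH1 u) (hv : MemH1 v) (k : Fin n) :
    weakPartial k (u - v) = weakPartial k u - weakPartial k v :=
  congrArg (fun q : Jet Ω => q (some k)) (jet_sub hu hv)

theorem memLp_momentumField (hΩ : Bornology.IsBounded (Ω : Set (Euc n))) (hA : LocallyLipschitz A)
    (hΦ : IsLocallyC11 Φ) (ι : ℂ) (k : Fin n) {p : ℝ≥0∞} :
    MemLp (fun x => momentumField ι A Φ x k) p (volume.restrict (Ω : Set (Euc n))) :=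
  memLp_of_continuous hΩ (locallyLipschitz_momentumField hΦ hA k).continuous

theorem memLp_field_mul_momentumField (hΩ : Bornology.IsBounded (Ω : Set (Euc n)))
    (hA : LocallyLipschitz A) (hΦ : IsLocallyC11 Φ) (ι : ℂ) (k : Fin n) {p : ℝ≥0∞} :
    MemLp (fun x => toC (A x) k * momentumField ι A Φ x k) p (volume.restrict (Ω : Set (Euc n))) :=
  memLp_of_continuous hΩ ((locallyLipschitz_toC hA k).continuous.mul
    (locallyLipschitz_momentumField hΦ hA k).continuous)

theorem memLp_grad_momentumField (hΩ : Bornology.IsBounded (Ω : Set (Euc n)))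
    (hA : LocallyLipschitz A) (hΦ : IsLocallyC11 Φ) (ι : ℂ) (k : Fin n) {p : ℝ≥0∞} :
    MemLp (fun x => grad (fun y => momentumField ι A Φ y k) x k) p
      (volume.restrict (Ω : Set (Euc n))) :=
  memLp_grad hΩ (locallyLipschitz_momentumField hΦ hA k) k

theorem memLp_momentumSq (hΩ : Bornology.IsBounded (Ω : Set (Euc n))) (hA : LocallyLipschitz A)
    (hΦ : IsLocallyC11 Φ) (ι : ℂ) {p : ℝ≥0∞} :
    MemLp (momentumSq ι A Φ) p (volume.restrict (Ω : Set (Euc n))) :=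
  memLp_finsetSum Finset.univ fun k _ => ((memLp_grad_momentumField hΩ hA hΦ ι k).const_mul ι).add
    (memLp_field_mul_momentumField hΩ hA hΦ ι k)

theorem memLp_potential_mul (hΩ : Bornology.IsBounded (Ω : Set (Euc n)))
    {W : Euc n → ℂ} (hW : MemLp W (⊤ : ℝ≥0∞) (volume.restrict (Ω : Set (Euc n))))
    (hΦ : Continuous Φ) : MemLp (fun x => W x * Φ x) 2 (volume.restrict (Ω : Set (Euc n))) :=
  (memLp_of_continuous (p := 2) hΩ hΦ).mul' hW

theorem integral_momentum_mul_testFunction (hΩ : Bornology.IsBounded (Ω : Set (Euc n)))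
    (hA : LocallyLipschitz A) (hΦ : IsLocallyC11 Φ) (φ : 𝓓(Ω, ℂ)) (k : Fin n) :
    ∫ x in (Ω : Set (Euc n)), (-Complex.I * weakPartial k (toL2 Ω Φ) x + toC (A x) k * toL2 Ω Φ x) *
        (Complex.I * grad φ x k + toC (A x) k * φ x)
      = ∫ x in (Ω : Set (Euc n)), (-Complex.I *
          grad (fun y => momentumField (-Complex.I) A Φ y k) x k
            + toC (A x) k * momentumField (-Complex.I) A Φ x k) * φ x := by
  set Z := momentumField (-Complex.I) A Φ with hZ
  have int_Z_grad := integrable_mul_of_memLp_two (memLp_momentumField hΩ hA hΦ (-Complex.I) k)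
    (testFunction_memLp_grad φ k)
  have int_AZ := integrable_mul_of_memLp_two (memLp_field_mul_momentumField hΩ hA hΦ (-Complex.I) k)
    (testFunction_memLp φ)
  have int_grad_Z := integrable_mul_of_memLp_two (memLp_grad_momentumField hΩ hA hΦ (-Complex.I) k)
    (testFunction_memLp φ)
  calc _ = ∫ x in (Ω : Set (Euc n)),
        (Complex.I * (Z x k * grad φ x k) + toC (A x) k * Z x k * φ x) := by
        refine integral_congr_ae ?_
        filter_upwards [weakPartial_toL2 hΩ hΦ.locallyLipschitz k,
          coeFn_toL2 (memLp_of_continuous hΩ hΦ.contDiff.continuous)] with x hgrad hval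
        simp only [hgrad, hval, hZ, momentumField, Pi.add_apply, Pi.smul_apply, smul_eq_mul]
        ring
    _ = -Complex.I * (∫ x in (Ω : Set (Euc n)), grad (fun y => Z y k) x k * φ x)
        + ∫ x in (Ω : Set (Euc n)), toC (A x) k * Z x k * φ x := by
        rw [integral_add (int_Z_grad.const_mul _) int_AZ, integral_const_mul,
          setIntegral_fderiv_mul_testFunction (locallyLipschitz_momentumField hΦ hA k)]
        ring
    _ = _ := by
        rw [← integral_const_mul, ← integral_add (int_grad_Z.const_mul _) int_AZ]
        simp only [hZ, add_mul, mul_assoc]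

theorem solvesMagnetic_toL2 (hΩ : Bornology.IsBounded (Ω : Set (Euc n))) (hA : LocallyLipschitz A)
    (hV : MemLp V (⊤ : ℝ≥0∞) (volume.restrict (Ω : Set (Euc n)))) (hΦ : IsLocallyC11 Φ) :
    SolvesMagnetic A V (toL2 Ω Φ)
      (toL2 Ω fun x => momentumSq (-Complex.I) A Φ x + V x * Φ x) := by
  refine ⟨memH1_toL2 hΩ hΦ.locallyLipschitz, fun φ => ?_⟩
  have hφ := testFunction_memLp φ (p := 2)
  have memLp_VΦ := memLp_potential_mul hΩ (boundedCoefficients hΩ hA hV).potential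
    hΦ.contDiff.continuous
  have int_component (k : Fin n) : Integrable (fun x => (-Complex.I *
      grad (fun y => momentumField (-Complex.I) A Φ y k) x k
        + toC (A x) k * momentumField (-Complex.I) A Φ x k) * φ x)
      (volume.restrict (Ω : Set (Euc n))) :=
    integrable_mul_of_memLp_two (((memLp_grad_momentumField hΩ hA hΦ _ k).const_mul _).add
      (memLp_field_mul_momentumField hΩ hA hΦ _ k)) hφ
  have potential : ∫ x in (Ω : Set (Euc n)), (V x : ℂ) * toL2 Ω Φ x * φ x
      = ∫ x in (Ω : Set (Euc n)), (V x : ℂ) * Φ x * φ x := by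
    refine integral_congr_ae ?_
    filter_upwards [coeFn_toL2 (memLp_of_continuous hΩ hΦ.contDiff.continuous)] with x hx
    rw [hx]
  rw [potential, Finset.sum_congr rfl fun k _ => integral_momentum_mul_testFunction hΩ hA hΦ φ k,
    ← integral_finsetSum _ fun k _ => int_component k,
    ← integral_add (integrable_finsetSum _ fun k _ => int_component k)
      (integrable_mul_of_memLp_two memLp_VΦ hφ)]
  refine integral_congr_ae ?_
  filter_upwards [coeFn_toL2 ((memLp_momentumSq hΩ hA hΦ (-Complex.I)).add memLp_VΦ)] with x hx
  rw [← Finset.sum_mul, ← add_mul]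
  exact congrArg (· * φ x) hx.symm

end WeakSolutions

section IntegrationByParts

variable {n : ℕ} {Ω : Opens (Euc n)} {Φ f : Euc n → ℂ}

theorem integral_L2_sub_mul (u v : L2 Ω)
    (hf : MemLp f 2 (volume.restrict (Ω : Set (Euc n)))) :
    ∫ x in (Ω : Set (Euc n)), (u - v) x * f x
      = (∫ x in (Ω : Set (Euc n)), u x * f x) - ∫ x in (Ω : Set (Euc n)), v x * f x := by
  rw [← integral_sub (integrable_L2_mul _ hf) (integrable_L2_mul _ hf)]
  refine integral_congr_ae ?_
  filter_upwards [Lp.coeFn_sub u v] with x hx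
  rw [hx, Pi.sub_apply, sub_mul]

theorem integral_weakPartial_mul_of_memH10 (hΩ : Bornology.IsBounded (Ω : Set (Euc n))) {v : L2 Ω}
    (hv : MemH10 v) (hf : LocallyLipschitz f) (k : Fin n) :
    ∫ x in (Ω : Set (Euc n)), weakPartial k v x * f x
      = -∫ x in (Ω : Set (Euc n)), v x * grad f x k := by
  have memLp_f := memLp_of_continuous (p := 2) hΩ hf.continuous
  have memLp_grad_f := memLp_grad (p := 2) hΩ hf k
  refine H10_induction (p := fun q => ∫ x in (Ω : Set (Euc n)), q (some k) x * f x
    = -∫ x in (Ω : Set (Euc n)), q none x * grad f x k) ?_ (fun φ => ?_) (memH10_iff.1 hv)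
  · simp only [integral_L2_mul_eq_inner _ memLp_f, integral_L2_mul_eq_inner _ memLp_grad_f]
    exact isClosed_eq (by fun_prop) (by fun_prop)
  · have partial_mul : ∫ x in (Ω : Set (Euc n)), testJet φ (some k) x * f x
        = ∫ x in (Ω : Set (Euc n)), f x * grad φ x k := by
      refine integral_congr_ae ?_
      filter_upwards [coeFn_toL2 (testFunction_memLp_grad φ k)] with x hx
      rw [testJet_some, hx, mul_comm]
    have mul_partial : ∫ x in (Ω : Set (Euc n)), testJet φ none x * grad f x k
        = ∫ x in (Ω : Set (Euc n)), grad f x k * φ x := by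
      refine integral_congr_ae ?_
      filter_upwards [coeFn_toL2 (testFunction_memLp φ)] with x hx
      rw [testJet_none, hx, mul_comm]
    rw [partial_mul, mul_partial, setIntegral_fderiv_mul_testFunction hf]

theorem inner_single_eq_toC (v : Euc n) (k : Fin n) :
    ((inner ℝ v (EuclideanSpace.single k 1) : ℝ) : ℂ) = toC v k := by
  simp [toC, EuclideanSpace.inner_single_right]

theorem integrable_mul_outwardNormal (hΩb : Bornology.IsBounded (Ω : Set (Euc n)))
    (hΩ : HasC1Boundary (Ω : Set (Euc n))) (hf : LocallyLipschitz f) (k : Fin n) :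
    Integrable (fun x => f x * toC (outwardNormal (Ω : Set (Euc n)) x) k)
      (surfaceMeasure (Ω : Set (Euc n))) := by
  simpa only [inner_single_eq_toC] using
    (divergenceFormula Ω.isOpen hΩb hΩ (EuclideanSpace.single k 1) hf).1

theorem integral_weakPartial_toL2_mul (hΩb : Bornology.IsBounded (Ω : Set (Euc n)))
    (hΩ : HasC1Boundary (Ω : Set (Euc n))) (hΦ : LocallyLipschitz Φ) (hf : LocallyLipschitz f)
    (k : Fin n) :
    ∫ x in (Ω : Set (Euc n)), weakPartial k (toL2 Ω Φ) x * f x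
      = ∫ x, Φ x * f x * toC (outwardNormal (Ω : Set (Euc n)) x) k
          ∂(surfaceMeasure (Ω : Set (Euc n)))
        - ∫ x in (Ω : Set (Euc n)), toL2 Ω Φ x * grad f x k := by
  have divergence_mul := (divergenceFormula Ω.isOpen hΩb hΩ (EuclideanSpace.single k 1)
    (locallyLipschitz_mul hΦ hf)).2
  simp only [inner_single_eq_toC] at divergence_mul
  rw [← divergence_mul, eq_sub_iff_add_eq,
    ← integral_add (integrable_L2_mul _ (memLp_of_continuous hΩb hf.continuous))
      (integrable_L2_mul _ (memLp_grad hΩb hf k))]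
  refine integral_congr_ae ?_
  filter_upwards [ae_restrict_of_ae (ae_differentiableAt_of_locallyLipschitz volume hΦ),
    ae_restrict_of_ae (ae_differentiableAt_of_locallyLipschitz volume hf),
    coeFn_toL2 (memLp_of_continuous hΩb hΦ.continuous), weakPartial_toL2 hΩb hΦ k]
    with x diff_Φ diff_f hval hgrad
  rw [hval, hgrad]
  exact (grad_mul diff_Φ diff_f k).symm

theorem integral_weakPartial_sub_mul (hΩb : Bornology.IsBounded (Ω : Set (Euc n)))
    (hΩ : HasC1Boundary (Ω : Set (Euc n))) {v : L2 Ω} (hv : MemH10 v) (hΦ : LocallyLipschitz Φ)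
    (hf : LocallyLipschitz f) (k : Fin n) :
    ∫ x in (Ω : Set (Euc n)), weakPartial k (toL2 Ω Φ - v) x * f x
      = ∫ x, Φ x * f x * toC (outwardNormal (Ω : Set (Euc n)) x) k
          ∂(surfaceMeasure (Ω : Set (Euc n)))
        - ∫ x in (Ω : Set (Euc n)), (toL2 Ω Φ - v) x * grad f x k := by
  rw [weakPartial_sub (memH1_toL2 hΩb hΦ) hv.1,
    integral_L2_sub_mul _ _ (memLp_of_continuous hΩb hf.continuous),
    integral_L2_sub_mul _ _ (memLp_grad hΩb hf k), integral_weakPartial_toL2_mul hΩb hΩ hΦ hf,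
    integral_weakPartial_mul_of_memH10 hΩb hv hf]
  ring

end IntegrationByParts

section Green

variable {n : ℕ} {Ω : Opens (Euc n)} {A : Euc n → Euc n} {V : Euc n → ℝ} {lam : ℂ} {u : L2 Ω}

theorem covariantGrad_ae (hA : BoundedCoefficients Ω A V) (u : L2 Ω) (k : Fin n) :
    covariantGrad A u k =ᵐ[volume.restrict (Ω : Set (Euc n))]
      fun x => weakPartial k u x + Complex.I * toC (A x) k * u x :=
  coeFn_toL2 <| (Lp.memLp (weakPartial k u)).add
    ((Lp.memLp u).mul' ((hA.field k).const_mul Complex.I))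

theorem memLp_field_mul_covariantGrad (hA : BoundedCoefficients Ω A V) (u : L2 Ω) (k : Fin n) :
    MemLp (fun x => Complex.I * (toC (A x) k * covariantGrad A u k x)) 2
      (volume.restrict (Ω : Set (Euc n))) :=
  ((Lp.memLp (covariantGrad A u k)).mul' (r := 2) (hA.field k)).const_mul Complex.I

theorem integral_momentum_mul_eq_covariantGrad (hA : BoundedCoefficients Ω A V) (u : L2 Ω)
    (φ : 𝓓(Ω, ℂ)) (k : Fin n) :
    ∫ x in (Ω : Set (Euc n)), (-Complex.I * weakPartial k u x + toC (A x) k * u x) *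
        (Complex.I * grad φ x k + toC (A x) k * φ x)
      = (∫ x in (Ω : Set (Euc n)), covariantGrad A u k x * grad φ x k)
        - ∫ x in (Ω : Set (Euc n)), Complex.I * (toC (A x) k * covariantGrad A u k x) * φ x := by
  rw [← integral_sub (integrable_L2_mul _ (testFunction_memLp_grad φ k))
    (integrable_mul_of_memLp_two (memLp_field_mul_covariantGrad hA u k) (testFunction_memLp φ))]
  refine integral_congr_ae ?_
  filter_upwards [covariantGrad_ae hA u k] with x hx
  rw [hx]
  linear_combination (-weakPartial k u x * grad φ x k
    + toC (A x) k * u x * toC (A x) k * φ x) * Complex.I_mul_I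

theorem memLp_sub_sum_field_mul_covariantGrad (hA : BoundedCoefficients Ω A V) (u : L2 Ω) (c : ℂ) :
    MemLp (fun x => (V x - c) * u x - ∑ k, Complex.I * (toC (A x) k * covariantGrad A u k x)) 2
      (volume.restrict (Ω : Set (Euc n))) :=
  ((Lp.memLp u).mul' (hA.potential_sub c)).sub <| memLp_finsetSum Finset.univ fun k _ =>
    memLp_field_mul_covariantGrad hA u k

theorem hasWeakDiv_covariantGrad (hA : BoundedCoefficients Ω A V)
    (hu : SolvesMagnetic A V u (lam • u)) :
    HasWeakDiv (covariantGrad A u) (toL2 Ω fun x =>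
      (V x - lam) * u x - ∑ k, Complex.I * (toC (A x) k * covariantGrad A u k x)) := by
  intro φ
  have hφ := testFunction_memLp φ (p := 2) (Ω := Ω)
  have int_field (k : Fin n) := integrable_mul_of_memLp_two
    (memLp_field_mul_covariantGrad hA u k) hφ
  have int_V := integrable_mul_of_memLp_two ((Lp.memLp u).mul' hA.potential) hφ
  have int_sub : Integrable (fun x => V x * u x * φ x - (lam • u) x * φ x)
      (volume.restrict (Ω : Set (Euc n))) := int_V.sub (integrable_L2_mul (lam • u) hφ)
  have weak := hu.2 φ
  simp only [integral_momentum_mul_eq_covariantGrad hA, Finset.sum_sub_distrib] at weak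
  suffices (∫ x in (Ω : Set (Euc n)), (toL2 Ω fun x =>
      (V x - lam) * u x - ∑ k, Complex.I * (toC (A x) k * covariantGrad A u k x)) x * φ x)
      = (∫ x in (Ω : Set (Euc n)), (V x : ℂ) * u x * φ x)
        - (∫ x in (Ω : Set (Euc n)), (lam • u) x * φ x)
        - ∑ k, ∫ x in (Ω : Set (Euc n)),
            Complex.I * (toC (A x) k * covariantGrad A u k x) * φ x by
    rw [this]
    linear_combination weak
  rw [← integral_finsetSum _ fun k _ => int_field k,
    ← integral_sub int_V (integrable_L2_mul (lam • u) hφ),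
    ← integral_sub int_sub (integrable_finsetSum _ fun k _ => int_field k)]
  refine integral_congr_ae ?_
  filter_upwards [coeFn_toL2 (memLp_sub_sum_field_mul_covariantGrad hA u lam),
    Lp.coeFn_smul lam u] with x hdiv hsmul
  rw [hdiv, hsmul, Pi.smul_apply, smul_eq_mul, ← Finset.sum_mul]
  ring

theorem weakDiv_covariantGrad (hA : BoundedCoefficients Ω A V)
    (hu : SolvesMagnetic A V u (lam • u)) :
    weakDiv (covariantGrad A u) =ᵐ[volume.restrict (Ω : Set (Euc n))]
      fun x => (V x - lam) * u x - ∑ k, Complex.I * (toC (A x) k * covariantGrad A u k x) := by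
  rw [(hasWeakDiv_covariantGrad hA hu).weakDiv_eq]
  exact coeFn_toL2 (memLp_sub_sum_field_mul_covariantGrad hA u lam)

variable {Φ₁ Φ₂ : Euc n → ℂ}

theorem normalTracePairing_toL2_conj (hΩ : Bornology.IsBounded (Ω : Set (Euc n)))
    (X : Fin n → L2 Ω) {Φ : Euc n → ℂ} (hΦ : LocallyLipschitz Φ) :
    normalTracePairing X (toL2 Ω fun x => conj (Φ x))
      = ∫ x in (Ω : Set (Euc n)), ((∑ k, X k x * grad Φ x k) + weakDiv X x * Φ x) := by
  have memLp_grad_Φ (k : Fin n) := memLp_grad (p := 2) hΩ hΦ k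
  have memLp_Φ := memLp_of_continuous (p := 2) hΩ hΦ.continuous
  have lipschitz_conj : LocallyLipschitz fun x => conj (Φ x) :=
    Complex.conjCLE.lipschitz.locallyLipschitz.comp hΦ
  rw [integral_add (integrable_finsetSum _ fun k _ => integrable_L2_mul _ (memLp_grad_Φ k))
    (integrable_L2_mul _ memLp_Φ),
    integral_finsetSum _ fun k _ => integrable_L2_mul _ (memLp_grad_Φ k), normalTracePairing]
  congr 1
  · refine Finset.sum_congr rfl fun k _ => integral_congr_ae ?_
    filter_upwards [weakPartial_toL2 hΩ lipschitz_conj k] with x hx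
    rw [hx, grad_conj, Complex.conj_conj]
  · refine integral_congr_ae ?_
    filter_upwards [coeFn_toL2 (memLp_of_continuous hΩ lipschitz_conj.continuous)] with x hx
    rw [hx, Complex.conj_conj]

theorem normalTracePairing_covariantGrad_ae (hA : BoundedCoefficients Ω A V)
    (hu : SolvesMagnetic A V u (lam • u)) (Φ : Euc n → ℂ) :
    ∀ᵐ x ∂(volume.restrict (Ω : Set (Euc n))),
      (∑ k, covariantGrad A u k x * grad Φ x k) + weakDiv (covariantGrad A u) x * Φ x
        = (∑ k, -Complex.I * (weakPartial k u x * momentumField Complex.I A Φ x k))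
          + u x * ((∑ k, toC (A x) k * momentumField Complex.I A Φ x k) + (V x - lam) * Φ x) := by
  filter_upwards [weakDiv_covariantGrad hA hu,
    ae_all_iff.2 fun k => covariantGrad_ae hA u k] with x hdiv hgrad
  have component (k : Fin n) : covariantGrad A u k x * grad Φ x k
      - Complex.I * (toC (A x) k * covariantGrad A u k x) * Φ x
      = -Complex.I * (weakPartial k u x * momentumField Complex.I A Φ x k)
        + u x * (toC (A x) k * momentumField Complex.I A Φ x k) := by
    simp only [hgrad k, momentumField, Pi.add_apply, Pi.smul_apply, smul_eq_mul]
    linear_combination (weakPartial k u x * grad Φ x k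
      - toC (A x) k * u x * toC (A x) k * Φ x) * Complex.I_mul_I
  have total := Finset.sum_congr rfl fun k (_ : k ∈ Finset.univ) => component k
  rw [Finset.sum_sub_distrib, Finset.sum_add_distrib, ← Finset.sum_mul,
    ← Finset.mul_sum _ _ (u x)] at total
  rw [hdiv]
  linear_combination total

theorem integral_mul_dotProduct_outwardNormal (hΩb : Bornology.IsBounded (Ω : Set (Euc n)))
    (hΩ : HasC1Boundary (Ω : Set (Euc n))) {f : Euc n → ℂ} (hf : LocallyLipschitz f)
    {Z : Euc n → Fin n → ℂ} (hZ : ∀ k, LocallyLipschitz fun y => Z y k) :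
    ∫ x, f x * (Z x ⬝ᵥ toC (outwardNormal (Ω : Set (Euc n)) x))
        ∂(surfaceMeasure (Ω : Set (Euc n)))
      = ∑ k, ∫ x, f x * Z x k * toC (outwardNormal (Ω : Set (Euc n)) x) k
        ∂(surfaceMeasure (Ω : Set (Euc n))) := by
  rw [← integral_finsetSum _ fun k _ =>
    integrable_mul_outwardNormal hΩb hΩ (locallyLipschitz_mul hf (hZ k)) k]
  simp only [dotProduct, Finset.mul_sum, mul_assoc]

theorem normalTracePairing_covariantGrad (hΩb : Bornology.IsBounded (Ω : Set (Euc n)))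
    (hΩ : HasC1Boundary (Ω : Set (Euc n))) (hA : LocallyLipschitz A)
    (hV : MemLp V (⊤ : ℝ≥0∞) (volume.restrict (Ω : Set (Euc n)))) {v : L2 Ω} (hv : MemH10 v)
    (hΦ₁ : LocallyLipschitz Φ₁) (hΦ₂ : IsLocallyC11 Φ₂)
    (hu : SolvesMagnetic A V (toL2 Ω Φ₁ - v) (lam • (toL2 Ω Φ₁ - v))) :
    normalTracePairing (covariantGrad A (toL2 Ω Φ₁ - v)) (toL2 Ω fun x => conj (Φ₂ x))
      = (∫ x in (Ω : Set (Euc n)), (toL2 Ω Φ₁ - v) x *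
          (momentumSq Complex.I A Φ₂ x + (V x - lam) * Φ₂ x))
        - Complex.I * ∫ x, Φ₁ x * (momentumField Complex.I A Φ₂ x
            ⬝ᵥ toC (outwardNormal (Ω : Set (Euc n)) x)) ∂(surfaceMeasure (Ω : Set (Euc n))) := by
  have hb := boundedCoefficients hΩb hA hV
  set u := toL2 Ω Φ₁ - v
  set Z := momentumField Complex.I A Φ₂
  have lipschitz_Z (k : Fin n) : LocallyLipschitz fun y => Z y k :=
    locallyLipschitz_momentumField hΦ₂ hA k
  have int_partial_Z (k : Fin n) : Integrable (fun x => -Complex.I * (weakPartial k u x * Z x k))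
      (volume.restrict (Ω : Set (Euc n))) :=
    (integrable_L2_mul _ (memLp_momentumField hΩb hA hΦ₂ _ k)).const_mul _
  have int_grad_Z (k : Fin n) : Integrable (fun x => Complex.I *
      (u x * grad (fun y => Z y k) x k)) (volume.restrict (Ω : Set (Euc n))) :=
    (integrable_L2_mul _ (memLp_grad_momentumField hΩb hA hΦ₂ _ k)).const_mul _
  have int_zeroth : Integrable (fun x => u x * ((∑ k, toC (A x) k * Z x k) + (V x - lam) * Φ₂ x))
      (volume.restrict (Ω : Set (Euc n))) :=
    integrable_L2_mul _ ((memLp_finsetSum Finset.univ fun k _ =>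
      memLp_field_mul_momentumField hΩb hA hΦ₂ _ k).add
        (memLp_potential_mul hΩb (hb.potential_sub lam) hΦ₂.contDiff.continuous))
  have volume_eq (x : Euc n) : u x * (momentumSq Complex.I A Φ₂ x + (V x - lam) * Φ₂ x)
      = (∑ k, Complex.I * (u x * grad (fun y => Z y k) x k))
        + u x * ((∑ k, toC (A x) k * Z x k) + (V x - lam) * Φ₂ x) := by
    simp only [momentumSq, Finset.sum_add_distrib, ← Finset.mul_sum]
    ring
  have by_parts (k : Fin n) : ∫ x in (Ω : Set (Euc n)), weakPartial k u x * Z x k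
      = ∫ x, Φ₁ x * Z x k * toC (outwardNormal (Ω : Set (Euc n)) x) k
          ∂(surfaceMeasure (Ω : Set (Euc n)))
        - ∫ x in (Ω : Set (Euc n)), u x * grad (fun y => Z y k) x k :=
    integral_weakPartial_sub_mul hΩb hΩ hv hΦ₁ (lipschitz_Z k) k
  simp only [volume_eq]
  rw [normalTracePairing_toL2_conj hΩb _ hΦ₂.locallyLipschitz,
    integral_congr_ae (normalTracePairing_covariantGrad_ae hb hu Φ₂),
    integral_mul_dotProduct_outwardNormal hΩb hΩ hΦ₁ lipschitz_Z,
    integral_add (integrable_finsetSum _ fun k _ => int_partial_Z k) int_zeroth,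
    integral_add (integrable_finsetSum _ fun k _ => int_grad_Z k) int_zeroth,
    integral_finsetSum _ fun k _ => int_partial_Z k, integral_finsetSum _ fun k _ => int_grad_Z k]
  simp only [integral_const_mul, by_parts]
  rw [← Finset.mul_sum, ← Finset.mul_sum, Finset.sum_sub_distrib]
  ring

end Green

/-! ### The ansatz functions -/

section Ansatz

variable {n : ℕ} {r : ℂ} {η : Euc n} {ψ b : Euc n → ℂ} {A As : Euc n → Euc n} {V : Euc n → ℝ}
  {x : Euc n}

/-- `ψ` is a phase for the field `As` in the direction `η`: it solves the transport equation
`η·∇ψ = -η·As`, which cancels the terms of order `r` that `As` contributes to `(-i∇ + A)² Φ₁`. -/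
structure IsTransportPhase (η : Euc n) (As : Euc n → Euc n) (ψ : Euc n → ℂ) : Prop where
  contDiff : ContDiff ℝ 2 ψ
  transport : ∀ x, toC η ⬝ᵥ grad ψ x = -rdot η (As x)

/-- `b` is an amplitude in the direction `η`: a `C^{1,1}` function constant along `η`. -/
structure IsAmplitude (η : Euc n) (b : Euc n → ℂ) : Prop where
  isLocallyC11 : IsLocallyC11 b
  transport : ∀ x, toC η ⬝ᵥ grad b x = 0

theorem isTransportPhase_phase (hη : ‖η‖ = 1) (hAs : ContDiff ℝ 2 As)
    (hc : HasCompactSupport As) : IsTransportPhase η As (phase η As) where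
  contDiff := contDiff_phase hη hAs hc
  transport x := by
    rw [toC_dotProduct_grad, fderiv_phase hη (hAs.of_le one_le_two) hc]

theorem IsTransportPhase.continuous_rdot (hψ : IsTransportPhase η As ψ) :
    Continuous fun x => rdot η (As x) := by
  have hderiv : Continuous fun x => -fderiv ℝ ψ x η :=
    ((hψ.contDiff.continuous_fderiv two_ne_zero).clm_apply continuous_const).neg
  refine hderiv.congr fun x => ?_
  rw [← toC_dotProduct_grad, hψ.transport, neg_neg]

theorem IsW2Infty.isAmplitude (hb : IsW2Infty b) (hηb : ∀ x, toC η ⬝ᵥ grad b x = 0) :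
    IsAmplitude η b :=
  ⟨⟨hb.contDiff, hb.lipschitz_fderiv.choose_spec.locallyLipschitz⟩, hηb⟩

/-- The function `2r η·(A - As) + q₁` such that `(-i∇ + A)² Φ₁ + V Φ₁ - r² Φ₁` is its product
with `Φ₁`. -/
noncomputable def remainder₁ (r : ℂ) (η : Euc n) (A : Euc n → Euc n) (V : Euc n → ℝ)
    (As : Euc n → Euc n) (ψ : Euc n → ℂ) (x : Euc n) : ℂ :=
  2 * r * rdot η (A x - As x) + q₁ A V ψ x

/-- The function `2r η·(A - As) b + V b - q₂` such that `(i∇ + A)² Φ₂ + V Φ₂ - r² Φ₂` is its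
product with `e^{-i r η·x} e^{-iψ}`. -/
noncomputable def remainder₂ (r : ℂ) (η : Euc n) (A : Euc n → Euc n) (V : Euc n → ℝ)
    (As : Euc n → Euc n) (b ψ : Euc n → ℂ) (x : Euc n) : ℂ :=
  2 * r * rdot η (A x - As x) * b x + (V x : ℂ) * b x - q₂ A b ψ x

theorem ansatz₁_eq (r : ℂ) (η : Euc n) (ψ : Euc n → ℂ) :
    ansatz₁ r η ψ = wave (-Complex.I) r η ψ := by
  funext y
  rw [ansatz₁, wave, ← Complex.exp_add]
  congr 1
  ring

theorem expFactor₂_eq (r : ℂ) (η : Euc n) (ψ : Euc n → ℂ) :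
    expFactor₂ r η ψ = wave Complex.I r η ψ := by
  funext y
  rw [expFactor₂, wave, ← Complex.exp_add]
  congr 1
  ring

theorem ansatz₂_eq (r : ℂ) (η : Euc n) (b ψ : Euc n → ℂ) :
    ansatz₂ r η b ψ = fun y => b y * wave Complex.I r η ψ y := by
  funext y
  rw [← expFactor₂_eq, ansatz₂, expFactor₂]
  ring

theorem ansatz₁_mul_expFactor₂ (r : ℂ) (η₁ η₂ : Euc n) (ψ₁ ψ₂ : Euc n → ℂ) (x : Euc n) :
    ansatz₁ r η₁ ψ₁ x * expFactor₂ r η₂ ψ₂ x = expFactor₁₂ r η₁ η₂ ψ₁ ψ₂ x := by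
  rw [ansatz₁, expFactor₂, expFactor₁₂, ← Complex.exp_add, ← Complex.exp_add, ← Complex.exp_add,
    ← Complex.exp_add]
  congr 1
  simp only [rdot, inner_sub_left, Complex.ofReal_sub]
  ring

theorem isLocallyC11_ansatz₁ (hψ : IsTransportPhase η As ψ) : IsLocallyC11 (ansatz₁ r η ψ) := by
  rw [ansatz₁_eq]
  exact isLocallyC11_of_contDiff (contDiff_wave hψ.contDiff)

theorem isLocallyC11_ansatz₂ (hψ : IsTransportPhase η As ψ) (hb : IsAmplitude η b) :
    IsLocallyC11 (ansatz₂ r η b ψ) := by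
  rw [ansatz₂_eq]
  exact hb.isLocallyC11.mul (isLocallyC11_of_contDiff (contDiff_wave hψ.contDiff))

theorem rdot_sub (η v w : Euc n) : rdot η (v - w) = rdot η v - rdot η w := by
  simp [rdot, inner_sub_right]

theorem waveVector_dotProduct_self (hη : ‖η‖ = 1) (hψ : IsTransportPhase η As ψ) :
    waveVector r η ψ A x ⬝ᵥ waveVector r η ψ A x
      = r ^ 2 + 2 * r * rdot η (A x - As x) + grad ψ x ⬝ᵥ grad ψ x
        + 2 * (toC (A x) ⬝ᵥ grad ψ x) + (‖A x‖ : ℂ) ^ 2 := by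
  have hηη : toC η ⬝ᵥ toC η = 1 := by
    rw [toC_dotProduct_toC, rdot_self, hη, Complex.ofReal_one, one_pow]
  have hAA : toC (A x) ⬝ᵥ toC (A x) = (‖A x‖ : ℂ) ^ 2 := by rw [toC_dotProduct_toC, rdot_self]
  simp only [waveVector, add_dotProduct, dotProduct_add, smul_dotProduct, dotProduct_smul,
    smul_eq_mul, rdot_sub, hηη, hAA, hψ.transport, dotProduct_comm (grad ψ x) (toC η),
    dotProduct_comm (grad ψ x) (toC (A x)), dotProduct_comm (toC (A x)) (toC η),
    toC_dotProduct_toC]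
  ring

theorem momentumSq_ansatz₁ (hη : ‖η‖ = 1) (hψ : IsTransportPhase η As ψ)
    (hA : DifferentiableAt ℝ A x) :
    momentumSq (-Complex.I) A (ansatz₁ r η ψ) x + V x * ansatz₁ r η ψ x
      = remainder₁ r η A V As ψ x * ansatz₁ r η ψ x + r ^ 2 * ansatz₁ r η ψ x := by
  have hI : -Complex.I * -Complex.I = -1 := by rw [neg_mul_neg, Complex.I_mul_I]
  have fderiv_one : fderiv ℝ (fun _ : Euc n => (1 : ℂ)) = fun _ => 0 :=
    funext fun _ => fderiv_const_apply 1
  have grad_one : grad (fun _ : Euc n => (1 : ℂ)) x = 0 := funext fun k => grad_const 1 x k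
  have laplacian_one : Laplacian.laplacian (fun _ : Euc n => (1 : ℂ)) x = 0 := by
    simp [laplacian_eq_sum]
  have ansatz₁_eq_mul : ansatz₁ r η ψ = fun y => 1 * wave (-Complex.I) r η ψ y := by
    simp only [ansatz₁_eq, one_mul]
  rw [ansatz₁_eq_mul, momentumSq_mul_wave hI hψ.contDiff (differentiable_const 1)
    (fderiv_one ▸ differentiableAt_const _) hA, laplacian_one, grad_one, dotProduct_zero,
    waveVector_dotProduct_self hη hψ, remainder₁, q₁]
  ring

theorem momentumSq_ansatz₂ (hη : ‖η‖ = 1) (hψ : IsTransportPhase η As ψ) (hb : IsAmplitude η b)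
    (hA : DifferentiableAt ℝ A x) (hbx : DifferentiableAt ℝ (fderiv ℝ b) x) :
    momentumSq Complex.I A (ansatz₂ r η b ψ) x + (V x - r ^ 2) * ansatz₂ r η b ψ x
      = remainder₂ r η A V As b ψ x * expFactor₂ r η ψ x := by
  have waveVector_grad : waveVector r η ψ A x ⬝ᵥ grad b x
      = grad ψ x ⬝ᵥ grad b x + grad b x ⬝ᵥ toC (A x) := by
    rw [waveVector, add_dotProduct, add_dotProduct, smul_dotProduct, hb.transport, smul_zero,
      zero_add, dotProduct_comm (toC (A x))]
  rw [expFactor₂_eq, ansatz₂_eq, momentumSq_mul_wave Complex.I_mul_I hψ.contDiff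
    hb.isLocallyC11.differentiable hbx hA, waveVector_grad, waveVector_dotProduct_self hη hψ,
    remainder₂, q₂, dotProduct_comm (grad ψ x) (toC (A x))]
  ring

theorem momentumField_ansatz₂ (hψ : DifferentiableAt ℝ ψ x) (hb : DifferentiableAt ℝ b x) :
    momentumField Complex.I A (ansatz₂ r η b ψ) x
      = expFactor₂ r η ψ x • ((b x * r) • toC η + b x • grad ψ x + Complex.I • grad b x
          + b x • toC (A x)) := by
  ext k
  rw [ansatz₂_eq, momentumField_mul_wave Complex.I_mul_I hψ hb, expFactor₂_eq]
  simp only [waveVector, Pi.add_apply, Pi.smul_apply, smul_eq_mul]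
  ring

end Ansatz

/-! ### The three terms of the representation -/

section Terms

variable {n : ℕ}

/-- The integral over `Ω` in the representation of `S` that does not involve the resolvent. -/
noncomputable def volumeTerm (Ω : Opens (Euc n)) (A : Euc n → Euc n) (V : Euc n → ℝ) (r : ℂ)
    (η₁ η₂ : Euc n) (As₂ : Euc n → Euc n) (b ψ₁ ψ₂ : Euc n → ℂ) : ℂ :=
  ∫ x in (Ω : Set (Euc n)), remainder₂ r η₂ A V As₂ b ψ₂ x * expFactor₁₂ r η₁ η₂ ψ₁ ψ₂ x

/-- The boundary term of the representation of `S`, with its factor `i`. -/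
noncomputable def boundaryTerm (Ω : Opens (Euc n)) (A : Euc n → Euc n) (r : ℂ) (η₁ η₂ : Euc n)
    (b ψ₁ ψ₂ : Euc n → ℂ) : ℂ :=
  Complex.I * (∫ x, expFactor₁₂ r η₁ η₂ ψ₁ ψ₂ x *
    (((b x * r) • toC η₂ + b x • grad ψ₂ x + Complex.I • grad b x + b x • toC (A x))
      ⬝ᵥ toC (outwardNormal (Ω : Set (Euc n)) x)) ∂(surfaceMeasure (Ω : Set (Euc n))))

/-- The term of the representation of `S` coming from the correction `(H - lam)⁻¹ (…)` to the
ansatz function `Φ₁`. -/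
noncomputable def resolventTerm (Ω : Opens (Euc n)) (A : Euc n → Euc n) (V : Euc n → ℝ)
    (lam r : ℂ) (η₁ η₂ : Euc n) (As₁ As₂ : Euc n → Euc n) (b ψ₁ ψ₂ : Euc n → ℂ) : ℂ :=
  ∫ x in (Ω : Set (Euc n)),
    schrodingerResolvent Ω A V lam
      (toL2 Ω fun y => remainder₁ r η₁ A V As₁ ψ₁ y * ansatz₁ r η₁ ψ₁ y) x
    * remainder₂ r η₂ A V As₂ b ψ₂ x * expFactor₂ r η₂ ψ₂ x

end Terms

/-! ### The Dirichlet-to-Neumann pairing for Lipschitz magnetic potentials -/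

section Representation

variable {n : ℕ} {Ω : Opens (Euc n)} {A : Euc n → Euc n} {V : Euc n → ℝ} {r : ℂ} {η η₁ η₂ : Euc n}
  {As As₁ As₂ : Euc n → Euc n} {ψ ψ₁ ψ₂ b : Euc n → ℂ}

theorem momentumSq_ansatz₁_ae (hA : LocallyLipschitz A) (hη : ‖η‖ = 1)
    (hψ : IsTransportPhase η As ψ) :
    ∀ᵐ x ∂volume.restrict (Ω : Set (Euc n)),
      momentumSq (-Complex.I) A (ansatz₁ r η ψ) x + V x * ansatz₁ r η ψ x
        = remainder₁ r η A V As ψ x * ansatz₁ r η ψ x + r ^ 2 * ansatz₁ r η ψ x := by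
  filter_upwards [ae_restrict_of_ae (ae_differentiableAt_of_locallyLipschitz volume hA)]
    with x diff_A
  exact momentumSq_ansatz₁ hη hψ diff_A

theorem momentumSq_ansatz₂_ae (hA : LocallyLipschitz A) (hη : ‖η‖ = 1)
    (hψ : IsTransportPhase η As ψ) (hb : IsAmplitude η b) :
    ∀ᵐ x ∂volume.restrict (Ω : Set (Euc n)),
      momentumSq Complex.I A (ansatz₂ r η b ψ) x + (V x - r ^ 2) * ansatz₂ r η b ψ x
        = remainder₂ r η A V As b ψ x * expFactor₂ r η ψ x := by
  filter_upwards [ae_restrict_of_ae (ae_differentiableAt_of_locallyLipschitz volume hA),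
    ae_restrict_of_ae (ae_differentiableAt_of_locallyLipschitz volume
      hb.isLocallyC11.locallyLipschitz_fderiv)] with x diff_A diff_fderiv_b
  exact momentumSq_ansatz₂ hη hψ hb diff_A diff_fderiv_b

theorem memLp_remainder₁_mul_ansatz₁ (hΩb : Bornology.IsBounded (Ω : Set (Euc n)))
    (hA : LocallyLipschitz A)
    (hV : MemLp V (⊤ : ℝ≥0∞) (volume.restrict (Ω : Set (Euc n)))) (hη : ‖η‖ = 1)
    (hψ : IsTransportPhase η As ψ) :
    MemLp (fun x => remainder₁ r η A V As ψ x * ansatz₁ r η ψ x) 2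
      (volume.restrict (Ω : Set (Euc n))) := by
  have hΦ := isLocallyC11_ansatz₁ (r := r) hψ
  refine (memLp_congr_ae ?_).1 ((memLp_momentumSq hΩb hA hΦ (-Complex.I)).add
    (memLp_potential_mul hΩb ((boundedCoefficients hΩb hA hV).potential_sub (r ^ 2))
      hΦ.contDiff.continuous))
  filter_upwards [momentumSq_ansatz₁_ae (V := V) hA hη hψ] with x hx
  rw [Pi.add_apply]
  linear_combination hx

theorem memLp_remainder₂_mul_expFactor₂ (hΩb : Bornology.IsBounded (Ω : Set (Euc n)))
    (hA : LocallyLipschitz A)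
    (hV : MemLp V (⊤ : ℝ≥0∞) (volume.restrict (Ω : Set (Euc n)))) (hη : ‖η‖ = 1)
    (hψ : IsTransportPhase η As ψ) (hb : IsAmplitude η b) :
    MemLp (fun x => remainder₂ r η A V As b ψ x * expFactor₂ r η ψ x) 2
      (volume.restrict (Ω : Set (Euc n))) := by
  have hΦ := isLocallyC11_ansatz₂ (r := r) hψ hb
  exact (memLp_congr_ae (momentumSq_ansatz₂_ae hA hη hψ hb)).1
    ((memLp_momentumSq hΩb hA hΦ Complex.I).add (memLp_potential_mul hΩb
      ((boundedCoefficients hΩb hA hV).potential_sub (r ^ 2)) hΦ.contDiff.continuous))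

theorem solvesMagnetic_ansatz₁ (hΩb : Bornology.IsBounded (Ω : Set (Euc n)))
    (hA : LocallyLipschitz A)
    (hV : MemLp V (⊤ : ℝ≥0∞) (volume.restrict (Ω : Set (Euc n)))) (hη : ‖η‖ = 1)
    (hψ : IsTransportPhase η As ψ) :
    SolvesMagnetic A V (toL2 Ω (ansatz₁ r η ψ))
      (toL2 Ω (fun x => remainder₁ r η A V As ψ x * ansatz₁ r η ψ x)
        + r ^ 2 • toL2 Ω (ansatz₁ r η ψ)) := by
  have hΦ := isLocallyC11_ansatz₁ (r := r) hψ
  have memLp_Φ := memLp_of_continuous (p := 2) hΩb hΦ.contDiff.continuous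
  have source_eq : toL2 Ω ((fun x => remainder₁ r η A V As ψ x * ansatz₁ r η ψ x)
      + fun x => r ^ 2 • ansatz₁ r η ψ x)
      = toL2 Ω fun x => momentumSq (-Complex.I) A (ansatz₁ r η ψ) x + V x * ansatz₁ r η ψ x :=
    toL2_congr_ae ((momentumSq_ansatz₁_ae hA hη hψ).mono fun _ hx => hx.symm)
  rw [← toL2_const_smul memLp_Φ,
    ← toL2_add (memLp_remainder₁_mul_ansatz₁ hΩb hA hV hη hψ) (memLp_Φ.const_smul (r ^ 2))]
  exact source_eq ▸ solvesMagnetic_toL2 hΩb hA hV hΦ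

theorem ansatz₁_mul_remainder₂_mul_expFactor₂ (x : Euc n) :
    ansatz₁ r η₁ ψ₁ x * (remainder₂ r η₂ A V As₂ b ψ₂ x * expFactor₂ r η₂ ψ₂ x)
      = remainder₂ r η₂ A V As₂ b ψ₂ x * expFactor₁₂ r η₁ η₂ ψ₁ ψ₂ x := by
  rw [← ansatz₁_mul_expFactor₂, mul_left_comm]

theorem integrableOn_remainder₂_mul_expFactor₁₂ (hΩb : Bornology.IsBounded (Ω : Set (Euc n)))
    (hA : LocallyLipschitz A)
    (hV : MemLp V (⊤ : ℝ≥0∞) (volume.restrict (Ω : Set (Euc n)))) (hη₂ : ‖η₂‖ = 1)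
    (hψ₁ : IsTransportPhase η₁ As₁ ψ₁) (hψ₂ : IsTransportPhase η₂ As₂ ψ₂)
    (hb : IsAmplitude η₂ b) :
    IntegrableOn (fun x => remainder₂ r η₂ A V As₂ b ψ₂ x * expFactor₁₂ r η₁ η₂ ψ₁ ψ₂ x)
      (Ω : Set (Euc n)) := by
  simp only [← ansatz₁_mul_remainder₂_mul_expFactor₂]
  exact integrable_mul_of_memLp_two
    (memLp_of_continuous hΩb (isLocallyC11_ansatz₁ hψ₁).contDiff.continuous)
    (memLp_remainder₂_mul_expFactor₂ hΩb hA hV hη₂ hψ₂ hb)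

theorem integral_solution_mul_eq (hΩb : Bornology.IsBounded (Ω : Set (Euc n)))
    (hA : LocallyLipschitz A)
    (hV : MemLp V (⊤ : ℝ≥0∞) (volume.restrict (Ω : Set (Euc n)))) {lam : ℂ} (hη₂ : ‖η₂‖ = 1)
    (hψ₁ : IsTransportPhase η₁ As₁ ψ₁) (hψ₂ : IsTransportPhase η₂ As₂ ψ₂)
    (hb : IsAmplitude η₂ b) :
    ∫ x in (Ω : Set (Euc n)), (toL2 Ω (ansatz₁ r η₁ ψ₁) - schrodingerResolvent Ω A V lam
        (toL2 Ω fun y => remainder₁ r η₁ A V As₁ ψ₁ y * ansatz₁ r η₁ ψ₁ y)) x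
        * (remainder₂ r η₂ A V As₂ b ψ₂ x * expFactor₂ r η₂ ψ₂ x)
      = volumeTerm Ω A V r η₁ η₂ As₂ b ψ₁ ψ₂
        - resolventTerm Ω A V lam r η₁ η₂ As₁ As₂ b ψ₁ ψ₂ := by
  rw [integral_L2_sub_mul _ _ (memLp_remainder₂_mul_expFactor₂ hΩb hA hV hη₂ hψ₂ hb), volumeTerm,
    resolventTerm]
  congr 1
  · refine integral_congr_ae ?_
    filter_upwards [coeFn_toL2 (memLp_of_continuous hΩb
      (isLocallyC11_ansatz₁ (r := r) hψ₁).contDiff.continuous)] with x hx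
    rw [hx, ansatz₁_mul_remainder₂_mul_expFactor₂]
  · simp only [mul_assoc]

theorem I_mul_integral_momentumField_ansatz₂ (hψ₂ : IsTransportPhase η₂ As₂ ψ₂)
    (hb : IsAmplitude η₂ b) :
    Complex.I * ∫ x, ansatz₁ r η₁ ψ₁ x * (momentumField Complex.I A (ansatz₂ r η₂ b ψ₂) x
        ⬝ᵥ toC (outwardNormal (Ω : Set (Euc n)) x)) ∂(surfaceMeasure (Ω : Set (Euc n)))
      = boundaryTerm Ω A r η₁ η₂ b ψ₁ ψ₂ := by
  simp only [boundaryTerm, ← ansatz₁_mul_expFactor₂, mul_assoc, smul_dotProduct, smul_eq_mul,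
    momentumField_ansatz₂ (hψ₂.contDiff.differentiable two_ne_zero _)
      (hb.isLocallyC11.differentiable _)]

theorem pairingS_eq_of_locallyLipschitz (hΩb : Bornology.IsBounded (Ω : Set (Euc n)))
    (hΩ : HasC1Boundary (Ω : Set (Euc n))) (hA : LocallyLipschitz A)
    (hV : MemLp V (⊤ : ℝ≥0∞) (volume.restrict (Ω : Set (Euc n)))) (hr : (r ^ 2).im ≠ 0)
    (hη₁ : ‖η₁‖ = 1) (hη₂ : ‖η₂‖ = 1) (hψ₁ : IsTransportPhase η₁ As₁ ψ₁)
    (hψ₂ : IsTransportPhase η₂ As₂ ψ₂) (hb : IsAmplitude η₂ b) :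
    pairingS Ω A V (r ^ 2) r η₁ η₂ b ψ₁ ψ₂
      = volumeTerm Ω A V r η₁ η₂ As₂ b ψ₁ ψ₂ - boundaryTerm Ω A r η₁ η₂ b ψ₁ ψ₂
        - resolventTerm Ω A V (r ^ 2) r η₁ η₂ As₁ As₂ b ψ₁ ψ₂ := by
  have hcoeff := boundedCoefficients hΩb hA hV
  have solves_Φ₁ := solvesMagnetic_ansatz₁ (r := r) hΩb hA hV hη₁ hψ₁
  have correction_mem := (schrodingerResolvent_mem_graph (resolventExists hcoeff hr)
    (toL2 Ω fun y => remainder₁ r η₁ A V As₁ ψ₁ y * ansatz₁ r η₁ ψ₁ y)).1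
  have solution := ((isDirichletSolution_iff hcoeff hr solves_Φ₁).2 rfl).1
  rw [pairingS, dnPairing, dirichletSolution_eq hcoeff hr solves_Φ₁,
    normalTracePairing_covariantGrad hΩb hΩ hA hV correction_mem
      (isLocallyC11_ansatz₁ hψ₁).locallyLipschitz (isLocallyC11_ansatz₂ hψ₂ hb) solution,
    I_mul_integral_momentumField_ansatz₂ hψ₂ hb, sub_right_comm,
    ← integral_solution_mul_eq hΩb hA hV hη₂ hψ₁ hψ₂ hb]
  congr 1
  refine integral_congr_ae ?_
  filter_upwards [momentumSq_ansatz₂_ae (V := V) hA hη₂ hψ₂ hb] with x hx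
  rw [hx]

end Representation

/-! ### Dependence on the values of the magnetic potential in the closed domain -/

section Congruence

variable {n : ℕ} {Ω : Opens (Euc n)} {A A' : Euc n → Euc n}

theorem solvesMagnetic_congr (h : EqOn A A' Ω) (V : Euc n → ℝ) :
    (SolvesMagnetic A V : L2 Ω → L2 Ω → Prop) = SolvesMagnetic A' V := by
  funext u f
  refine propext (and_congr_right fun _ => forall_congr' fun φ => ?_)
  have component_eq (k : Fin n) : ∫ x in (Ω : Set (Euc n)),
      (-Complex.I * weakPartial k u x + toC (A x) k * u x) *
        (Complex.I * grad φ x k + toC (A x) k * φ x)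
      = ∫ x in (Ω : Set (Euc n)), (-Complex.I * weakPartial k u x + toC (A' x) k * u x) *
        (Complex.I * grad φ x k + toC (A' x) k * φ x) :=
    setIntegral_congr_fun Ω.isOpen.measurableSet fun x hx => by simp only [h hx]
  simp only [component_eq]

theorem toL2_congr {f g : Euc n → ℂ} (h : EqOn f g Ω) : toL2 Ω f = toL2 Ω g :=
  toL2_congr_ae (ae_restrict_of_forall_mem Ω.isOpen.measurableSet h)

theorem covariantGrad_congr (h : EqOn A A' Ω) :
    (covariantGrad A : L2 Ω → Fin n → L2 Ω) = covariantGrad A' := by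
  funext u k
  exact toL2_congr fun x hx => by simp only [h hx]

theorem schrodingerGraph_congr (h : EqOn A A' Ω) (V : Euc n → ℝ) :
    schrodingerGraph Ω A V = schrodingerGraph Ω A' V := by
  rw [schrodingerGraph, schrodingerGraph, solvesMagnetic_congr h]

theorem schrodingerResolvent_congr (h : EqOn A A' Ω) (V : Euc n → ℝ) (lam : ℂ) :
    schrodingerResolvent Ω A V lam = schrodingerResolvent Ω A' V lam := by
  unfold schrodingerResolvent
  rw [schrodingerGraph_congr h]

theorem resolventExists_congr (h : EqOn A A' Ω) (V : Euc n → ℝ) (lam : ℂ) :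
    ResolventExists Ω A V lam ↔ ResolventExists Ω A' V lam := by
  rw [ResolventExists, ResolventExists, schrodingerGraph_congr h]

theorem isDirichletSolution_congr (h : EqOn A A' Ω) (V : Euc n → ℝ) (lam : ℂ) :
    (IsDirichletSolution A V lam : L2 Ω → L2 Ω → Prop) = IsDirichletSolution A' V lam := by
  unfold IsDirichletSolution
  rw [solvesMagnetic_congr h]

theorem pairingS_congr (h : EqOn A A' Ω) (V : Euc n → ℝ) (lam r : ℂ) (η₁ η₂ : Euc n)
    (b ψ₁ ψ₂ : Euc n → ℂ) :
    pairingS Ω A V lam r η₁ η₂ b ψ₁ ψ₂ = pairingS Ω A' V lam r η₁ η₂ b ψ₁ ψ₂ := by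
  unfold pairingS dnPairing dirichletSolution
  rw [isDirichletSolution_congr h, covariantGrad_congr h]

theorem divergence_congr (h : EqOn A A' Ω) : EqOn (divergence A) (divergence A') Ω := by
  intro x hx
  have hnhds : A =ᶠ[𝓝 x] A' := h.eventuallyEq_of_mem (Ω.isOpen.mem_nhds hx)
  simp only [divergence, hnhds.fderiv_eq]

theorem remainder₁_congr (h : EqOn A A' Ω) (r : ℂ) (η : Euc n) (V : Euc n → ℝ)
    (As : Euc n → Euc n) (ψ : Euc n → ℂ) :
    EqOn (remainder₁ r η A V As ψ) (remainder₁ r η A' V As ψ) Ω := fun x hx => by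
  simp only [remainder₁, q₁, divergence_congr h hx, h hx]

theorem remainder₂_congr (h : EqOn A A' Ω) (r : ℂ) (η : Euc n) (V : Euc n → ℝ)
    (As : Euc n → Euc n) (b ψ : Euc n → ℂ) :
    EqOn (remainder₂ r η A V As b ψ) (remainder₂ r η A' V As b ψ) Ω := fun x hx => by
  simp only [remainder₂, q₂, divergence_congr h hx, h hx]

theorem volumeTerm_congr (h : EqOn A A' Ω) (V : Euc n → ℝ) (r : ℂ) (η₁ η₂ : Euc n)
    (As₂ : Euc n → Euc n) (b ψ₁ ψ₂ : Euc n → ℂ) :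
    volumeTerm Ω A V r η₁ η₂ As₂ b ψ₁ ψ₂ = volumeTerm Ω A' V r η₁ η₂ As₂ b ψ₁ ψ₂ :=
  setIntegral_congr_fun Ω.isOpen.measurableSet fun x hx => by
    simp only [remainder₂_congr h r η₂ V As₂ b ψ₂ hx]

theorem boundaryTerm_congr (h : EqOn A A' (closure (Ω : Set (Euc n)))) (r : ℂ) (η₁ η₂ : Euc n)
    (b ψ₁ ψ₂ : Euc n → ℂ) :
    boundaryTerm Ω A r η₁ η₂ b ψ₁ ψ₂ = boundaryTerm Ω A' r η₁ η₂ b ψ₁ ψ₂ :=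
  congrArg (Complex.I * ·) <| setIntegral_congr_fun isClosed_frontier.measurableSet fun x hx => by
    simp only [h (frontier_subset_closure hx)]

theorem resolventTerm_congr (h : EqOn A A' Ω) (V : Euc n → ℝ) (lam r : ℂ) (η₁ η₂ : Euc n)
    (As₁ As₂ : Euc n → Euc n) (b ψ₁ ψ₂ : Euc n → ℂ) :
    resolventTerm Ω A V lam r η₁ η₂ As₁ As₂ b ψ₁ ψ₂
      = resolventTerm Ω A' V lam r η₁ η₂ As₁ As₂ b ψ₁ ψ₂ := by
  have source_eq : toL2 Ω (fun y => remainder₁ r η₁ A V As₁ ψ₁ y * ansatz₁ r η₁ ψ₁ y)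
      = toL2 Ω fun y => remainder₁ r η₁ A' V As₁ ψ₁ y * ansatz₁ r η₁ ψ₁ y :=
    toL2_congr fun x hx => by simp only [remainder₁_congr h r η₁ V As₁ ψ₁ hx]
  rw [resolventTerm, resolventTerm, schrodingerResolvent_congr h, source_eq]
  exact setIntegral_congr_fun Ω.isOpen.measurableSet fun x hx => by
    simp only [remainder₂_congr h r η₂ V As₂ b ψ₂ hx]

end Congruence

/-! ### Magnetic potentials that are Lipschitz on the closed domain -/

section LipschitzPotential

variable {n : ℕ} {Ω : Opens (Euc n)} {A : Euc n → Euc n} {V : Euc n → ℝ} {K : ℝ≥0} {lam r : ℂ}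
  {η₁ η₂ : Euc n} {As₁ As₂ : Euc n → Euc n} {ψ₁ ψ₂ b : Euc n → ℂ}

theorem exists_locallyLipschitz_eqOn_closure
    (hA : LipschitzOnWith K A (closure (Ω : Set (Euc n)))) :
    ∃ A' : Euc n → Euc n, LocallyLipschitz A' ∧ EqOn A A' (closure (Ω : Set (Euc n))) := by
  obtain ⟨A', hA', hAA'⟩ := hA.extend_finite_dimension
  exact ⟨A', hA'.locallyLipschitz, hAA'⟩

theorem volumeTerm_eq_add (hΩb : Bornology.IsBounded (Ω : Set (Euc n)))
    (hA : LipschitzOnWith K A (closure (Ω : Set (Euc n))))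
    (hV : MemLp V (⊤ : ℝ≥0∞) (volume.restrict (Ω : Set (Euc n)))) (hη₂ : ‖η₂‖ = 1)
    (hψ₁ : IsTransportPhase η₁ As₁ ψ₁) (hψ₂ : IsTransportPhase η₂ As₂ ψ₂)
    (hb : IsAmplitude η₂ b) :
    volumeTerm Ω A V r η₁ η₂ As₂ b ψ₁ ψ₂
      = 2 * r * (∫ x in (Ω : Set (Euc n)),
          rdot η₂ (A x - As₂ x) * expFactor₁₂ r η₁ η₂ ψ₁ ψ₂ x * b x)
        + ∫ x in (Ω : Set (Euc n)),
          ((V x : ℂ) * b x - q₂ A b ψ₂ x) * expFactor₁₂ r η₁ η₂ ψ₁ ψ₂ x := by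
  obtain ⟨A', hA', hAA'⟩ := exists_locallyLipschitz_eqOn_closure hA
  have int_remainder : IntegrableOn
      (fun x => remainder₂ r η₂ A V As₂ b ψ₂ x * expFactor₁₂ r η₁ η₂ ψ₁ ψ₂ x)
      (Ω : Set (Euc n)) :=
    (integrableOn_remainder₂_mul_expFactor₁₂ (r := r) hΩb hA' hV hη₂ hψ₁ hψ₂ hb).congr_fun
      (fun x hx => by
        simp only [remainder₂_congr (hAA'.mono subset_closure) r η₂ V As₂ b ψ₂ hx])
      Ω.isOpen.measurableSet
  have cont_A : ContinuousOn (fun x => rdot η₂ (A x)) (closure (Ω : Set (Euc n))) :=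
    (contDiff_rdot η₂).continuous.comp_continuousOn hA.continuousOn
  have cont_exp : Continuous (expFactor₁₂ r η₁ η₂ ψ₁ ψ₂) := by
    simp only [← funext (ansatz₁_mul_expFactor₂ r η₁ η₂ ψ₁ ψ₂), expFactor₂_eq]
    exact (isLocallyC11_ansatz₁ hψ₁).contDiff.continuous.mul
      (contDiff_wave hψ₂.contDiff).continuous
  have cont : ContinuousOn (fun x => rdot η₂ (A x - As₂ x) * expFactor₁₂ r η₁ η₂ ψ₁ ψ₂ x * b x)
      (closure (Ω : Set (Euc n))) := by
    simp only [rdot_sub]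
    exact ((cont_A.sub hψ₂.continuous_rdot.continuousOn).mul cont_exp.continuousOn).mul
      hb.isLocallyC11.contDiff.continuous.continuousOn
  have int_leading : IntegrableOn
      (fun x => rdot η₂ (A x - As₂ x) * expFactor₁₂ r η₁ η₂ ψ₁ ψ₂ x * b x) Ω :=
    (cont.integrableOn_compact hΩb.isCompact_closure).mono_set subset_closure
  rw [volumeTerm, ← integral_const_mul, ← sub_eq_iff_eq_add',
    ← integral_sub int_remainder (int_leading.const_mul _)]
  refine integral_congr_ae (ae_of_all _ fun x => ?_)
  simp only [remainder₂]
  ring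

theorem pairingS_eq (hΩb : Bornology.IsBounded (Ω : Set (Euc n)))
    (hΩ : HasC1Boundary (Ω : Set (Euc n)))
    (hA : LipschitzOnWith K A (closure (Ω : Set (Euc n))))
    (hV : MemLp V (⊤ : ℝ≥0∞) (volume.restrict (Ω : Set (Euc n)))) (hr : (r ^ 2).im ≠ 0)
    (hη₁ : ‖η₁‖ = 1) (hη₂ : ‖η₂‖ = 1) (hψ₁ : IsTransportPhase η₁ As₁ ψ₁)
    (hψ₂ : IsTransportPhase η₂ As₂ ψ₂) (hb : IsAmplitude η₂ b) :
    pairingS Ω A V (r ^ 2) r η₁ η₂ b ψ₁ ψ₂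
      = volumeTerm Ω A V r η₁ η₂ As₂ b ψ₁ ψ₂ - boundaryTerm Ω A r η₁ η₂ b ψ₁ ψ₂
        - resolventTerm Ω A V (r ^ 2) r η₁ η₂ As₁ As₂ b ψ₁ ψ₂ := by
  obtain ⟨A', hA', hAA'⟩ := exists_locallyLipschitz_eqOn_closure hA
  have hAA'Ω : EqOn A A' Ω := hAA'.mono subset_closure
  rw [pairingS_congr hAA'Ω, volumeTerm_congr hAA'Ω, boundaryTerm_congr hAA',
    resolventTerm_congr hAA'Ω]
  exact pairingS_eq_of_locallyLipschitz hΩb hΩ hA' hV hr hη₁ hη₂ hψ₁ hψ₂ hb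

theorem resolventExists_of_lipschitzOnWith (hΩb : Bornology.IsBounded (Ω : Set (Euc n)))
    (hA : LipschitzOnWith K A (closure (Ω : Set (Euc n))))
    (hV : MemLp V (⊤ : ℝ≥0∞) (volume.restrict (Ω : Set (Euc n)))) (hlam : lam.im ≠ 0) :
    ResolventExists Ω A V lam := by
  obtain ⟨A', hA', hAA'⟩ := exists_locallyLipschitz_eqOn_closure hA
  rw [resolventExists_congr (hAA'.mono subset_closure)]
  exact resolventExists (boundedCoefficients hΩb hA' hV) hlam

theorem existsUnique_isDirichletSolution_ansatz₁ (hΩb : Bornology.IsBounded (Ω : Set (Euc n)))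
    (hA : LipschitzOnWith K A (closure (Ω : Set (Euc n))))
    (hV : MemLp V (⊤ : ℝ≥0∞) (volume.restrict (Ω : Set (Euc n)))) (hr : (r ^ 2).im ≠ 0)
    (hη₁ : ‖η₁‖ = 1) (hψ₁ : IsTransportPhase η₁ As₁ ψ₁) :
    ∃! u : L2 Ω, IsDirichletSolution A V (r ^ 2) (toL2 Ω (ansatz₁ r η₁ ψ₁)) u := by
  obtain ⟨A', hA', hAA'⟩ := exists_locallyLipschitz_eqOn_closure hA
  rw [isDirichletSolution_congr (hAA'.mono subset_closure)]
  exact existsUnique_isDirichletSolution (boundedCoefficients hΩb hA' hV) hr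
    (solvesMagnetic_ansatz₁ hΩb hA' hV hη₁ hψ₁)

end LipschitzPotential

end MagneticSchrodinger

theorem propositionl1_general {n : ℕ} {Ω : Opens (Euc n)}
    (hΩb : Bornology.IsBounded (Ω : Set (Euc n))) (hΩ : HasC1Boundary (Ω : Set (Euc n)))
    {A : Euc n → Euc n} {K : ℝ≥0} (hA : LipschitzOnWith K A (closure (Ω : Set (Euc n))))
    {V : Euc n → ℝ} (hV : MemLp V (⊤ : ℝ≥0∞) (volume.restrict (Ω : Set (Euc n))))
    {lam r : ℂ} (hlam : lam.im ≠ 0) (hr : r ^ 2 = lam)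
    {η₁ η₂ : Euc n} (hη₁ : ‖η₁‖ = 1) (hη₂ : ‖η₂‖ = 1)
    {As₁ As₂ : Euc n → Euc n} {ψ₁ ψ₂ b : Euc n → ℂ} (hψ₁ : IsTransportPhase η₁ As₁ ψ₁)
    (hψ₂ : IsTransportPhase η₂ As₂ ψ₂) (hb : IsAmplitude η₂ b) :
    ResolventExists Ω A V lam ∧
    (∃! u : L2 Ω, IsDirichletSolution A V lam (toL2 Ω (ansatz₁ r η₁ ψ₁)) u) ∧
    pairingS Ω A V lam r η₁ η₂ b ψ₁ ψ₂ =
      2 * r * (∫ x in (Ω : Set (Euc n)),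
          rdot η₂ (A x - As₂ x) * expFactor₁₂ r η₁ η₂ ψ₁ ψ₂ x * b x)
      + (∫ x in (Ω : Set (Euc n)),
          ((V x : ℂ) * b x - q₂ A b ψ₂ x) * expFactor₁₂ r η₁ η₂ ψ₁ ψ₂ x)
      - boundaryTerm Ω A r η₁ η₂ b ψ₁ ψ₂
      - resolventTerm Ω A V lam r η₁ η₂ As₁ As₂ b ψ₁ ψ₂ ∧
    pairingS Ω A V lam r η₁ η₂ b ψ₁ ψ₂ =
      volumeTerm Ω A V r η₁ η₂ As₂ b ψ₁ ψ₂
      - boundaryTerm Ω A r η₁ η₂ b ψ₁ ψ₂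
      - resolventTerm Ω A V lam r η₁ η₂ As₁ As₂ b ψ₁ ψ₂ := by
  subst hr
  have pairing_eq := pairingS_eq hΩb hΩ hA hV hlam hη₁ hη₂ hψ₁ hψ₂ hb
  refine ⟨resolventExists_of_lipschitzOnWith hΩb hA hV hlam,
    existsUnique_isDirichletSolution_ansatz₁ hΩb hA hV hlam hη₁ hψ₁, ?_, pairing_eq⟩
  rw [pairing_eq, volumeTerm_eq_add hΩb hA hV hη₂ hψ₁ hψ₂ hb]

theorem propositionl1 {n : ℕ} (hn : 2 ≤ n)
    (Ω : Opens (Euc n)) (hΩ : IsAdmissibleDomain Ω)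
    (A₁ A₂ : Euc n → Euc n)
    (hA₁ : ContDiffOn ℝ 1 A₁ (closure (Ω : Set (Euc n))))
    (hA₂ : ContDiffOn ℝ 1 A₂ (closure (Ω : Set (Euc n))))
    (V₁ V₂ : Euc n → ℝ)
    (hV₁ : MemLp V₁ (⊤ : ℝ≥0∞) (volume.restrict (Ω : Set (Euc n))))
    (hV₂ : MemLp V₂ (⊤ : ℝ≥0∞) (volume.restrict (Ω : Set (Euc n))))
    (As₁ As₂ : Euc n → Euc n)
    (hAs₁ : ContDiff ℝ ∞ As₁) (hAs₁c : HasCompactSupport As₁)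
    (hAs₂ : ContDiff ℝ ∞ As₂) (hAs₂c : HasCompactSupport As₂)
    (lam r : ℂ) (hlam : lam.im ≠ 0) (hr : r ^ 2 = lam)
    (η₁ η₂ : Euc n) (hη₁ : ‖η₁‖ = 1) (hη₂ : ‖η₂‖ = 1)
    (ψ₁ ψ₂ : Euc n → ℂ) (hψ₁ : ψ₁ = phase η₁ As₁) (hψ₂ : ψ₂ = phase η₂ As₂)
    (b₂ : Euc n → ℂ) (hb₂ : IsW2Infty b₂) (hηb₂ : ∀ x, toC η₂ ⬝ᵥ grad b₂ x = 0) :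
    (ResolventExists Ω A₁ V₁ lam ∧ ResolventExists Ω A₂ V₂ lam) ∧
    ((∃! u : L2 Ω, IsDirichletSolution A₁ V₁ lam (toL2 Ω (ansatz₁ r η₁ ψ₁)) u) ∧
      (∃! u : L2 Ω, IsDirichletSolution A₂ V₂ lam (toL2 Ω (ansatz₁ r η₁ ψ₁)) u)) ∧
    pairingS Ω A₁ V₁ lam r η₁ η₂ b₂ ψ₁ ψ₂ =
      2 * r * (∫ x in (Ω : Set (Euc n)),
          rdot η₂ (A₁ x - As₂ x) * expFactor₁₂ r η₁ η₂ ψ₁ ψ₂ x * b₂ x)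
      + (∫ x in (Ω : Set (Euc n)),
          ((V₁ x : ℂ) * b₂ x - q₂ A₁ b₂ ψ₂ x) * expFactor₁₂ r η₁ η₂ ψ₁ ψ₂ x)
      - Complex.I * (∫ x, expFactor₁₂ r η₁ η₂ ψ₁ ψ₂ x *
          (((b₂ x * r) • toC η₂ + b₂ x • grad ψ₂ x + Complex.I • grad b₂ x + b₂ x • toC (A₁ x))
            ⬝ᵥ toC (outwardNormal (Ω : Set (Euc n)) x)) ∂(surfaceMeasure (Ω : Set (Euc n))))
      - (∫ x in (Ω : Set (Euc n)),
          schrodingerResolvent Ω A₁ V₁ lam (toL2 Ω (fun y =>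
            (2 * r * rdot η₁ (A₁ y - As₁ y) + q₁ A₁ V₁ ψ₁ y) * ansatz₁ r η₁ ψ₁ y)) x
          * (2 * r * rdot η₂ (A₁ x - As₂ x) * b₂ x + (V₁ x : ℂ) * b₂ x - q₂ A₁ b₂ ψ₂ x)
          * expFactor₂ r η₂ ψ₂ x) ∧
    pairingS Ω A₂ V₂ lam r η₁ η₂ b₂ ψ₁ ψ₂ =
      (∫ x in (Ω : Set (Euc n)),
          (2 * r * rdot η₂ (A₂ x - As₂ x) * b₂ x + (V₂ x : ℂ) * b₂ x - q₂ A₂ b₂ ψ₂ x)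
            * expFactor₁₂ r η₁ η₂ ψ₁ ψ₂ x)
      - Complex.I * (∫ x, expFactor₁₂ r η₁ η₂ ψ₁ ψ₂ x *
          (((b₂ x * r) • toC η₂ + b₂ x • grad ψ₂ x + Complex.I • grad b₂ x + b₂ x • toC (A₂ x))
            ⬝ᵥ toC (outwardNormal (Ω : Set (Euc n)) x)) ∂(surfaceMeasure (Ω : Set (Euc n))))
      - (∫ x in (Ω : Set (Euc n)),
          schrodingerResolvent Ω A₂ V₂ lam (toL2 Ω (fun y =>
            (2 * r * rdot η₁ (A₂ y - As₁ y) + q₁ A₂ V₂ ψ₁ y) * ansatz₁ r η₁ ψ₁ y)) x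
          * (2 * r * rdot η₂ (A₂ x - As₂ x) * b₂ x + (V₂ x : ℂ) * b₂ x - q₂ A₂ b₂ ψ₂ x)
          * expFactor₂ r η₂ ψ₂ x) := by
  subst hψ₁ hψ₂
  have hΩ₁ := hΩ.c11.hasC1Boundary
  obtain ⟨_, lip₁⟩ := exists_lipschitzOnWith_closure_of_contDiffOn Ω.isOpen hΩ.bounded hΩ₁ hA₁
  obtain ⟨_, lip₂⟩ := exists_lipschitzOnWith_closure_of_contDiffOn Ω.isOpen hΩ.bounded hΩ₁ hA₂
  have phase₁ := isTransportPhase_phase hη₁ (contDiff_infty.1 hAs₁ 2) hAs₁c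
  have phase₂ := isTransportPhase_phase hη₂ (contDiff_infty.1 hAs₂ 2) hAs₂c
  have amplitude := hb₂.isAmplitude hηb₂
  have h₁ := propositionl1_general hΩ.bounded hΩ₁ lip₁ hV₁ hlam hr hη₁ hη₂ phase₁ phase₂ amplitude
  have h₂ := propositionl1_general hΩ.bounded hΩ₁ lip₂ hV₂ hlam hr hη₁ hη₂ phase₁ phase₂ amplitude
  exact ⟨⟨h₁.1, h₂.1⟩, ⟨h₁.2.1, h₂.2.1⟩, h₁.2.2.1, h₂.2.2.2⟩
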